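/- **Setting.** Let $k$ be a field and $G$ a group. A *Hopf $G$-coalgebra* $H$ is a family of unital $k$-algebras $(H_x)_{x\in G}$ with algebra maps $\Delta_{x,y}\colon H_{xy}\to H_x\otimes H_y$ and $\varepsilon\colon H_1\to k$ and linear maps $S_x\colon H_x\to H_{x^{-1}}$ such that, for all $x,y,z\in G$, $$(\Delta_{x,y}\otimes\mathrm{id})\Delta_{xy,z}=(\mathrm{id}\otimes\Delta_{y,z})\Delta_{x,yz},\qquad (\mathrm{id}\otimes\varepsilon)\Delta_{x,1}=\mathrm{id}=(\varepsilon\otimes\mathrm{id})\Delta_{1,x},$$ $$m_x(S_{x^{-1}}\otimes\mathrm{id})\Delta_{x^{-1},x}=\varepsilon(-)1_x=m_x(\mathrm{id}\otimes S_{x^{-1}})\Delta_{x,x^{-1}}.$$ It is *pivotal* if it is equipped with a family of invertible elements $g_x\in H_x$ with $\Delta_{x,y}(g_{xy})=g_x\otimes g_y$, $\varepsilon(g_1)=1$ and $S_{x^{-1}}S_x(a)=g_xag_x^{-1}$ for $a\in H_x$, and of *finite type* if every $H_x$ is finite-dimensional. We write $\Delta_{x,y}(a)=a_{(1,x)}\otimes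 a_{(2,y)}$. Let $H\text{-mod}$ be the monoidal category of finite-dimensional modules $V=\bigoplus_{x\in G}V_x$ with $V_x$ an $H_x$-module and $V_x=0$ for almost all $x$; the summand $V_x\otimes W_y$ of $V\otimes W$ lies in degree $xy$ and is acted on through $\Delta_{x,y}$. The dual $V^*$ carries the action $(af)(v)=f(S(a)v)$, with $\mathrm{ev}_V(f\otimes v)=f(v)$, $\mathrm{coev}_V(1)=\sum_i v_i\otimes v_i^*$, $\widetilde{\mathrm{ev}}_V(v\otimes f)=f(gv)$, $\widetilde{\mathrm{coev}}_V(1)=\sum_i v_i^*\otimes g^{-1}v_i$. Let $H\text{-pmod}$ be the full subcategory of projective objects, a left and right module category over $H\text{-mod}$ under $\otimes$. For an algebra map $\alpha\colon H_1\to k$ let $R(\alpha),L(\alpha)$ be the families of algebra automorphisms of the $H_x$ $$R(\alpha)_x(a)=\alpha(a_{(1,1)})\,a_{(2,x)},\qquad L(\alpha)_x(a)=a_{(1,x)}\,\alpha(a_{(2,1)}),$$ and let $R(\alpha)_*$, $L(\alpha)_*$ be the endofunctors of $H\text{-pmod}$ that pull back the action along them. $R(\alpha)_*$ is a right, and $L(\alpha)_*$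 a left, module functor, with identity maps as structure isomorphisms $\sigma$. For a right module endofunctor $\Sigma$ of $H\text{-pmod}$, a *right module trace* on $(H\text{-pmod},\Sigma)$ is a family of $k$-linear maps $t_P\colon\mathrm{Hom}(P,\Sigma P)\to k$, $P\in H\text{-pmod}$, such that $t_X(f\circ u)=t_Y(\Sigma(u)\circ f)$ for all $u\colon X\to Y$, $f\colon Y\to\Sigma X$, and $$t_{P\otimes V}(f)=t_P\bigl((\mathrm{id}_{\Sigma P}\otimes\widetilde{\mathrm{ev}}_V)\circ((\sigma_{P,V}\circ f)\otimes\mathrm{id}_{V^*})\circ(\mathrm{id}_P\otimes\mathrm{coev}_V)\bigr)$$ for all $P\in H\text{-pmod}$, $V\in H\text{-mod}$, $f\colon P\otimes V\to\Sigma(P\otimes V)$. For a left module endofunctor, a *left module trace* is defined in the same way, with the second condition replaced by $$t_{V\otimes P}(f)=t_P\bigl((\mathrm{ev}_V\otimes\mathrm{id}_{\Sigma P})\circ(\mathrm{id}_{V^*}\otimes(\sigma_{V,P}\circ f))\circ(\widetilde{\mathrm{coev}}_V\otimes\mathrm{id}_P)\bigr)$$ for $f\colon V\otimes P\to\Sigma(V\otimes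 P)$. A trace $t$ is *non-degenerate* if for all $P,P'$ the pairing $\mathrm{Hom}(P',\Sigma P)\times\mathrm{Hom}(P,P')\to k$, $(f,u)\mapsto t_P(f\circ u)$, is non-degenerate in both arguments. A *right* (resp. *left*) *$G$-integral* is a family $\mu=(\mu_x)\in\prod_xH_x^*$ with $(\mu_x\otimes\mathrm{id})\Delta_{x,y}(a)=\mu_{xy}(a)1_y$ (resp. $(\mathrm{id}\otimes\mu_y)\Delta_{x,y}(a)=\mu_{xy}(a)1_x$) for all $x,y\in G$ and $a\in H_{xy}$. For a right $G$-integral $\mu$ and a left $G$-integral $\mu^l$ put $\hat\mu_x(a)=\mu_x(g_xa)$ and $\hat\mu^l_x(a)=\mu^l_x(g_x^{-1}a)$; these are the *$\alpha$-symmetrised* right and left $G$-integrals, where $\alpha$ is the *modulus* of $H_1$, that is, the algebra map $\alpha\colon H_1\to k$ such that $ca=\alpha(a)c$ for all $a\in H_1$, where $c\neq0$ is a left cointegral ($ac=\varepsilon(a)c$ for all $a\in H_1$). **Theorem.** Let $(H,g)$ be a pivotal Hopf $G$-coalgebra of finite type over a field $k$ and let $\alpha$ be the modulus of $H_1$. (Right.)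 There is a linear isomorphism $t\mapsto\hat\mu$ from the space of right module traces on $(H\text{-pmod},R(\alpha)_*)$ onto the space of $\alpha$-symmetrised right $G$-integrals such that $$t_{H_x}(f)=\hat\mu_x(f(1_x))\qquad\text{for all } x\in G,\ f\in\mathrm{Hom}_{H_x}(H_x,R(\alpha)_*H_x).$$ The space of these traces is one-dimensional, and every nonzero one is non-degenerate. (Left.) There is a linear isomorphism $t\mapsto\hat\mu^l$ from the space of left module traces on $(H\text{-pmod},L(\alpha)_*)$ onto the space of $\alpha$-symmetrised left $G$-integrals such that $$t_{H_x}(f)=\hat\mu^l_x(f(1_x))\qquad\text{for all } x\in G,\ f\in\mathrm{Hom}_{H_x}(H_x,L(\alpha)_*H_x).$$ The space of these traces is one-dimensional, and every nonzero one is non-degenerate. -/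

import Mathlib

universe u w
open TensorProduct CategoryTheory
/-- Hopf `G`-coalgebras over `k`: unital algebras `A x` for `x : G`, with algebra maps
`Δ x y : A (x y) → A x ⊗ A y` and `ε : A 1 → k` and linear maps `S x : A x → A x⁻¹` satisfying
coassociativity, the counit axioms and the antipode axioms. The maps `AlgEquiv.cast` are the
identifications `A x = A y` for `x = y`. -/
structure HopfGCoalgebra (k : Type u) [Field k] (G : Type w) [Group G] where
  A : G → Type u
  [ring : ∀ x, Ring (A x)]
  [algebra : ∀ x, Algebra k (A x)]
  Δ : ∀ x y, A (x * y) →ₐ[k] A x ⊗[k] A y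
  ε : A 1 →ₐ[k] k
  S : ∀ x, A x →ₗ[k] A x⁻¹
  coassoc : ∀ (x y z : G) (a : A (x * y * z)),
    TensorProduct.assoc k (A x) (A y) (A z)
        ((Δ x y).toLinearMap.rTensor (A z) (Δ (x * y) z a)) =
      (Δ y z).toLinearMap.lTensor (A x)
        (Δ x (y * z) (AlgEquiv.cast (R := k) (A := A) (mul_assoc x y z) a))
  counit_right : ∀ (x : G) (a : A (x * 1)),
    TensorProduct.rid k (A x) (ε.toLinearMap.lTensor (A x) (Δ x 1 a)) =
      AlgEquiv.cast (R := k) (A := A) (mul_one x) a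
  counit_left : ∀ (x : G) (a : A (1 * x)),
    TensorProduct.lid k (A x) (ε.toLinearMap.rTensor (A x) (Δ 1 x a)) =
      AlgEquiv.cast (R := k) (A := A) (one_mul x) a
  antipode_left : ∀ (x : G) (a : A (x⁻¹ * x)),
    LinearMap.mul' k (A x)
        (((AlgEquiv.cast (R := k) (A := A) (inv_inv x)).toLinearMap ∘ₗ S x⁻¹).rTensor (A x)
          (Δ x⁻¹ x a)) =
      algebraMap k (A x) (ε (AlgEquiv.cast (R := k) (A := A) (inv_mul_cancel x) a))
  antipode_right : ∀ (x : G) (a : A (x * x⁻¹)),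
    LinearMap.mul' k (A x)
        (((AlgEquiv.cast (R := k) (A := A) (inv_inv x)).toLinearMap ∘ₗ S x⁻¹).lTensor (A x)
          (Δ x x⁻¹ a)) =
      algebraMap k (A x) (ε (AlgEquiv.cast (R := k) (A := A) (mul_inv_cancel x) a))

namespace HopfGCoalgebra
variable {k : Type u} [Field k] {G : Type w} [Group G]
attribute [instance] HopfGCoalgebra.ring HopfGCoalgebra.algebra
variable (H : HopfGCoalgebra k G)

/-- The identification `A x = A y` for `x = y`. -/
abbrev tr {x y : G} (h : x = y) : H.A x ≃ₐ[k] H.A y := AlgEquiv.cast (R := k) (A := H.A) h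

@[simp] theorem tr_sec {x y : G} (h : x = y) (a : ∀ x, H.A x) : H.tr h (a x) = a y := by
  subst h; rfl
@[simp] theorem tr_rfl {x : G} (h : x = x) (a : H.A x) : H.tr h a = a := rfl

theorem tr_tr {x y z : G} (h : x = y) (h' : y = z) (a : H.A x) :
   H.tr h' (H.tr h a) = H.tr (h.trans h') a := by subst h; subst h'; rfl

/-- The coproduct with the relation between the three degrees as an argument. -/
def cop {x y z : G} (h : x * y = z) : H.A z →ₐ[k] H.A x ⊗[k] H.A y :=
  (H.Δ x y).comp (H.tr h.symm).toAlgHom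

/-- The antipode with the degree of the target as an argument. -/
def anti {x y : G} (h : x⁻¹ = y) : H.A x →ₗ[k] H.A y :=
  (H.tr h).toLinearMap ∘ₗ H.S x

theorem cop_rfl (x y : G) : H.cop (rfl : x * y = x * y) = H.Δ x y := rfl

theorem cop_coassoc {x y z p q r : G} (h₁ : x * y = p) (h₂ : p * z = r) (h₃ : y * z = q)
    (h₄ : x * q = r) (a : H.A r) :
    TensorProduct.assoc k _ _ _ ((H.cop h₁).toLinearMap.rTensor _ (H.cop h₂ a)) =
      (H.cop h₃).toLinearMap.lTensor _ (H.cop h₄ a) := by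
  subst h₁ h₃ h₂
  exact H.coassoc x y z a

theorem cop_counit_right {x y : G} (h : x * 1 = y) (hxy : y = x) (a : H.A y) :
    TensorProduct.rid k _ (H.ε.toLinearMap.lTensor _ (H.cop h a)) = H.tr hxy a := by
  subst h
  exact H.counit_right x a

theorem cop_counit_left {x y : G} (h : 1 * x = y) (hxy : y = x) (a : H.A y) :
    TensorProduct.lid k _ (H.ε.toLinearMap.rTensor _ (H.cop h a)) = H.tr hxy a := by
  subst h
  exact H.counit_left x a

theorem anti_left {x y : G} (h : y * x = 1) (h' : y⁻¹ = x) (a : H.A 1) :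
    LinearMap.mul' k _ ((H.anti h').rTensor _ (H.cop h a)) = algebraMap k _ (H.ε a) := by
  obtain rfl : y = x⁻¹ := by rw [← h', inv_inv]
  refine (H.antipode_left x _).trans ?_
  congr 2
  exact H.tr_tr h.symm h a

theorem anti_right {x y : G} (h : x * y = 1) (h' : y⁻¹ = x) (a : H.A 1) :
    LinearMap.mul' k _ ((H.anti h').lTensor _ (H.cop h a)) = algebraMap k _ (H.ε a) := by
  obtain rfl : y = x⁻¹ := by rw [← h', inv_inv]
  refine (H.antipode_right x _).trans ?_
  congr 2
  exact H.tr_tr h.symm h a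

theorem anti_one {x y : G} (h : x⁻¹ = y) : H.anti h 1 = 1 := by
  have := H.anti_left (x := y) (y := x) (by simp [← h]) h 1
  simpa [Algebra.TensorProduct.one_def] using this

/-- The linear map `b ⊗ c ↦ b c`, the second factor being read in the opposite algebra. -/
def mulUnop (y : G) : H.A y ⊗[k] (H.A y)ᵐᵒᵖ →ₗ[k] H.A y :=
  LinearMap.mul' k (H.A y) ∘ₗ
    (MulOpposite.opLinearEquiv k (M := H.A y)).symm.toLinearMap.lTensor (H.A y)

theorem mulUnop_mul (y : G) (p q : H.A y ⊗[k] (H.A y)ᵐᵒᵖ) (c : k)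
    (hq : H.mulUnop y q = algebraMap k _ c) :
    H.mulUnop y (p * q) = c • H.mulUnop y p := by
  induction p with
  | zero => simp
  | add p p' hp hp' => simp [add_mul, hp, hp']
  | tmul b d =>
    have key : ∀ q, H.mulUnop y (b ⊗ₜ d * q) = b * H.mulUnop y q * d.unop := by
      intro q
      induction q with
      | zero => simp
      | add q q' hp hp' => simp [mul_add, add_mul, hp, hp']
      | tmul b' d' => simp [mulUnop, mul_assoc]
    rw [key, hq]
    simp [mulUnop, Algebra.algebraMap_eq_smul_one]

/-- The linear map `a ⊗ b ⊗ c ↦ a ⊗ b ⊗ S c`. -/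
def hat {x y : G} (h : x⁻¹ = y) :
    H.A x ⊗[k] (H.A y ⊗[k] H.A x) →ₗ[k] H.A x ⊗[k] (H.A y ⊗[k] (H.A y)ᵐᵒᵖ) :=
  (((MulOpposite.opLinearEquiv k (M := H.A y)).toLinearMap ∘ₗ H.anti h).lTensor
    (H.A y)).lTensor (H.A x)

/-- The bilinear map `(a ⊗ b ⊗ c, a' ⊗ b' ⊗ c') ↦ S(a a') b b' S(c') S(c)`. -/
def triple {x y : G} (h : x⁻¹ = y) :
    H.A x ⊗[k] (H.A y ⊗[k] H.A x) →ₗ[k] H.A x ⊗[k] (H.A y ⊗[k] H.A x) →ₗ[k] H.A y :=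
  ((TensorProduct.map₂ (LinearMap.mul k (H.A x))
    (LinearMap.mul k (H.A y ⊗[k] (H.A y)ᵐᵒᵖ))).compl₁₂ (H.hat h) (H.hat h)).compr₂
    (LinearMap.mul' k (H.A y) ∘ₗ TensorProduct.map (H.anti h) (H.mulUnop y))

theorem triple_lTensor {x y : G} (h : x⁻¹ = y) (hyx : y * x = 1) (p q : H.A x ⊗[k] H.A 1) :
    H.triple h ((H.cop hyx).toLinearMap.lTensor _ p) ((H.cop hyx).toLinearMap.lTensor _ q) =
      H.anti h (TensorProduct.rid k _ (H.ε.toLinearMap.lTensor _ p) *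
        TensorProduct.rid k _ (H.ε.toLinearMap.lTensor _ q)) := by
  have hv : ∀ v : H.A 1, H.mulUnop y
      (((MulOpposite.opLinearEquiv k (M := H.A y)).toLinearMap ∘ₗ H.anti h).lTensor _
        (H.cop hyx v)) = algebraMap k _ (H.ε v) := by
    intro v
    rw [← H.anti_right hyx h v]
    simp only [mulUnop, LinearMap.comp_apply, ← LinearMap.lTensor_comp_apply]
    congr 2
  induction p with
  | zero => simp
  | add p p' hp hp' => simp only [map_add, LinearMap.add_apply, add_mul, hp, hp']
  | tmul u v =>
    induction q with
    | zero => simp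
    | add p p' hp hp' => simp only [map_add, mul_add, hp, hp']
    | tmul u' v' =>
      have h1 : H.triple h (u ⊗ₜ H.cop hyx v) (u' ⊗ₜ H.cop hyx v') =
          H.anti h (u * u') * H.mulUnop y
            (((MulOpposite.opLinearEquiv k (M := H.A y)).toLinearMap ∘ₗ H.anti h).lTensor _
              (H.cop hyx v) *
            ((MulOpposite.opLinearEquiv k (M := H.A y)).toLinearMap ∘ₗ H.anti h).lTensor _
              (H.cop hyx v')) := by
        simp only [triple, LinearMap.compr₂_apply, LinearMap.compl₁₂_apply, hat,
          LinearMap.lTensor_tmul, TensorProduct.map₂_apply_tmul, LinearMap.mul_apply',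
          LinearMap.comp_apply, TensorProduct.map_tmul, LinearMap.mul'_apply]
      simp only [LinearMap.lTensor_tmul, AlgHom.toLinearMap_apply, h1]
      rw [H.mulUnop_mul y _ _ _ (hv v'), hv v]
      simp [Algebra.algebraMap_eq_smul_one, smul_smul]

theorem triple_rTensor {x y : G} (h : x⁻¹ = y) (hxy : x * y = 1) (p q : H.A 1 ⊗[k] H.A x) :
    H.triple h (TensorProduct.assoc k _ _ _ ((H.cop hxy).toLinearMap.rTensor _ p))
        (TensorProduct.assoc k _ _ _ ((H.cop hxy).toLinearMap.rTensor _ q)) =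
      H.anti h (TensorProduct.lid k _ (H.ε.toLinearMap.rTensor _ q)) *
        H.anti h (TensorProduct.lid k _ (H.ε.toLinearMap.rTensor _ p)) := by
  have key : ∀ (s t : H.A x ⊗[k] H.A y) (u u' : H.A x),
      H.triple h (TensorProduct.assoc k _ _ _ (s ⊗ₜ u))
          (TensorProduct.assoc k _ _ _ (t ⊗ₜ u')) =
        LinearMap.mul' k _ ((H.anti h).rTensor _ (s * t)) * (H.anti h u' * H.anti h u) := by
    intro s t u u'
    induction s with
    | zero => simp
    | add p p' hp hp' =>
      simp only [map_add, LinearMap.add_apply, add_mul, TensorProduct.add_tmul, hp, hp']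
    | tmul a b =>
      induction t with
      | zero => simp
      | add p p' hp hp' =>
        simp only [map_add, mul_add, add_mul, TensorProduct.add_tmul, hp, hp']
      | tmul a' b' =>
        simp [triple, hat, mulUnop, mul_assoc]
  induction p with
  | zero => simp
  | add p p' hp hp' => simp only [map_add, LinearMap.add_apply, mul_add, hp, hp']
  | tmul u v =>
    induction q with
    | zero => simp
    | add p p' hp hp' => simp only [map_add, add_mul, hp, hp']
    | tmul u' v' =>
      simp only [LinearMap.rTensor_tmul, AlgHom.toLinearMap_apply, key, ← map_mul,
        H.anti_left hxy h, TensorProduct.lid_tmul]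
      simp [Algebra.algebraMap_eq_smul_one, smul_smul]

theorem anti_mul {x y : G} (h : x⁻¹ = y) (a b : H.A x) :
    H.anti h (a * b) = H.anti h b * H.anti h a := by
  have hyx : y * x = 1 := by simp [← h]
  have hxy : x * y = 1 := by simp [← h]
  have e (a : H.A x) := H.cop_coassoc hxy (one_mul x) hyx (mul_one x) a
  have ha := H.triple_lTensor h hyx (H.cop (mul_one x) a) (H.cop (mul_one x) b)
  rw [← e, ← e, H.triple_rTensor, H.cop_counit_right _ rfl, H.cop_counit_right _ rfl,
    H.cop_counit_left _ rfl, H.cop_counit_left _ rfl] at ha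
  simpa using ha.symm

end HopfGCoalgebra

namespace HopfGCoalgebra
variable {k : Type u} [Field k] {G : Type w} [Group G] (H : HopfGCoalgebra k G)

/-- The finite-dimensional modules `V = ⨁ V_x` over `H`, where `V_x` is an `H_x`-module and
`V_x = 0` for almost all `x`. Such a module is the same as a finite-dimensional representation of
the algebra of all families `(a_x)` that only depends on finitely many of the `a_x`; the
summand `V_x` is the image of the idempotent `1_x`. -/
structure Rep where
  V : Type u
  [addCommGroup : AddCommGroup V]
  [module : Module k V]
  [finite : FiniteDimensional k V]
  ρ : (∀ x, H.A x) →ₐ[k] Module.End k V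
  finite_support : ∃ s : Finset G, ∀ a : ∀ x, H.A x, (∀ x ∈ s, a x = 0) → ρ a = 0

namespace Rep
attribute [instance] Rep.addCommGroup Rep.module Rep.finite
variable {H}

open scoped Classical in
/-- The action of `H_x`. -/
noncomputable def act (V : H.Rep) (x : G) : H.A x →ₗ[k] Module.End k V.V :=
  V.ρ.toLinearMap ∘ₗ LinearMap.single k H.A x

theorem act_mul (V : H.Rep) (x : G) (a b : H.A x) : V.act x (a * b) = V.act x a * V.act x b := by
  classical
  simp only [act, LinearMap.comp_apply, LinearMap.single_apply, AlgHom.toLinearMap_apply,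
    ← map_mul, Pi.single_mul]

theorem act_mul_ne (V : H.Rep) {x y : G} (h : x ≠ y) (a : H.A x) (b : H.A y) :
    V.act x a * V.act y b = 0 := by
  classical
  have : (Pi.single x a * Pi.single y b : ∀ x, H.A x) = 0 := by
    ext z
    by_cases hz : z = x
    · subst hz; simp [Pi.single_eq_of_ne h]
    · simp [Pi.single_eq_of_ne hz]
  simp only [act, LinearMap.comp_apply, LinearMap.single_apply, AlgHom.toLinearMap_apply,
    ← map_mul, this, map_zero]

/-- `s` contains the support of `V`. -/
def SupportedOn (V : H.Rep) (s : Finset G) : Prop :=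
  ∀ a : ∀ x, H.A x, (∀ x ∈ s, a x = 0) → V.ρ a = 0

theorem act_eq_zero {V : H.Rep} {s : Finset G} (hs : V.SupportedOn s) {x : G} (hx : x ∉ s)
    (a : H.A x) : V.act x a = 0 := by
  classical
  exact hs _ fun y hy => Pi.single_eq_of_ne (by rintro rfl; exact hx hy) a

theorem ρ_eq_sum {V : H.Rep} {s : Finset G} (hs : V.SupportedOn s) (a : ∀ x, H.A x) :
    V.ρ a = ∑ x ∈ s, V.act x (a x) := by
  classical
  have h := hs (a - ∑ x ∈ s, Pi.single x (a x)) (fun x hx => by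
    simp [Finset.sum_apply, Finset.sum_pi_single, hx])
  rw [map_sub, sub_eq_zero, map_sum] at h
  rw [h]; rfl

theorem ρ_mul_act (V : H.Rep) (a : ∀ x, H.A x) (x : G) (b : H.A x) :
    V.ρ a * V.act x b = V.act x (a x * b) := by
  classical
  simp only [act, LinearMap.comp_apply, LinearMap.single_apply, AlgHom.toLinearMap_apply,
    ← map_mul]
  congr 1
  ext z
  by_cases hz : z = x
  · subst hz; simp
  · simp [Pi.single_eq_of_ne hz]

theorem act_mul_ρ (V : H.Rep) (a : ∀ x, H.A x) (x : G) (b : H.A x) :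
    V.act x b * V.ρ a = V.act x (b * a x) := by
  classical
  simp only [act, LinearMap.comp_apply, LinearMap.single_apply, AlgHom.toLinearMap_apply,
    ← map_mul]
  congr 1
  ext z
  by_cases hz : z = x
  · subst hz; simp
  · simp [Pi.single_eq_of_ne hz]

/-- The linear maps `V → W` commuting with the action of `H`. -/
def intertwiners (V W : H.Rep) : Submodule k (V.V →ₗ[k] W.V) where
  carrier := {f | ∀ (a : ∀ x, H.A x) (v : V.V), f (V.ρ a v) = W.ρ a (f v)}
  zero_mem' := by simp
  add_mem' hf hg a v := by simp [hf a v, hg a v]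
  smul_mem' c f hf a v := by simp [hf a v]

/-- Morphisms are the `H`-linear maps. -/
instance : Category H.Rep where
  Hom V W := intertwiners V W
  id V := ⟨LinearMap.id, fun _ _ => rfl⟩
  comp f g := ⟨g.1 ∘ₗ f.1, fun a v => by simp [f.2 a v, g.2 a (f.1 v)]⟩

/-- The underlying linear map of a morphism. -/
def lin {V W : H.Rep} (f : V ⟶ W) : V.V →ₗ[k] W.V := Subtype.val f

theorem lin_comm {V W : H.Rep} (f : V ⟶ W) (a : ∀ x, H.A x) (v : V.V) :
    lin f (V.ρ a v) = W.ρ a (lin f v) := f.2 a v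

/-- Morphisms from linear maps. -/
def ofLin {V W : H.Rep} (f : V.V →ₗ[k] W.V)
    (hf : ∀ (a : ∀ x, H.A x) (v : V.V), f (V.ρ a v) = W.ρ a (f v)) : V ⟶ W :=
  ⟨f, hf⟩

theorem hom_ext {V W : H.Rep} {f g : V ⟶ W} (h : lin f = lin g) : f = g := Subtype.ext h

@[simp] theorem lin_id (V : H.Rep) : lin (𝟙 V) = LinearMap.id := rfl
@[simp] theorem lin_comp {U V W : H.Rep} (f : U ⟶ V) (g : V ⟶ W) :
    lin (f ≫ g) = lin g ∘ₗ lin f := rfl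
@[simp] theorem lin_ofLin {V W : H.Rep} (f : V.V →ₗ[k] W.V) (hf) :
    lin (ofLin f hf : V ⟶ W) = f := rfl

instance : Preadditive H.Rep where
  homGroup V W := inferInstanceAs (AddCommGroup (intertwiners V W))
  add_comp U V W f f' g := hom_ext (LinearMap.comp_add _ _ _)
  comp_add U V W f g g' := hom_ext (LinearMap.add_comp _ _ _)

instance : Linear k H.Rep where
  homModule V W := inferInstanceAs (Module k (intertwiners V W))
  smul_comp U V W c f g := hom_ext (LinearMap.comp_smul _ _ _)
  comp_smul U V W f c g := hom_ext (LinearMap.smul_comp _ _ _)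

@[simp] theorem lin_add {V W : H.Rep} (f g : V ⟶ W) : lin (f + g) = lin f + lin g := rfl
@[simp] theorem lin_smul {V W : H.Rep} (c : k) (f : V ⟶ W) : lin (c • f) = c • lin f := rfl

/-- Isomorphisms from linear equivalences. -/
def isoOfLin {V W : H.Rep} (f : V.V ≃ₗ[k] W.V)
    (hf : ∀ (a : ∀ x, H.A x) (v : V.V), f (V.ρ a v) = W.ρ a (f v)) : V ≅ W where
  hom := ofLin f.toLinearMap hf
  inv := ofLin f.symm.toLinearMap fun a v => by
    apply f.injective
    simp [hf]
  hom_inv_id := hom_ext (by ext; simp)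
  inv_hom_id := hom_ext (by ext; simp)

/-- The action of `H_x ⊗ H_y` on `V ⊗ W`. -/
noncomputable def act₂ (V W : H.Rep) (x y : G) :
    H.A x ⊗[k] H.A y →ₗ[k] Module.End k (V.V ⊗[k] W.V) :=
  (Module.endTensorEndAlgHom (R := k) (S := k) (A := k) (M := V.V) (N := W.V)).toLinearMap ∘ₗ
    TensorProduct.map (V.act x) (W.act y)

@[simp] theorem act₂_tmul (V W : H.Rep) (x y : G) (a : H.A x) (b : H.A y) :
    act₂ V W x y (a ⊗ₜ b) = TensorProduct.map (V.act x a) (W.act y b) := rfl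

theorem act₂_mul (V W : H.Rep) (x y : G) (s t : H.A x ⊗[k] H.A y) :
    act₂ V W x y (s * t) = act₂ V W x y s * act₂ V W x y t := by
  induction s with
  | zero => simp
  | add p p' hp hp' => simp only [map_add, add_mul, hp, hp']
  | tmul a b =>
    induction t with
    | zero => simp
    | add p p' hp hp' => simp only [map_add, mul_add, hp, hp']
    | tmul a' b' => simp [act_mul, TensorProduct.map_mul]

theorem act₂_mul_ne (V W : H.Rep) {x y x' y' : G} (h : (x, y) ≠ (x', y')) (s : H.A x ⊗[k] H.A y)
    (t : H.A x' ⊗[k] H.A y') : act₂ V W x y s * act₂ V W x' y' t = 0 := by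
  induction s with
  | zero => simp
  | add p p' hp hp' => simp only [map_add, add_mul, hp, hp', add_zero]
  | tmul a b =>
    induction t with
    | zero => simp
    | add p p' hp hp' => simp only [map_add, mul_add, hp, hp', add_zero]
    | tmul a' b' =>
      rw [act₂_tmul, act₂_tmul, ← TensorProduct.map_mul]
      by_cases hx : x = x'
      · have hy : y ≠ y' := fun hy => h (by rw [hx, hy])
        rw [act_mul_ne _ hy, TensorProduct.map_zero_right]
      · rw [act_mul_ne _ hx, TensorProduct.map_zero_left]

theorem act₂_eq_zero {V W : H.Rep} {s t : Finset G} (hs : V.SupportedOn s) (ht : W.SupportedOn t)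
    {x y : G} (h : ¬ (x ∈ s ∧ y ∈ t)) (c : H.A x ⊗[k] H.A y) : act₂ V W x y c = 0 := by
  induction c with
  | zero => simp
  | add p p' hp hp' => simp only [map_add, hp, hp', add_zero]
  | tmul a b =>
    rw [act₂_tmul]
    by_cases hx : x ∈ s
    · rw [act_eq_zero ht (fun hy => h ⟨hx, hy⟩), TensorProduct.map_zero_right]
    · rw [act_eq_zero hs hx, TensorProduct.map_zero_left]

/-- The action of a family `a = (a_z)` on `V ⊗ W`: on the summand `V_x ⊗ W_y` it is given by
`Δ_{x,y}(a_{xy})`. -/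
noncomputable def tensorAct (V W : H.Rep) (a : ∀ x, H.A x) : Module.End k (V.V ⊗[k] W.V) :=
  ∑ᶠ p : G × G, act₂ V W p.1 p.2 (H.Δ p.1 p.2 (a (p.1 * p.2)))

theorem tensorAct_eq {V W : H.Rep} {s t : Finset G} (hs : V.SupportedOn s)
    (ht : W.SupportedOn t) (a : ∀ x, H.A x) :
    tensorAct V W a = ∑ p ∈ s ×ˢ t, act₂ V W p.1 p.2 (H.Δ p.1 p.2 (a (p.1 * p.2))) := by
  apply finsum_eq_sum_of_support_subset
  intro p hp
  by_contra h
  exact hp (act₂_eq_zero hs ht (by simpa using h) _)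

theorem tensorAct_one (V W : H.Rep) : tensorAct V W 1 = 1 := by
  obtain ⟨s, hs⟩ := V.finite_support
  obtain ⟨t, ht⟩ := W.finite_support
  have h1 := ρ_eq_sum hs 1
  have h2 := ρ_eq_sum ht 1
  rw [map_one] at h1 h2
  simp only [tensorAct_eq hs ht, Pi.one_apply, map_one, Algebra.TensorProduct.one_def, act₂_tmul]
  rw [← TensorProduct.map_one, h1, h2, Finset.sum_product]
  ext v w
  simp only [TensorProduct.sum_tmul, TensorProduct.tmul_sum, LinearMap.sum_apply,
    TensorProduct.AlgebraTensorModule.curry_apply, TensorProduct.curry_apply,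
    LinearMap.coe_restrictScalars, TensorProduct.map_tmul, Pi.one_apply]
  rw [Finset.sum_comm]

theorem tensorAct_mul (V W : H.Rep) (a b : ∀ x, H.A x) :
    tensorAct V W (a * b) = tensorAct V W a * tensorAct V W b := by
  obtain ⟨s, hs⟩ := V.finite_support
  obtain ⟨t, ht⟩ := W.finite_support
  rw [tensorAct_eq hs ht, tensorAct_eq hs ht, tensorAct_eq hs ht, Finset.sum_mul_sum]
  refine Finset.sum_congr rfl fun p hp => ?_
  rw [Finset.sum_eq_single p]
  · rw [← act₂_mul, ← map_mul, Pi.mul_apply]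
  · intro q _ hq
    exact act₂_mul_ne V W (x := p.1) (y := p.2) (x' := q.1) (y' := q.2) (fun h => hq h.symm) _ _
  · exact fun h => absurd hp h

/-- `tensorAct` as a linear map of the family `a`. -/
noncomputable def tensorActLin (V W : H.Rep) :
    (∀ x, H.A x) →ₗ[k] Module.End k (V.V ⊗[k] W.V) where
  toFun := tensorAct V W
  map_add' a b := by
    obtain ⟨s, hs⟩ := V.finite_support
    obtain ⟨t, ht⟩ := W.finite_support
    simp only [tensorAct_eq hs ht, Pi.add_apply, map_add, Finset.sum_add_distrib]
  map_smul' c a := by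
    obtain ⟨s, hs⟩ := V.finite_support
    obtain ⟨t, ht⟩ := W.finite_support
    simp only [tensorAct_eq hs ht, Pi.smul_apply, map_smul, Finset.smul_sum, RingHom.id_apply]

theorem tensorAct_support [DecidableEq G] {V W : H.Rep} {s t : Finset G} (hs : V.SupportedOn s)
    (ht : W.SupportedOn t) (a : ∀ x, H.A x)
    (ha : ∀ x ∈ (s ×ˢ t).image fun p => p.1 * p.2, a x = 0) : tensorAct V W a = 0 := by
  rw [tensorAct_eq hs ht]
  refine Finset.sum_eq_zero fun p hp => ?_
  rw [ha _ (Finset.mem_image_of_mem _ hp), map_zero, map_zero]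

/-- The tensor product of two modules. -/
noncomputable abbrev tensor (V W : H.Rep) : H.Rep where
  V := V.V ⊗[k] W.V
  ρ := AlgHom.ofLinearMap (tensorActLin V W) (tensorAct_one V W) (tensorAct_mul V W)
  finite_support := by
    classical
    obtain ⟨s, hs⟩ := V.finite_support
    obtain ⟨t, ht⟩ := W.finite_support
    exact ⟨_, tensorAct_support hs ht⟩

theorem tensor_ρ (V W : H.Rep) (a : ∀ x, H.A x) : (tensor V W).ρ a = tensorAct V W a := rfl

end Rep
end HopfGCoalgebra

namespace HopfGCoalgebra
variable {k : Type u} [Field k] {G : Type w} [Group G] {H : HopfGCoalgebra k G}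
namespace Rep

theorem act₂_apply (V W : H.Rep) (x y : G) (c : H.A x ⊗[k] H.A y) (v : V.V) (w : W.V) :
    act₂ V W x y c (v ⊗ₜ w) = TensorProduct.map ((V.act x).flip v) ((W.act y).flip w) c := by
  induction c with
  | zero => simp
  | add p p' hp hp' => simp only [map_add, LinearMap.add_apply, hp, hp']
  | tmul a b => simp

theorem tensor_ρ_tmul {V W : H.Rep} {s t : Finset G} (hs : V.SupportedOn s)
    (ht : W.SupportedOn t) (a : ∀ x, H.A x) (v : V.V) (w : W.V) :
    (tensor V W).ρ a (v ⊗ₜ w) = ∑ x ∈ s, ∑ y ∈ t,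
      TensorProduct.map ((V.act x).flip v) ((W.act y).flip w) (H.Δ x y (a (x * y))) := by
  rw [tensor_ρ, tensorAct_eq hs ht, LinearMap.sum_apply, Finset.sum_product]
  simp only [act₂_apply]

open scoped Classical in
theorem tensor_act_flip {V W : H.Rep} {s t : Finset G} (hs : V.SupportedOn s)
    (ht : W.SupportedOn t) (p : G) (v : V.V) (w : W.V) :
    ((tensor V W).act p).flip (v ⊗ₜ w) = ∑ x ∈ s, ∑ y ∈ t, if h : x * y = p then
      TensorProduct.map ((V.act x).flip v) ((W.act y).flip w) ∘ₗ (H.cop h).toLinearMap else 0 := by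
  ext b
  simp only [LinearMap.flip_apply, act, LinearMap.comp_apply, AlgHom.toLinearMap_apply,
    LinearMap.single_apply]
  rw [tensor_ρ_tmul hs ht]
  simp only [LinearMap.sum_apply]
  refine Finset.sum_congr rfl fun x _ => Finset.sum_congr rfl fun y _ => ?_
  split_ifs with h
  · subst h
    simp only [Pi.single_eq_same]
    rfl
  · simp [Pi.single_eq_of_ne h]

theorem supportedOn_tensor [DecidableEq G] {V W : H.Rep} {s t : Finset G} (hs : V.SupportedOn s)
    (ht : W.SupportedOn t) : (tensor V W).SupportedOn ((s ×ˢ t).image fun p => p.1 * p.2) := by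
  exact tensorAct_support hs ht

theorem tensor_tensor_left {U V W : H.Rep} {r s t : Finset G} (hr : U.SupportedOn r)
    (hs : V.SupportedOn s) (ht : W.SupportedOn t) (a : ∀ x, H.A x) (u : U.V) (v : V.V) (w : W.V) :
    (tensor (tensor U V) W).ρ a ((u ⊗ₜ v) ⊗ₜ w) = ∑ x ∈ r, ∑ y ∈ s, ∑ z ∈ t,
      TensorProduct.map (TensorProduct.map ((U.act x).flip u) ((V.act y).flip v))
        ((W.act z).flip w)
        ((H.Δ x y).toLinearMap.rTensor _ (H.Δ (x * y) z (a (x * y * z)))) := by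
  classical
  rw [tensor_ρ_tmul (supportedOn_tensor hr hs) ht]
  have key : ∀ p (c : ∀ p z, H.A p ⊗[k] H.A z),
      ∑ z ∈ t, TensorProduct.map (((tensor U V).act p).flip (u ⊗ₜ v)) ((W.act z).flip w) (c p z) =
      ∑ x ∈ r, ∑ y ∈ s, if x * y = p then ∑ z ∈ t,
        TensorProduct.map (TensorProduct.map ((U.act x).flip u) ((V.act y).flip v))
        ((W.act z).flip w)
        ((H.Δ x y).toLinearMap.rTensor _ (c (x * y) z)) else 0 := by
    intro p c
    rw [tensor_act_flip hr hs]
    simp only [← TensorProduct.mapBilinear_apply, map_sum, LinearMap.sum_apply]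
    rw [Finset.sum_comm]
    refine Finset.sum_congr rfl fun x _ => ?_
    rw [Finset.sum_comm]
    refine Finset.sum_congr rfl fun y _ => ?_
    split_ifs with h
    · subst h
      refine Finset.sum_congr rfl fun z _ => ?_
      simp only [TensorProduct.mapBilinear_apply, cop_rfl]
      rw [← LinearMap.map_comp_rTensor, LinearMap.comp_apply]
    · simp
  simp only [key _ fun p z => H.Δ p z (a (p * z))]
  rw [Finset.sum_comm]
  refine Finset.sum_congr rfl fun x hx => ?_
  rw [Finset.sum_comm]
  refine Finset.sum_congr rfl fun y hy => ?_
  rw [Finset.sum_ite_eq, if_pos (Finset.mem_image.2 ⟨(x, y), by simp [hx, hy], rfl⟩)]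

theorem tensor_tensor_right {U V W : H.Rep} {r s t : Finset G} (hr : U.SupportedOn r)
    (hs : V.SupportedOn s) (ht : W.SupportedOn t) (a : ∀ x, H.A x) (u : U.V) (v : V.V) (w : W.V) :
    (tensor U (tensor V W)).ρ a (u ⊗ₜ (v ⊗ₜ w)) = ∑ x ∈ r, ∑ y ∈ s, ∑ z ∈ t,
      TensorProduct.map ((U.act x).flip u)
        (TensorProduct.map ((V.act y).flip v) ((W.act z).flip w))
        ((H.Δ y z).toLinearMap.lTensor _ (H.Δ x (y * z) (a (x * (y * z))))) := by
  classical
  rw [tensor_ρ_tmul hr (supportedOn_tensor hs ht)]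
  refine Finset.sum_congr rfl fun x hx => ?_
  have key : ∀ p (c : ∀ p, H.A x ⊗[k] H.A p),
      TensorProduct.map ((U.act x).flip u) (((tensor V W).act p).flip (v ⊗ₜ w)) (c p) =
      ∑ y ∈ s, ∑ z ∈ t, if y * z = p then
        TensorProduct.map ((U.act x).flip u)
        (TensorProduct.map ((V.act y).flip v) ((W.act z).flip w))
        ((H.Δ y z).toLinearMap.lTensor _ (c (y * z))) else 0 := by
    intro p c
    rw [tensor_act_flip hs ht]
    simp only [← TensorProduct.mapBilinear_apply, map_sum, LinearMap.sum_apply]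
    refine Finset.sum_congr rfl fun y _ => Finset.sum_congr rfl fun z _ => ?_
    split_ifs with h
    · subst h
      simp only [TensorProduct.mapBilinear_apply, cop_rfl]
      rw [← LinearMap.map_comp_lTensor, LinearMap.comp_apply]
    · simp
  simp only [key _ fun p => H.Δ x p (a (x * p))]
  rw [Finset.sum_comm]
  refine Finset.sum_congr rfl fun y hy => ?_
  rw [Finset.sum_comm]
  refine Finset.sum_congr rfl fun z hz => ?_
  rw [Finset.sum_ite_eq, if_pos (Finset.mem_image.2 ⟨(y, z), by simp [hy, hz], rfl⟩)]

theorem assoc_comm (U V W : H.Rep) (a : ∀ x, H.A x) (q : (U.V ⊗[k] V.V) ⊗[k] W.V) :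
    TensorProduct.assoc k _ _ _ ((tensor (tensor U V) W).ρ a q) =
      (tensor U (tensor V W)).ρ a (TensorProduct.assoc k _ _ _ q) := by
  obtain ⟨r, hr⟩ := U.finite_support
  obtain ⟨s, hs⟩ := V.finite_support
  obtain ⟨t, ht⟩ := W.finite_support
  induction q with
  | zero => simp
  | add p p' hp hp' => simp only [map_add, hp, hp']
  | tmul q w =>
    induction q with
    | zero => simp
    | add p p' hp hp' => simp only [map_add, TensorProduct.add_tmul, hp, hp']
    | tmul u v =>
      rw [TensorProduct.assoc_tmul, tensor_tensor_right hr hs ht, tensor_tensor_left hr hs ht]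
      simp only [map_sum]
      refine Finset.sum_congr rfl fun x hx => Finset.sum_congr rfl fun y hy =>
        Finset.sum_congr rfl fun z hz => ?_
      have := H.coassoc x y z (a (x * y * z))
      rw [H.tr_sec] at this
      rw [← this, TensorProduct.map_map_assoc]

theorem map_comm {V V' W W' : H.Rep} (f : V ⟶ V') (g : W ⟶ W') (a : ∀ x, H.A x)
    (q : V.V ⊗[k] W.V) :
    TensorProduct.map (lin f) (lin g) ((tensor V W).ρ a q) =
      (tensor V' W').ρ a (TensorProduct.map (lin f) (lin g) q) := by
  classical
  obtain ⟨s, hs⟩ := V.finite_support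
  obtain ⟨t, ht⟩ := W.finite_support
  obtain ⟨s', hs'⟩ := V'.finite_support
  obtain ⟨t', ht'⟩ := W'.finite_support
  have mono {V : H.Rep} {s s' : Finset G} (h : V.SupportedOn s) : V.SupportedOn (s ∪ s') :=
    fun a ha => h a fun x hx => ha x (Finset.mem_union_left _ hx)
  have mono' {V : H.Rep} {s s' : Finset G} (h : V.SupportedOn s) : V.SupportedOn (s' ∪ s) :=
    fun a ha => h a fun x hx => ha x (Finset.mem_union_right _ hx)
  have hf (x : G) (v : V.V) : lin f ∘ₗ (V.act x).flip v = (V'.act x).flip (lin f v) := by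
    ext b
    exact lin_comm f _ _
  have hg (x : G) (v : W.V) : lin g ∘ₗ (W.act x).flip v = (W'.act x).flip (lin g v) := by
    ext b
    exact lin_comm g _ _
  induction q with
  | zero => simp
  | add p p' hp hp' => simp only [map_add, hp, hp']
  | tmul v w =>
    rw [TensorProduct.map_tmul, tensor_ρ_tmul (mono (s' := s') hs) (mono (s' := t') ht),
      tensor_ρ_tmul (mono' hs') (mono' ht')]
    simp only [map_sum]
    refine Finset.sum_congr rfl fun x hx => Finset.sum_congr rfl fun y hy => ?_
    rw [← hf, ← hg, TensorProduct.map_comp, LinearMap.comp_apply]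

/-- The trivial module `k`, in degree `1`. -/
abbrev unit (H : HopfGCoalgebra k G) : H.Rep where
  V := k
  ρ := (Algebra.lmul k k).comp (H.ε.comp (Pi.evalAlgHom k H.A 1))
  finite_support := ⟨{1}, fun a ha => by simp [ha 1 (by simp)]⟩

theorem unit_ρ (a : ∀ x, H.A x) (c : k) : (unit H).ρ a c = H.ε (a 1) * c := rfl

theorem supportedOn_unit : (unit H).SupportedOn {1} := fun a ha => by
  apply LinearMap.ext
  intro c
  rw [unit_ρ, ha 1 (by simp)]
  simp

theorem unit_act_flip (c : k) : ((unit H).act 1).flip c = c • H.ε.toLinearMap := by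
  classical
  ext b
  have : (unit H).act 1 b c = H.ε ((Pi.single 1 b : ∀ x, H.A x) 1) * c := rfl
  rw [LinearMap.flip_apply, this]
  simp [mul_comm]

theorem lid_comm (V : H.Rep) (a : ∀ x, H.A x) (q : k ⊗[k] V.V) :
    TensorProduct.lid k _ ((tensor (unit H) V).ρ a q) = V.ρ a (TensorProduct.lid k _ q) := by
  obtain ⟨s, hs⟩ := V.finite_support
  induction q with
  | zero => simp
  | add p p' hp hp' => simp only [map_add, hp, hp']
  | tmul c v =>
    rw [tensor_ρ_tmul supportedOn_unit hs, Finset.sum_singleton, ρ_eq_sum hs, map_sum,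
      LinearMap.sum_apply]
    refine Finset.sum_congr rfl fun x hx => ?_
    have h := H.counit_left x (a (1 * x))
    rw [H.tr_sec] at h
    rw [← h, unit_act_flip]
    generalize H.Δ 1 x (a (1 * x)) = d
    induction d with
    | zero => simp
    | add p p' hp hp' => simp only [map_add, LinearMap.add_apply, hp, hp']
    | tmul b b' => simp [smul_smul]

theorem rid_comm (V : H.Rep) (a : ∀ x, H.A x) (q : V.V ⊗[k] k) :
    TensorProduct.rid k _ ((tensor V (unit H)).ρ a q) = V.ρ a (TensorProduct.rid k _ q) := by
  obtain ⟨s, hs⟩ := V.finite_support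
  induction q with
  | zero => simp
  | add p p' hp hp' => simp only [map_add, hp, hp']
  | tmul v c =>
    rw [tensor_ρ_tmul hs supportedOn_unit, ρ_eq_sum hs, map_sum, LinearMap.sum_apply]
    refine Finset.sum_congr rfl fun x hx => ?_
    rw [Finset.sum_singleton]
    have h := H.counit_right x (a (x * 1))
    rw [H.tr_sec] at h
    rw [← h, unit_act_flip]
    generalize H.Δ x 1 (a (x * 1)) = d
    induction d with
    | zero => simp
    | add p p' hp hp' => simp only [map_add, LinearMap.add_apply, hp, hp']
    | tmul b b' => simp [smul_smul]

noncomputable instance : MonoidalCategoryStruct H.Rep where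
  tensorObj := tensor
  whiskerLeft V _ _ f := ofLin ((lin f).lTensor V.V) (map_comm (𝟙 V) f)
  whiskerRight f W := ofLin ((lin f).rTensor W.V) (map_comm f (𝟙 W))
  tensorHom f g := ofLin (TensorProduct.map (lin f) (lin g)) (map_comm f g)
  tensorUnit := unit H
  associator U V W := isoOfLin (TensorProduct.assoc k U.V V.V W.V) (assoc_comm U V W)
  leftUnitor V := isoOfLin (TensorProduct.lid k V.V) (lid_comm V)
  rightUnitor V := isoOfLin (TensorProduct.rid k V.V) (rid_comm V)

/-- The forgetful functor to vector spaces. -/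
def forget (H : HopfGCoalgebra k G) : H.Rep ⥤ ModuleCat.{u} k where
  obj V := ModuleCat.of k V.V
  map f := ModuleCat.ofHom (lin f)

instance : (forget H).Faithful where
  map_injective h := hom_ext (ModuleCat.hom_ext_iff.1 h)

noncomputable instance : MonoidalCategory H.Rep :=
  Monoidal.induced (forget H)
    { μIso := fun X Y => Iso.refl _
      εIso := Iso.refl _
      whiskerLeft_eq := fun X Y₁ Y₂ f => by
        ext; rfl
      whiskerRight_eq := fun f Y => by
        ext; rfl
      tensorHom_eq := fun f g => by
        ext; rfl
      associator_eq := fun X Y Z =>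
        ModuleCat.hom_ext (TensorProduct.ext_threefold fun x y z => rfl)
      leftUnitor_eq := fun X =>
        ModuleCat.hom_ext (TensorProduct.ext' fun x y => rfl)
      rightUnitor_eq := fun X =>
        ModuleCat.hom_ext (TensorProduct.ext' fun x y => rfl) }

end Rep
end HopfGCoalgebra

/-- Pivotal Hopf `G`-coalgebras: Hopf `G`-coalgebras with a family of invertible elements `g_x`
such that `Δ_{x,y}(g_{xy}) = g_x ⊗ g_y`, `ε(g_1) = 1` and `S_{x⁻¹} S_x (a) = g_x a g_x⁻¹`. -/
structure PivotalHopfGCoalgebra (k : Type u) [Field k] (G : Type w) [Group G] extends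
    HopfGCoalgebra k G where
  g : ∀ x, (A x)ˣ
  Δ_g : ∀ x y, Δ x y (g (x * y) : A (x * y)) = (g x : A x) ⊗ₜ[k] (g y : A y)
  ε_g : ε (g 1 : A 1) = 1
  antipode_sq : ∀ (x : G) (a : A x),
    AlgEquiv.cast (R := k) (A := A) (inv_inv x) (S x⁻¹ (S x a)) = g x * a * ((g x)⁻¹ : (A x)ˣ)

namespace HopfGCoalgebra
variable {k : Type u} [Field k] {G : Type w} [Group G] {H : HopfGCoalgebra k G}

theorem cop_sec (H : HopfGCoalgebra k G) {x y z : G} (h : x * y = z) (a : ∀ x, H.A x) :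
    H.cop h (a z) = H.Δ x y (a (x * y)) := by
  subst h; rfl

/-- The family `x ↦ S_{x⁻¹}(a_{x⁻¹})`. -/
def antiSec (H : HopfGCoalgebra k G) (a : ∀ x, H.A x) (x : G) : H.A x := H.anti (inv_inv x) (a x⁻¹)

namespace Rep

/-- The dual module: `(a f)(v) = f(S(a) v)`. -/
abbrev dual (V : H.Rep) : H.Rep where
  V := Module.Dual k V.V
  ρ := AlgHom.ofLinearMap
    { toFun := fun a => (V.ρ (H.antiSec a)).dualMap
      map_add' := fun a b => by
        have : H.antiSec (a + b) = H.antiSec a + H.antiSec b := by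
          ext x; simp [antiSec]
        ext f v; simp [this]
      map_smul' := fun c a => by
        have : H.antiSec (c • a) = c • H.antiSec a := by
          ext x; simp [antiSec]
        ext f v; simp [this] }
    (by
      have : H.antiSec 1 = 1 := by
        ext x; simp [antiSec, anti_one]
      ext f v; simp [this])
    (fun a b => by
      have : H.antiSec (a * b) = H.antiSec b * H.antiSec a := by
        ext x; simp [antiSec, anti_mul]
      ext f v; simp [this])
  finite_support := by
    classical
    obtain ⟨s, hs⟩ := V.finite_support
    refine ⟨s.image fun x => x⁻¹, fun a ha => ?_⟩
    have := hs (H.antiSec a) (fun x hx => by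
      rw [antiSec, ha _ (Finset.mem_image_of_mem _ hx), map_zero])
    ext f v
    simp [this]

theorem dual_ρ (V : H.Rep) (a : ∀ x, H.A x) (f : Module.Dual k V.V) (v : V.V) :
    (dual V).ρ a f v = f (V.ρ (H.antiSec a) v) := rfl

theorem dual_act (V : H.Rep) {x y : G} (h : x⁻¹ = y) (a : H.A x) (f : Module.Dual k V.V) (v : V.V) :
    (dual V).act x a f v = f (V.act y (H.anti h a) v) := by
  classical
  subst h
  have : H.antiSec (Pi.single x a) = Pi.single x⁻¹ (H.anti rfl a) := by
    ext z
    by_cases hz : z = x⁻¹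
    · subst hz
      rw [antiSec, Pi.single_eq_same]
      have key : ∀ (y : G) (hy : y = x) (hy' : y⁻¹ = x⁻¹),
          H.anti hy' (Pi.single (M := H.A) x a y) = H.anti rfl a := by
        intro y hy
        subst hy
        intro _
        rw [Pi.single_eq_same]
      exact key _ (inv_inv x) _
    · rw [Pi.single_eq_of_ne hz, antiSec, Pi.single_eq_of_ne, map_zero]
      intro h; exact hz (by rw [← h, inv_inv])
  change f (V.ρ (H.antiSec (Pi.single x a)) v) = f (V.ρ (Pi.single x⁻¹ (H.anti rfl a)) v)
  rw [this]

theorem supportedOn_dual [DecidableEq G] {V : H.Rep} {s : Finset G} (hs : V.SupportedOn s) :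
    (dual V).SupportedOn (s.image fun x => x⁻¹) := by
  intro a ha
  have := hs (H.antiSec a) (fun x hx => by
    rw [antiSec, ha _ (Finset.mem_image_of_mem _ hx), map_zero])
  ext f v
  rw [dual_ρ, this]
  simp

/-- The isomorphism `v ⊗ f ↦ (w ↦ f w • v)`. -/
noncomputable def toEnd (V : H.Rep) : V.V ⊗[k] Module.Dual k V.V ≃ₗ[k] Module.End k V.V :=
  TensorProduct.comm k _ _ ≪≫ₗ dualTensorHomEquiv k V.V V.V

theorem toEnd_tmul (V : H.Rep) (v w : V.V) (f : Module.Dual k V.V) :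
    V.toEnd (v ⊗ₜ f) w = f w • v := by
  simp [toEnd]

theorem toEnd_coev (V : H.Rep) : V.toEnd (coevaluation k V.V 1) = LinearMap.id := by
  ext w
  rw [coevaluation_apply_one]
  simp only [map_sum, LinearMap.sum_apply, toEnd_tmul]
  exact (Module.Basis.ofVectorSpace k V.V).sum_repr w

theorem toEnd_act₂ (V : H.Rep) {x y : G} (q : V.V ⊗[k] Module.Dual k V.V) {y' : G} (h : y⁻¹ = y')
    (c : H.A x ⊗[k] H.A y) :
    V.toEnd (act₂ V (dual V) x y c q) = LinearMap.mul' k _ (TensorProduct.map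
      (LinearMap.mulRight k (V.toEnd q) ∘ₗ V.act x) (V.act y' ∘ₗ H.anti h) c) := by
  induction c with
  | zero => simp
  | add p p' hp hp' => simp only [map_add, LinearMap.add_apply, hp, hp']
  | tmul a b =>
    induction q with
    | zero => simp
    | add p p' hp hp' =>
      simp only [TensorProduct.map_tmul, LinearMap.comp_apply, LinearMap.mulRight_apply, LinearMap.mul'_apply, map_add, hp, hp', mul_add, add_mul]
    | tmul v f =>
      ext w
      have := dual_act V h b f w
      change V.toEnd (TensorProduct.map (V.act x a) ((dual V).act y b) (v ⊗ₜ f)) w = _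
      simp only [TensorProduct.map_tmul, toEnd_tmul, this, LinearMap.comp_apply,
        LinearMap.mul'_apply, LinearMap.mulRight_apply, Module.End.mul_apply, map_smul]

theorem coev_comm (V : H.Rep) (a : ∀ x, H.A x) (c : k) :
    coevaluation k V.V ((unit H).ρ a c) = (tensor V (dual V)).ρ a (coevaluation k V.V c) := by
  classical
  obtain ⟨s, hs⟩ := V.finite_support
  suffices h : (tensor V (dual V)).ρ a (coevaluation k V.V 1) =
      H.ε (a 1) • coevaluation k V.V 1 by
    have e : ∀ d : k, coevaluation k V.V d = d • coevaluation k V.V 1 := fun d => by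
      rw [← map_smul, smul_eq_mul, mul_one]
    rw [e c, map_smul, h, unit_ρ, e, mul_comm, mul_smul]
  apply V.toEnd.injective
  rw [tensor_ρ, tensorAct_eq hs (supportedOn_dual hs), LinearMap.sum_apply, map_sum, map_smul,
    toEnd_coev, Finset.sum_product]
  have h1 := ρ_eq_sum hs 1
  rw [map_one] at h1
  change _ = _ • (1 : Module.End k V.V)
  rw [h1, Finset.smul_sum]
  refine Finset.sum_congr rfl fun x hx => ?_
  rw [Finset.sum_eq_single x⁻¹]
  · rw [toEnd_act₂ V _ (inv_inv x), toEnd_coev]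
    have h := H.anti_right (mul_inv_cancel x) (inv_inv x) (a 1)
    have e : H.cop (mul_inv_cancel x) (a 1) = H.Δ x x⁻¹ (a (x * x⁻¹)) := by
      exact H.cop_sec _ a
    rw [e] at h
    rw [Pi.one_apply, ← map_smul, ← Algebra.algebraMap_eq_smul_one, ← h]
    generalize H.Δ x x⁻¹ (a (x * x⁻¹)) = d
    induction d with
    | zero => simp
    | add p p' hp hp' => simp only [map_add, hp, hp']
    | tmul b b' =>
      simp only [TensorProduct.map_tmul, LinearMap.comp_apply, LinearMap.mul'_apply, LinearMap.mulRight_apply, LinearMap.lTensor_tmul, act_mul]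
      rfl
  · intro y _ hy
    rw [toEnd_act₂ V _ rfl, toEnd_coev]
    generalize H.Δ x y (a (x * y)) = d
    induction d with
    | zero => simp
    | add p p' hp hp' => simp only [map_add, hp, hp', add_zero]
    | tmul b b' =>
      have : x ≠ y⁻¹ := fun h => hy (by rw [h, inv_inv])
      simp only [TensorProduct.map_tmul, LinearMap.comp_apply, LinearMap.mul'_apply, LinearMap.mulRight_apply]
      exact act_mul_ne V this _ _
  · exact fun h => absurd (Finset.mem_image_of_mem _ hx) h

theorem ev_comm (V : H.Rep) (a : ∀ x, H.A x) (q : Module.Dual k V.V ⊗[k] V.V) :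
    contractLeft k V.V ((tensor (dual V) V).ρ a q) = (unit H).ρ a (contractLeft k V.V q) := by
  classical
  obtain ⟨s, hs⟩ := V.finite_support
  induction q with
  | zero => simp
  | add p p' hp hp' => simp only [map_add, hp, hp']
  | tmul f v =>
    rw [tensor_ρ_tmul (supportedOn_dual hs) hs, unit_ρ, Finset.sum_comm, map_sum, contractLeft_apply]
    have h1 := ρ_eq_sum hs 1
    rw [map_one] at h1
    have hv : v = (1 : Module.End k V.V) v := rfl
    conv_rhs => rw [hv, h1, LinearMap.sum_apply, map_sum, Finset.mul_sum]
    refine Finset.sum_congr rfl fun x hx => ?_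
    have key : ∀ (y : G) (d : H.A y ⊗[k] H.A x),
      contractLeft k V.V (TensorProduct.map (((dual V).act y).flip f) ((V.act x).flip v) d) =
        f (LinearMap.mul' k _ (TensorProduct.map (V.act y⁻¹ ∘ₗ H.anti rfl) (V.act x) d) v) := by
      intro y d
      induction d with
      | zero => simp
      | add p p' hp hp' => simp only [map_add, LinearMap.add_apply, hp, hp']
      | tmul b b' =>
        simp only [TensorProduct.map_tmul, LinearMap.flip_apply, contractLeft_apply,
          LinearMap.comp_apply, LinearMap.mul'_apply, Module.End.mul_apply]
        exact dual_act V rfl b f _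
    rw [map_sum, Finset.sum_eq_single x⁻¹]
    · rw [key]
      have h := H.anti_left (inv_mul_cancel x) (inv_inv x) (a 1)
      have e : H.cop (inv_mul_cancel x) (a 1) = H.Δ x⁻¹ x (a (x⁻¹ * x)) := by
        exact H.cop_sec _ a
      rw [e] at h
      have e2 : LinearMap.mul' k _ (TensorProduct.map (V.act x⁻¹⁻¹ ∘ₗ H.anti rfl) (V.act x)
          (H.Δ x⁻¹ x (a (x⁻¹ * x)))) = H.ε (a 1) • V.act x 1 := by
        rw [← map_smul, ← Algebra.algebraMap_eq_smul_one, ← h]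
        have e3 : ∀ (z : G) (hz : x⁻¹⁻¹ = z) (b : H.A x⁻¹),
            V.act x⁻¹⁻¹ (H.anti rfl b) = V.act z (H.anti hz b) := by
          intro z hz b; subst hz; rfl
        generalize H.Δ x⁻¹ x (a (x⁻¹ * x)) = d
        induction d with
        | zero => simp
        | add p p' hp hp' => simp only [map_add, hp, hp']
        | tmul b b' =>
          simp only [TensorProduct.map_tmul, LinearMap.comp_apply, LinearMap.mul'_apply,
            LinearMap.rTensor_tmul, act_mul, e3 _ (inv_inv x)]
      rw [e2]
      simp
    · intro y _ hy
      rw [key]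
      generalize H.Δ y x (a (y * x)) = d
      induction d with
      | zero => simp
      | add p p' hp hp' => simp only [map_add, LinearMap.add_apply, hp, hp', add_zero]
      | tmul b b' =>
        have : y⁻¹ ≠ x := fun h => hy (by rw [← h, inv_inv])
        simp only [TensorProduct.map_tmul, LinearMap.comp_apply, LinearMap.mul'_apply]
        rw [act_mul_ne V this]
        simp
    · exact fun h => absurd (Finset.mem_image_of_mem _ hx) h

open MonoidalCategory

/-- The evaluation `f ⊗ v ↦ f v` and the coevaluation `1 ↦ ∑ vᵢ ⊗ vᵢ*`. -/
@[reducible]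
noncomputable def pairing (V : H.Rep) : ExactPairing V (dual V) where
  coevaluation' := ofLin (V := unit H) (W := tensor V (dual V)) (coevaluation k V.V) (coev_comm V)
  evaluation' := ofLin (V := tensor (dual V) V) (W := unit H) (contractLeft k V.V) (ev_comm V)
  coevaluation_evaluation' := hom_ext (contractLeft_assoc_coevaluation k V.V)
  evaluation_coevaluation' := hom_ext (contractLeft_assoc_coevaluation' k V.V)

end Rep
end HopfGCoalgebra

namespace CategoryTheory
open MonoidalCategory

/-- A choice, for every object `V`, of an object `V*` together with morphisms
`coev : 1 → V ⊗ V*`, `ev : V* ⊗ V → 1` and `coev' : 1 → V* ⊗ V`, `ev' : V ⊗ V* → 1`,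
both pairs satisfying the zig-zag identities. -/
class TwoSidedDuality (C : Type*) [Category C] [MonoidalCategory C] where
  dual : C → C
  rightPairing : ∀ V : C, ExactPairing V (dual V)
  leftPairing : ∀ V : C, ExactPairing (dual V) V

section
variable {C : Type*} [Category C] [MonoidalCategory C] [TwoSidedDuality C]
attribute [instance, reducible] TwoSidedDuality.rightPairing TwoSidedDuality.leftPairing

theorem projective_tensor_right {P : C} (hP : Projective P) (V : C) : Projective (P ⊗ V) := by
  have : (tensorRight (TwoSidedDuality.dual V)).PreservesEpimorphisms :=
    Functor.preservesEpimorphisms_of_adjunction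
      (tensorRightAdjunction (TwoSidedDuality.dual V) V)
  exact (tensorRightAdjunction V (TwoSidedDuality.dual V)).map_projective P hP

theorem projective_tensor_left {P : C} (hP : Projective P) (V : C) : Projective (V ⊗ P) := by
  have : (tensorLeft (TwoSidedDuality.dual V)).PreservesEpimorphisms :=
    Functor.preservesEpimorphisms_of_adjunction
      (tensorLeftAdjunction V (TwoSidedDuality.dual V))
  exact (tensorLeftAdjunction (TwoSidedDuality.dual V) V).map_projective P hP

/-- The right action of `C` on its projective objects by the tensor product. -/
noncomputable instance : MonoidalRightAction C (isProjective C).FullSubcategory where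
  actionObj P V := ⟨P.obj ⊗ V, projective_tensor_right P.property V⟩
  actionHomRight P _ _ f := ObjectProperty.homMk (P.obj ◁ f)
  actionHomLeft f V := ObjectProperty.homMk (f.hom ▷ V)
  actionHom f g := ObjectProperty.homMk (f.hom ⊗ₘ g)
  actionAssocIso P V W := (isProjective C).isoMk (α_ P.obj V W).symm
  actionUnitIso P := (isProjective C).isoMk (ρ_ P.obj)
  actionHom_def f g := by ext; exact MonoidalCategory.tensorHom_def _ _

/-- The left action of `C` on its projective objects by the tensor product. -/
noncomputable instance : MonoidalLeftAction C (isProjective C).FullSubcategory where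
  actionObj V P := ⟨V ⊗ P.obj, projective_tensor_left P.property V⟩
  actionHomRight V _ _ f := ObjectProperty.homMk (V ◁ f.hom)
  actionHomLeft f P := ObjectProperty.homMk (f ▷ P.obj)
  actionHom f g := ObjectProperty.homMk (f ⊗ₘ g.hom)
  actionAssocIso V W P := (isProjective C).isoMk (α_ V W P.obj)
  actionUnitIso P := (isProjective C).isoMk (λ_ P.obj)
  actionHom_def f g := by ext; exact MonoidalCategory.tensorHom_def _ _

section
open MonoidalRightAction
variable {D : Type*} [Category D] [MonoidalRightAction C D] (S : D ⥤ D) [S.RightLinear C]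

/-- The right partial trace
`(id_{S P} ⊙ ev'_V) ∘ ((δ_{P,V} ∘ f) ⊙ id_{V*}) ∘ (id_P ⊙ coev_V)` of `f : P ⊙ V → S (P ⊙ V)`. -/
noncomputable def rightPartialTrace {P : D} {V : C} (f : P ⊙ᵣ V ⟶ S.obj (P ⊙ᵣ V)) :
    P ⟶ S.obj P :=
  (ρᵣ[C] P).inv ≫ P ⊴ᵣ (η_ V (TwoSidedDuality.dual V)) ≫
    (αᵣ P V (TwoSidedDuality.dual V)).hom ≫
    (f ≫ Functor.OplaxRightLinear.δᵣ S P V) ⊵ᵣ TwoSidedDuality.dual V ≫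
    (αᵣ (S.obj P) V (TwoSidedDuality.dual V)).inv ≫
    S.obj P ⊴ᵣ (ε_ (TwoSidedDuality.dual V) V) ≫ (ρᵣ[C] (S.obj P)).hom
end
section
open MonoidalLeftAction
variable {D : Type*} [Category D] [MonoidalLeftAction C D] (S : D ⥤ D) [S.LeftLinear C]

/-- The left partial trace
`(ev_V ⊙ id_{S P}) ∘ (id_{V*} ⊙ (δ_{V,P} ∘ f)) ∘ (coev'_V ⊙ id_P)` of `f : V ⊙ P → S (V ⊙ P)`. -/
noncomputable def leftPartialTrace {P : D} {V : C} (f : V ⊙ₗ P ⟶ S.obj (V ⊙ₗ P)) :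
    P ⟶ S.obj P :=
  (λₗ[C] P).inv ≫ (η_ (TwoSidedDuality.dual V) V) ⊵ₗ P ≫
    (αₗ (TwoSidedDuality.dual V) V P).hom ≫
    TwoSidedDuality.dual V ⊴ₗ (f ≫ Functor.OplaxLeftLinear.δₗ S V P) ≫
    (αₗ (TwoSidedDuality.dual V) V (S.obj P)).inv ≫
    (ε_ V (TwoSidedDuality.dual V)) ⊵ₗ S.obj P ≫ (λₗ[C] (S.obj P)).hom
end

end

section
variable (k : Type*) [Field k] {D : Type*} [Category D] [Preadditive D] [Linear k D] (S : D ⥤ D)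

/-- Families of linear maps `t_P : Hom(P, S P) → k`. -/
abbrev TraceFamily := ∀ P : D, (P ⟶ S.obj P) →ₗ[k] k

variable {k S}

/-- `t_X(f ∘ g) = t_Y(S(g) ∘ f)` for all `g : X → Y` and `f : Y → S X`. -/
def IsSCyclic (t : TraceFamily k S) : Prop :=
  ∀ ⦃X Y : D⦄ (g : X ⟶ Y) (f : Y ⟶ S.obj X), t X (g ≫ f) = t Y (f ≫ S.map g)

/-- The pairings `Hom(P', S P) × Hom(P, P') → k`, `(f, g) ↦ t_P(f ∘ g)`, are non-degenerate
(in both arguments). -/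
def TraceNondegenerate (t : TraceFamily k S) : Prop :=
  ∀ P P' : D,
    (∀ f : P' ⟶ S.obj P, (∀ g : P ⟶ P', t P (g ≫ f) = 0) → f = 0) ∧
    (∀ g : P ⟶ P', (∀ f : P' ⟶ S.obj P, t P (g ≫ f) = 0) → g = 0)

variable (k S)

/-- The space of right module traces on `(D, S)`. -/
def rightModuleTraces (C : Type*) [Category C] [MonoidalCategory C] [TwoSidedDuality C]
    [MonoidalRightAction C D] [S.RightLinear C] : Submodule k (TraceFamily k S) where
  carrier := {t | IsSCyclic t ∧ ∀ (P : D) (V : C) (f : _ ⟶ _),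
    t (MonoidalRightAction.actionObj P V) f = t P (rightPartialTrace S f)}
  zero_mem' := ⟨fun _ _ _ _ => rfl, fun _ _ _ => rfl⟩
  add_mem' := fun {t t'} h h' => ⟨fun X Y g f => congrArg₂ (· + ·) (h.1 g f) (h'.1 g f),
    fun P V f => congrArg₂ (· + ·) (h.2 P V f) (h'.2 P V f)⟩
  smul_mem' := fun c t h => ⟨fun X Y g f => congrArg (c • ·) (h.1 g f),
    fun P V f => congrArg (c • ·) (h.2 P V f)⟩

/-- The space of left module traces on `(D, S)`. -/
def leftModuleTraces (C : Type*) [Category C] [MonoidalCategory C] [TwoSidedDuality C]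
    [MonoidalLeftAction C D] [S.LeftLinear C] : Submodule k (TraceFamily k S) where
  carrier := {t | IsSCyclic t ∧ ∀ (P : D) (V : C) (f : _ ⟶ _),
    t (MonoidalLeftAction.actionObj V P) f = t P (leftPartialTrace S f)}
  zero_mem' := ⟨fun _ _ _ _ => rfl, fun _ _ _ => rfl⟩
  add_mem' := fun {t t'} h h' => ⟨fun X Y g f => congrArg₂ (· + ·) (h.1 g f) (h'.1 g f),
    fun P V f => congrArg₂ (· + ·) (h.2 P V f) (h'.2 P V f)⟩
  smul_mem' := fun c t h => ⟨fun X Y g f => congrArg (c • ·) (h.1 g f),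
    fun P V f => congrArg (c • ·) (h.2 P V f)⟩
end

end CategoryTheory

namespace HopfGCoalgebra
variable {k : Type u} [Field k] {G : Type w} [Group G]

namespace Rep
open MonoidalCategory

section
variable {H : PivotalHopfGCoalgebra k G}

theorem anti_anti (a : ∀ x, H.A x) (x : G) :
    H.antiSec (H.antiSec a) x = H.g x * a x * ((H.g x)⁻¹ : (H.A x)ˣ) := by
  have key : ∀ (z : G) (_ : z = x) (h₁ : z⁻¹ = x⁻¹) (h₂ : x⁻¹⁻¹ = x),
      H.anti h₂ (H.anti h₁ (a z)) = H.g x * a x * ((H.g x)⁻¹ : (H.A x)ˣ) := by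
    intro z hz
    subst hz
    intro _ _
    exact H.antipode_sq z (a z)
  exact key _ (inv_inv x) (inv_inv x⁻¹) (inv_inv x)

/-- The canonical isomorphism `V ≅ V**` given by the action of the pivot. -/
noncomputable def doubleDualIso (V : H.Rep) : V ≅ dual (dual V) :=
  isoOfLin
    (LinearEquiv.ofLinearMap
      ((Module.evalEquiv k V.V).toLinearMap ∘ₗ V.ρ fun x => (H.g x : H.A x))
      ((V.ρ fun x => ((H.g x)⁻¹ : (H.A x)ˣ)) ∘ₗ (Module.evalEquiv k V.V).symm.toLinearMap)
      (by
        have h : (V.ρ fun x => (H.g x : H.A x)) ∘ₗ (V.ρ fun x => ((H.g x)⁻¹ : (H.A x)ˣ)) =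
            LinearMap.id := by
          change V.ρ _ * V.ρ _ = 1
          rw [← map_mul, ← map_one V.ρ]
          congr 1
          ext x
          exact Units.mul_inv _
        rw [LinearMap.comp_assoc, ← LinearMap.comp_assoc _ _ (V.ρ _), h]
        ext v
        simp)
      (by
        have h : (V.ρ fun x => ((H.g x)⁻¹ : (H.A x)ˣ)) ∘ₗ (V.ρ fun x => (H.g x : H.A x)) =
            LinearMap.id := by
          change V.ρ _ * V.ρ _ = 1
          rw [← map_mul, ← map_one V.ρ]
          congr 1
          ext x
          exact Units.inv_mul _
        refine LinearMap.ext fun v => ?_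
        have := LinearMap.congr_fun h v
        rw [LinearMap.comp_apply] at this
        change (V.ρ _) ((Module.evalEquiv k V.V).symm (Module.evalEquiv k V.V (V.ρ _ v))) = _
        rw [LinearEquiv.symm_apply_apply]
        exact this))
    (fun a v => by
      ext f
      have h : V.ρ (H.antiSec (H.antiSec a)) * (V.ρ fun x => (H.g x : H.A x)) =
          (V.ρ fun x => (H.g x : H.A x)) * V.ρ a := by
        rw [← map_mul, ← map_mul]
        congr 1
        ext x
        rw [Pi.mul_apply, anti_anti, Units.inv_mul_cancel_right]
        rfl
      exact congrArg f (LinearMap.congr_fun h v).symm)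

theorem doubleDualIso_apply (V : H.Rep) (v : V.V) (f : Module.Dual k V.V) :
    (lin (doubleDualIso V).hom v : Module.Dual k (Module.Dual k V.V)) f =
      f ((V.ρ fun x => (H.g x : H.A x)) v) := rfl

/-- The dualities of the category of modules: `ev` and `coev` are the evaluation and coevaluation of
vector spaces, and `ev'`, `coev'` are obtained from those of `V*` through the isomorphism
`V ≅ V**` given by the pivot. -/
noncomputable instance : TwoSidedDuality H.Rep where
  dual := dual
  rightPairing := pairing
  leftPairing V :=
    haveI := pairing (dual V)
    exactPairingCongrRight (doubleDualIso V)

/-- The right evaluation is `v ⊗ f ↦ f (g v)`. -/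
theorem tev_tmul (V : H.Rep) (v : V.V) (f : Module.Dual k V.V) :
    lin (ε_ (TwoSidedDuality.dual V) V) (v ⊗ₜ[k] f : V.V ⊗[k] Module.Dual k V.V) =
      f ((V.ρ fun x => (H.g x : H.A x)) v) := rfl

end

section
variable {H : HopfGCoalgebra k G}

/-- The quotient of `W` by the image of `f : V ⟶ W`. -/
noncomputable abbrev quot {V W : H.Rep} (f : V ⟶ W) : H.Rep where
  V := W.V ⧸ LinearMap.range (lin f)
  ρ := AlgHom.ofLinearMap
    { toFun := fun a => Submodule.mapQ _ _ (W.ρ a) (by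
        rintro _ ⟨v, rfl⟩
        exact ⟨V.ρ a v, lin_comm f a v⟩)
      map_add' := fun a b => Submodule.linearMap_qext _ (by ext v; simp)
      map_smul' := fun c a => Submodule.linearMap_qext _ (by ext v; simp) }
    (Submodule.linearMap_qext _ (by ext v; simp))
    (fun a b => Submodule.linearMap_qext _ (by ext v; simp))
  finite_support := by
    obtain ⟨s, hs⟩ := W.finite_support
    refine ⟨s, fun a ha => Submodule.linearMap_qext _ ?_⟩
    ext v
    simp [hs a ha]

theorem surjective_of_epi {V W : H.Rep} (f : V ⟶ W) [Epi f] : Function.Surjective (lin f) := by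
  have h : (ofLin (W := quot f) (Submodule.mkQ _) fun a w => rfl : W ⟶ quot f) =
      ofLin (W := quot f) 0 fun a w => by simp := by
    rw [← cancel_epi f]
    apply hom_ext
    refine LinearMap.ext fun v => ?_
    exact (Submodule.Quotient.mk_eq_zero _).2 ⟨v, rfl⟩
  rw [← LinearMap.range_eq_top, ← Submodule.ker_mkQ (LinearMap.range (lin f))]
  have h' : Submodule.mkQ (LinearMap.range (lin f)) = 0 := congrArg lin h
  rw [h', LinearMap.ker_zero]

/-- The regular module `H_x`, concentrated in degree `x`. -/
noncomputable abbrev regular (H : HopfGCoalgebra k G) [∀ x, FiniteDimensional k (H.A x)] (x : G) :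
    H.Rep where
  V := H.A x
  ρ := (Algebra.lmul k (H.A x)).comp (Pi.evalAlgHom k H.A x)
  finite_support := ⟨{x}, fun a ha => by simp [ha x (by simp)]⟩

theorem regular_projective [∀ x, FiniteDimensional k (H.A x)] (x : G) :
    Projective (regular H x) where
  factors {E X} f e _ := by
    obtain ⟨v, hv⟩ := surjective_of_epi e (lin f (1 : H.A x))
    refine ⟨ofLin (V := regular H x) ((E.act x).flip v) fun a b => ?_, ?_⟩
    · have := LinearMap.congr_fun (ρ_mul_act E a x b) v
      exact this.symm
    · apply hom_ext
      refine LinearMap.ext fun b => ?_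
      classical
      have h1 : lin e (E.act x b v) = X.act x b (lin e v) := lin_comm e _ _
      have h2 : lin f ((regular H x).ρ (Pi.single x b) (1 : H.A x)) =
        X.act x b (lin f (1 : H.A x)) := by
        convert lin_comm f (Pi.single x b) (1 : H.A x)
        simp [act]
      have h3 : (regular H x).ρ (Pi.single x b) (1 : H.A x) = b := by
        change (Pi.single x b : ∀ x, H.A x) x * 1 = b
        simp
      rw [h3, ← hv] at h2
      exact h1.trans h2.symm

/-- Pull back of the action along a family of automorphisms `φ_x` of the algebras `H_x`. -/
abbrev twist (φ : ∀ x, H.A x ≃ₐ[k] H.A x) (V : H.Rep) : H.Rep where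
  V := V.V
  ρ := V.ρ.comp (AlgHom.pi fun x => (φ x).toAlgHom.comp (Pi.evalAlgHom k H.A x))
  finite_support := by
    obtain ⟨s, hs⟩ := V.finite_support
    exact ⟨s, fun a ha => hs _ fun x hx => by
      change φ x (a x) = 0
      rw [ha x hx, map_zero]⟩

theorem twist_ρ (φ : ∀ x, H.A x ≃ₐ[k] H.A x) (V : H.Rep) (a : ∀ x, H.A x) :
    (twist φ V).ρ a = V.ρ fun x => φ x (a x) := rfl

theorem twist_act (φ : ∀ x, H.A x ≃ₐ[k] H.A x) (V : H.Rep) (x : G) (a : H.A x) :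
    (twist φ V).act x a = V.act x (φ x a) := by
  classical
  change V.ρ _ = V.ρ _
  congr 1
  ext y
  by_cases hy : y = x
  · subst hy; simp
  · simp [Pi.single_eq_of_ne hy]

theorem twist_supportedOn (φ : ∀ x, H.A x ≃ₐ[k] H.A x) {V : H.Rep} {s : Finset G}
    (hs : V.SupportedOn s) : (twist φ V).SupportedOn s := fun a ha => hs _ fun x hx => by
  change φ x (a x) = 0
  rw [ha x hx, map_zero]

/-- The pull back `φ_*` of modules along `φ`; it is the identity on linear maps. -/
def twistFunctor (φ : ∀ x, H.A x ≃ₐ[k] H.A x) : H.Rep ⥤ H.Rep where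
  obj := twist φ
  map {V W} f := ofLin (V := twist φ V) (W := twist φ W) (lin (V := V) (W := W) f)
    fun _ v => lin_comm (V := V) (W := W) f _ v
  map_id _ := rfl
  map_comp _ _ := rfl

theorem twist_twist_symm (φ : ∀ x, H.A x ≃ₐ[k] H.A x) (V : H.Rep) (a : ∀ x, H.A x) :
    (twist φ (twist (fun x => (φ x).symm) V)).ρ a = V.ρ a := by
  rw [twist_ρ, twist_ρ]
  simp

theorem twist_symm_twist (φ : ∀ x, H.A x ≃ₐ[k] H.A x) (V : H.Rep) (a : ∀ x, H.A x) :
    (twist (fun x => (φ x).symm) (twist φ V)).ρ a = V.ρ a := by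
  rw [twist_ρ, twist_ρ]
  simp

/-- The pull back along `φ` is an equivalence. -/
def twistEquiv (φ : ∀ x, H.A x ≃ₐ[k] H.A x) : H.Rep ≌ H.Rep where
  functor := twistFunctor φ
  inverse := twistFunctor fun x => (φ x).symm
  unitIso := NatIso.ofComponents
    (fun V => (isoOfLin (LinearEquiv.refl k V.V)
      fun a v => (LinearMap.congr_fun (twist_symm_twist φ V a) v).symm :
        V ≅ twist (fun x => (φ x).symm) (twist φ V))) (fun f => rfl)
  counitIso := NatIso.ofComponents
    (fun V => (isoOfLin (LinearEquiv.refl k V.V)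
      fun a v => LinearMap.congr_fun (twist_twist_symm φ V a) v :
        twist φ (twist (fun x => (φ x).symm) V) ≅ V)) (fun f => rfl)
  functor_unitIso_comp V := rfl

theorem twist_projective (φ : ∀ x, H.A x ≃ₐ[k] H.A x) {V : H.Rep} (hV : Projective V) :
    Projective (twist φ V) :=
  ((twistEquiv φ).map_projective_iff V).2 hV

end

end Rep
end HopfGCoalgebra

namespace HopfGCoalgebra
variable {k : Type u} [Field k] {G : Type w} [Group G] (H : HopfGCoalgebra k G)

/-- The map `R(α)_x : a ↦ α(a₍₁,₁₎) a₍₂,ₓ₎`. -/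
noncomputable def coactR (α : H.A 1 →ₐ[k] k) (x : G) : H.A x →ₐ[k] H.A x :=
  (Algebra.TensorProduct.lid k (H.A x)).toAlgHom.comp
    ((Algebra.TensorProduct.map α (AlgHom.id k (H.A x))).comp (H.cop (one_mul x)))

/-- The map `L(α)_x : a ↦ a₍₁,ₓ₎ α(a₍₂,₁₎)`. -/
noncomputable def coactL (α : H.A 1 →ₐ[k] k) (x : G) : H.A x →ₐ[k] H.A x :=
  (Algebra.TensorProduct.rid k k (H.A x)).toAlgHom.comp
    ((Algebra.TensorProduct.map (AlgHom.id k (H.A x)) α).comp (H.cop (mul_one x)))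

theorem coactR_apply (α : H.A 1 →ₐ[k] k) (x : G) (a : H.A x) :
    H.coactR α x a = TensorProduct.lid k _ (α.toLinearMap.rTensor _ (H.cop (one_mul x) a)) := rfl

theorem coactL_apply (α : H.A 1 →ₐ[k] k) (x : G) (a : H.A x) :
    H.coactL α x a = TensorProduct.rid k _ (α.toLinearMap.lTensor _ (H.cop (mul_one x) a)) := rfl

/-- The character `b ⊗ b' ↦ α(b) β(b')`. -/
noncomputable def charTensor (α β : H.A 1 →ₐ[k] k) : H.A 1 ⊗[k] H.A 1 →ₐ[k] k :=
  Algebra.TensorProduct.lift α β fun _ _ => mul_comm _ _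

theorem charTensor_tmul (α β : H.A 1 →ₐ[k] k) (b b' : H.A 1) :
    H.charTensor α β (b ⊗ₜ b') = α b * β b' := Algebra.TensorProduct.lift_tmul _ _ _ _ _

/-- The convolution product of two characters. -/
noncomputable def conv (α β : H.A 1 →ₐ[k] k) : H.A 1 →ₐ[k] k :=
  (H.charTensor α β).comp (H.cop (one_mul 1))

theorem coactR_conv (α β : H.A 1 →ₐ[k] k) (x : G) (a : H.A x) :
    H.coactR β x (H.coactR α x a) = H.coactR (H.conv α β) x a := by
  have h := congrArg (fun q => TensorProduct.lid k _ (TensorProduct.map α.toLinearMap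
    ((TensorProduct.lid k _).toLinearMap ∘ₗ β.toLinearMap.rTensor (H.A x)) q))
    (H.cop_coassoc (one_mul 1) (one_mul x) (one_mul x) (one_mul x) a)
  beta_reduce at h
  have h1 : ∀ c : H.A 1 ⊗[k] H.A x,
      TensorProduct.lid k _ (TensorProduct.map α.toLinearMap
        ((TensorProduct.lid k _).toLinearMap ∘ₗ β.toLinearMap.rTensor (H.A x))
        ((H.cop (one_mul x)).toLinearMap.lTensor _ c)) =
      H.coactR β x (TensorProduct.lid k _ (α.toLinearMap.rTensor _ c)) := by
    intro c
    induction c with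
    | zero => simp
    | add p p' hp hp' => simp only [map_add, hp, hp']
    | tmul b b' => simp [coactR_apply]
  have h2 : ∀ c : H.A 1 ⊗[k] H.A x,
      TensorProduct.lid k _ (TensorProduct.map α.toLinearMap
        ((TensorProduct.lid k _).toLinearMap ∘ₗ β.toLinearMap.rTensor (H.A x))
        (TensorProduct.assoc k _ _ _ ((H.cop (one_mul 1)).toLinearMap.rTensor _ c))) =
      TensorProduct.lid k _ ((H.conv α β).toLinearMap.rTensor _ c) := by
    intro c
    induction c with
    | zero => simp
    | add p p' hp hp' => simp only [map_add, hp, hp']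
    | tmul b b' =>
      simp only [LinearMap.rTensor_tmul, conv, AlgHom.toLinearMap_apply, AlgHom.comp_apply]
      generalize H.cop (one_mul 1) b = d
      induction d with
      | zero => simp
      | add p p' hp hp' => simp only [map_add, TensorProduct.add_tmul, hp, hp']
      | tmul b b' => simp [charTensor_tmul, smul_smul, mul_comm]
  rw [h1, h2] at h
  exact h.symm

theorem coactL_conv (α β : H.A 1 →ₐ[k] k) (x : G) (a : H.A x) :
    H.coactL α x (H.coactL β x a) = H.coactL (H.conv α β) x a := by
  have h := congrArg (fun q => TensorProduct.rid k _ (TensorProduct.map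
    ((TensorProduct.rid k _).toLinearMap ∘ₗ α.toLinearMap.lTensor (H.A x)) β.toLinearMap
      ((TensorProduct.assoc k _ _ _).symm q)))
    (H.cop_coassoc (mul_one x) (mul_one x) (one_mul 1) (mul_one x) a)
  simp only [LinearEquiv.symm_apply_apply] at h
  have h1 : ∀ c : H.A x ⊗[k] H.A 1,
      TensorProduct.rid k _ (TensorProduct.map
        ((TensorProduct.rid k _).toLinearMap ∘ₗ α.toLinearMap.lTensor (H.A x)) β.toLinearMap
        ((H.cop (mul_one x)).toLinearMap.rTensor _ c)) =
      H.coactL α x (TensorProduct.rid k _ (β.toLinearMap.lTensor _ c)) := by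
    intro c
    induction c with
    | zero => simp
    | add p p' hp hp' => simp only [map_add, hp, hp']
    | tmul b b' => simp [coactL_apply]
  have h2 : ∀ c : H.A x ⊗[k] H.A 1,
      TensorProduct.rid k _ (TensorProduct.map
        ((TensorProduct.rid k _).toLinearMap ∘ₗ α.toLinearMap.lTensor (H.A x)) β.toLinearMap
        ((TensorProduct.assoc k _ _ _).symm ((H.cop (one_mul 1)).toLinearMap.lTensor _ c))) =
      TensorProduct.rid k _ ((H.conv α β).toLinearMap.lTensor _ c) := by
    intro c
    induction c with
    | zero => simp
    | add p p' hp hp' => simp only [map_add, hp, hp']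
    | tmul b b' =>
      simp only [LinearMap.lTensor_tmul, conv, AlgHom.toLinearMap_apply, AlgHom.comp_apply]
      generalize H.cop (one_mul 1) b' = d
      induction d with
      | zero => simp
      | add p p' hp hp' => simp only [map_add, TensorProduct.tmul_add, hp, hp']
      | tmul b b' => simp [charTensor_tmul, smul_smul, mul_comm]
  rw [h1, h2] at h
  exact h

theorem coactR_counit (x : G) (a : H.A x) : H.coactR H.ε x a = a :=
  H.cop_counit_left (one_mul x) rfl a

theorem coactL_counit (x : G) (a : H.A x) : H.coactL H.ε x a = a :=
  H.cop_counit_right (mul_one x) rfl a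

/-- The character `α ∘ S`. -/
def charInv (α : H.A 1 →ₐ[k] k) : H.A 1 →ₐ[k] k :=
  AlgHom.ofLinearMap (α.toLinearMap ∘ₗ H.anti inv_one)
    (by simp [anti_one]) (fun a b => by simp [anti_mul, mul_comm])

theorem charInv_apply (α : H.A 1 →ₐ[k] k) (a : H.A 1) :
    H.charInv α a = α (H.anti inv_one a) := rfl

theorem conv_charInv (α : H.A 1 →ₐ[k] k) : H.conv α (H.charInv α) = H.ε := by
  ext a
  have h := congrArg α (H.anti_right (one_mul 1) inv_one a)
  rw [AlgHom.commutes, Algebra.algebraMap_self_apply] at h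
  rw [← h]
  simp only [conv, AlgHom.comp_apply]
  generalize H.cop (one_mul 1) a = d
  induction d with
  | zero => simp
  | add p p' hp hp' => simp only [map_add, hp, hp']
  | tmul b b' => simp [charTensor_tmul, charInv_apply]

theorem charInv_conv (α : H.A 1 →ₐ[k] k) : H.conv (H.charInv α) α = H.ε := by
  ext a
  have h := congrArg α (H.anti_left (one_mul 1) inv_one a)
  rw [AlgHom.commutes, Algebra.algebraMap_self_apply] at h
  rw [← h]
  simp only [conv, AlgHom.comp_apply]
  generalize H.cop (one_mul 1) a = d
  induction d with
  | zero => simp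
  | add p p' hp hp' => simp only [map_add, hp, hp']
  | tmul b b' => simp [charTensor_tmul, charInv_apply]

/-- The automorphism `R(α)_x`. -/
noncomputable def autR (α : H.A 1 →ₐ[k] k) (x : G) : H.A x ≃ₐ[k] H.A x :=
  AlgEquiv.ofAlgHom (H.coactR α x) (H.coactR (H.charInv α) x)
    (AlgHom.ext fun a => by
      rw [AlgHom.comp_apply, coactR_conv, charInv_conv, coactR_counit]; rfl)
    (AlgHom.ext fun a => by
      rw [AlgHom.comp_apply, coactR_conv, conv_charInv, coactR_counit]; rfl)

/-- The automorphism `L(α)_x`. -/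
noncomputable def autL (α : H.A 1 →ₐ[k] k) (x : G) : H.A x ≃ₐ[k] H.A x :=
  AlgEquiv.ofAlgHom (H.coactL α x) (H.coactL (H.charInv α) x)
    (AlgHom.ext fun a => by
      rw [AlgHom.comp_apply, coactL_conv, conv_charInv, coactL_counit]; rfl)
    (AlgHom.ext fun a => by
      rw [AlgHom.comp_apply, coactL_conv, charInv_conv, coactL_counit]; rfl)

theorem Δ_autR (α : H.A 1 →ₐ[k] k) (x y : G) (a : H.A (x * y)) :
    H.Δ x y (H.autR α (x * y) a) = (H.coactR α x).toLinearMap.rTensor _ (H.Δ x y a) := by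
  have h := congrArg (fun q => TensorProduct.lid k _ (α.toLinearMap.rTensor _ q))
    (H.cop_coassoc (one_mul x) rfl (rfl : x * y = x * y) (one_mul (x * y)) a)
  beta_reduce at h
  have h1 : ∀ c : H.A 1 ⊗[k] H.A (x * y),
      TensorProduct.lid k _ (α.toLinearMap.rTensor _
        ((H.cop (rfl : x * y = x * y)).toLinearMap.lTensor _ c)) =
      H.Δ x y (TensorProduct.lid k _ (α.toLinearMap.rTensor _ c)) := by
    intro c
    induction c with
    | zero => simp
    | add p p' hp hp' => simp only [map_add, hp, hp']
    | tmul b b' => simp [cop_rfl]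
  have h2 : ∀ c : H.A x ⊗[k] H.A y,
      TensorProduct.lid k _ (α.toLinearMap.rTensor _
        (TensorProduct.assoc k _ _ _ ((H.cop (one_mul x)).toLinearMap.rTensor _ c))) =
      (H.coactR α x).toLinearMap.rTensor _ c := by
    intro c
    induction c with
    | zero => simp
    | add p p' hp hp' => simp only [map_add, hp, hp']
    | tmul b b' =>
      simp only [LinearMap.rTensor_tmul, AlgHom.toLinearMap_apply, coactR_apply]
      generalize H.cop (one_mul x) b = d
      induction d with
      | zero => simp
      | add p p' hp hp' => simp only [map_add, TensorProduct.add_tmul, hp, hp']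
      | tmul b b' => simp [TensorProduct.smul_tmul']
  rw [h1, h2] at h
  exact h.symm

theorem Δ_autL (α : H.A 1 →ₐ[k] k) (x y : G) (a : H.A (x * y)) :
    H.Δ x y (H.autL α (x * y) a) = (H.coactL α y).toLinearMap.lTensor _ (H.Δ x y a) := by
  have h := congrArg (fun q => TensorProduct.rid k _ (α.toLinearMap.lTensor _
      ((TensorProduct.assoc k _ _ _).symm q)))
    (H.cop_coassoc (rfl : x * y = x * y) (mul_one (x * y)) (mul_one y) rfl a)
  simp only [LinearEquiv.symm_apply_apply] at h
  have h1 : ∀ c : H.A (x * y) ⊗[k] H.A 1,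
      TensorProduct.rid k _ (α.toLinearMap.lTensor _
        ((H.cop (rfl : x * y = x * y)).toLinearMap.rTensor _ c)) =
      H.Δ x y (TensorProduct.rid k _ (α.toLinearMap.lTensor _ c)) := by
    intro c
    induction c with
    | zero => simp
    | add p p' hp hp' => simp only [map_add, hp, hp']
    | tmul b b' => simp [cop_rfl]
  have h2 : ∀ c : H.A x ⊗[k] H.A y,
      TensorProduct.rid k _ (α.toLinearMap.lTensor _
        ((TensorProduct.assoc k _ _ _).symm ((H.cop (mul_one y)).toLinearMap.lTensor _ c))) =
      (H.coactL α y).toLinearMap.lTensor _ c := by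
    intro c
    induction c with
    | zero => simp
    | add p p' hp hp' => simp only [map_add, hp, hp']
    | tmul b b' =>
      simp only [LinearMap.lTensor_tmul, AlgHom.toLinearMap_apply, coactL_apply]
      generalize H.cop (mul_one y) b' = d
      induction d with
      | zero => simp
      | add p p' hp hp' => simp only [map_add, TensorProduct.tmul_add, hp, hp']
      | tmul b b' => simp
  rw [h1, h2] at h
  exact h

end HopfGCoalgebra

namespace HopfGCoalgebra
variable {k : Type u} [Field k] {G : Type w} [Group G]
namespace Rep
open MonoidalCategory

theorem twist_tensor_R {H : HopfGCoalgebra k G} (α : H.A 1 →ₐ[k] k) (V W : H.Rep) :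
    (tensor (twist (H.autR α) V) W).ρ = (twist (H.autR α) (tensor V W)).ρ := by
  ext a v w
  obtain ⟨s, hs⟩ := V.finite_support
  obtain ⟨t, ht⟩ := W.finite_support
  change (tensor (twist (H.autR α) V) W).ρ a (v ⊗ₜ w) = (tensor V W).ρ _ (v ⊗ₜ w)
  rw [tensor_ρ_tmul (twist_supportedOn _ hs) ht, tensor_ρ_tmul hs ht]
  refine Finset.sum_congr rfl fun x hx => Finset.sum_congr rfl fun y hy => ?_
  change _ = TensorProduct.map _ _ (H.Δ x y (H.autR α (x * y) (a (x * y))))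
  rw [Δ_autR]
  generalize H.Δ x y (a (x * y)) = d
  induction d with
  | zero => simp
  | add p p' hp hp' => simp only [map_add, hp, hp']
  | tmul b b' =>
    simp only [TensorProduct.map_tmul, LinearMap.rTensor_tmul, LinearMap.flip_apply]
    rw [twist_act]
    rfl

theorem twist_tensor_L {H : HopfGCoalgebra k G} (α : H.A 1 →ₐ[k] k) (V W : H.Rep) :
    (tensor V (twist (H.autL α) W)).ρ = (twist (H.autL α) (tensor V W)).ρ := by
  ext a v w
  obtain ⟨s, hs⟩ := V.finite_support
  obtain ⟨t, ht⟩ := W.finite_support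
  change (tensor V (twist (H.autL α) W)).ρ a (v ⊗ₜ w) = (tensor V W).ρ _ (v ⊗ₜ w)
  rw [tensor_ρ_tmul hs (twist_supportedOn _ ht), tensor_ρ_tmul hs ht]
  refine Finset.sum_congr rfl fun x hx => Finset.sum_congr rfl fun y hy => ?_
  change _ = TensorProduct.map _ _ (H.Δ x y (H.autL α (x * y) (a (x * y))))
  rw [Δ_autL]
  generalize H.Δ x y (a (x * y)) = d
  induction d with
  | zero => simp
  | add p p' hp hp' => simp only [map_add, hp, hp']
  | tmul b b' =>
    simp only [TensorProduct.map_tmul, LinearMap.lTensor_tmul, LinearMap.flip_apply]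
    rw [twist_act]
    rfl

end Rep
end HopfGCoalgebra

namespace PivotalHopfGCoalgebra
open MonoidalCategory HopfGCoalgebra HopfGCoalgebra.Rep
variable {k : Type u} [Field k] {G : Type w} [Group G] (H : PivotalHopfGCoalgebra k G)

/-- The category of projective modules. -/
abbrev Pmod : Type _ := (isProjective H.Rep).FullSubcategory

variable {H}

/-- Restriction of the pull back along `φ` to projective modules. -/
def twistPmod (φ : ∀ x, H.A x ≃ₐ[k] H.A x) : H.Pmod ⥤ H.Pmod :=
  (isProjective H.Rep).lift ((isProjective H.Rep).ι ⋙ twistFunctor φ)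
    fun P => twist_projective φ P.property

/-- The endofunctor `R(α)_*` of the category of projective modules. -/
noncomputable def twistR (α : H.A 1 →ₐ[k] k) : H.Pmod ⥤ H.Pmod := twistPmod (H.autR α)

/-- The endofunctor `L(α)_*` of the category of projective modules. -/
noncomputable def twistL (α : H.A 1 →ₐ[k] k) : H.Pmod ⥤ H.Pmod := twistPmod (H.autL α)

/-- The isomorphism `R(α)_* P ⊗ V ≅ R(α)_* (P ⊗ V)`, given by the identity map. -/
noncomputable def twistRIso (α : H.A 1 →ₐ[k] k) (P : H.Rep) (V : H.Rep) :
    (tensor (twist (H.autR α) P) V) ≅ twist (H.autR α) (tensor P V) :=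
  isoOfLin (LinearEquiv.refl k _) fun a v => by
    rw [← twist_tensor_R]; rfl

/-- The isomorphism `V ⊗ L(α)_* P ≅ L(α)_* (V ⊗ P)`, given by the identity map. -/
noncomputable def twistLIso (α : H.A 1 →ₐ[k] k) (V : H.Rep) (P : H.Rep) :
    (tensor V (twist (H.autL α) P)) ≅ twist (H.autL α) (tensor V P) :=
  isoOfLin (LinearEquiv.refl k _) fun a v => by
    rw [← twist_tensor_L]; rfl

theorem hom_ext_right {U V W X : H.Rep} {f g : U ⊗ (V ⊗ W) ⟶ X}
    (h : ∀ (u : U.V) (v : V.V) (w : W.V),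
      lin f (u ⊗ₜ[k] (v ⊗ₜ[k] w) : U.V ⊗[k] (V.V ⊗[k] W.V)) =
        lin g (u ⊗ₜ[k] (v ⊗ₜ[k] w) : U.V ⊗[k] (V.V ⊗[k] W.V))) : f = g :=
  hom_ext (TensorProduct.ext (LinearMap.ext fun u => TensorProduct.ext' fun v w => h u v w))

theorem hom_ext_left {U V W X : H.Rep} {f g : (U ⊗ V) ⊗ W ⟶ X}
    (h : ∀ (u : U.V) (v : V.V) (w : W.V),
      lin f ((u ⊗ₜ[k] v) ⊗ₜ[k] w : (U.V ⊗[k] V.V) ⊗[k] W.V) =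
        lin g ((u ⊗ₜ[k] v) ⊗ₜ[k] w : (U.V ⊗[k] V.V) ⊗[k] W.V)) : f = g :=
  hom_ext (TensorProduct.ext_threefold fun u v w => h u v w)

theorem twistRIso_assoc (α : H.A 1 →ₐ[k] k) (P V W : H.Rep) :
    (twistRIso α P (V ⊗ W)).hom ≫ (twistFunctor (H.autR α)).map (α_ P V W).inv =
      (α_ (twist (H.autR α) P) V W).inv ≫ (twistRIso α P V).hom ▷ W ≫
        (twistRIso α (P ⊗ V) W).hom :=
  hom_ext_right (U := twist (H.autR α) P) fun _ _ _ => rfl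

theorem twistRIso_assoc_inv (α : H.A 1 →ₐ[k] k) (P V W : H.Rep) :
    (twistRIso α P (V ⊗ W)).inv ≫ (α_ (twist (H.autR α) P) V W).inv =
      (twistFunctor (H.autR α)).map (α_ P V W).inv ≫ (twistRIso α (P ⊗ V) W).inv ≫
        (twistRIso α P V).inv ▷ W :=
  hom_ext (V := twist _ (P ⊗ (V ⊗ W)))
    (TensorProduct.ext (LinearMap.ext fun u => TensorProduct.ext' fun v w => rfl))

theorem twistLIso_assoc (α : H.A 1 →ₐ[k] k) (V W P : H.Rep) :
    (twistLIso α (V ⊗ W) P).hom ≫ (twistFunctor (H.autL α)).map (α_ V W P).hom =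
      (α_ V W (twist (H.autL α) P)).hom ≫ V ◁ (twistLIso α W P).hom ≫
        (twistLIso α V (W ⊗ P)).hom :=
  hom_ext_left (W := twist (H.autL α) P) fun _ _ _ => rfl

theorem twistLIso_assoc_inv (α : H.A 1 →ₐ[k] k) (V W P : H.Rep) :
    (twistLIso α (V ⊗ W) P).inv ≫ (α_ V W (twist (H.autL α) P)).hom =
      (twistFunctor (H.autL α)).map (α_ V W P).hom ≫ (twistLIso α V (W ⊗ P)).inv ≫
        V ◁ (twistLIso α W P).inv :=
  hom_ext (V := twist _ ((V ⊗ W) ⊗ P)) (TensorProduct.ext_threefold fun u v w => rfl)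

/-- `R(α)_*` is a right module functor. -/
noncomputable instance (α : H.A 1 →ₐ[k] k) : (twistR α).RightLinear H.Rep where
  μᵣ P V := ObjectProperty.homMk (twistRIso α P.obj V).hom
  δᵣ P V := ObjectProperty.homMk (twistRIso α P.obj V).inv
  μᵣ_naturality_right _ _ _ _ := rfl
  μᵣ_naturality_left _ _ := rfl
  μᵣ_associativity P V W := ObjectProperty.hom_ext _ (twistRIso_assoc α P.obj V W)
  μᵣ_unitality _ := rfl
  δᵣ_naturality_right _ _ _ _ := rfl
  δᵣ_naturality_left _ _ := rfl
  δᵣ_associativity P V W := ObjectProperty.hom_ext _ (twistRIso_assoc_inv α P.obj V W)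
  δᵣ_unitality_inv _ := rfl
  μᵣ_comp_δᵣ _ _ := rfl
  δᵣ_comp_μᵣ _ _ := rfl

/-- `L(α)_*` is a left module functor. -/
noncomputable instance (α : H.A 1 →ₐ[k] k) : (twistL α).LeftLinear H.Rep where
  μₗ V P := ObjectProperty.homMk (twistLIso α V P.obj).hom
  δₗ V P := ObjectProperty.homMk (twistLIso α V P.obj).inv
  μₗ_naturality_right _ _ _ _ := rfl
  μₗ_naturality_left _ _ := rfl
  μₗ_associativity V W P := ObjectProperty.hom_ext _ (twistLIso_assoc α V W P.obj)
  μₗ_unitality _ := rfl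
  δₗ_naturality_right _ _ _ _ := rfl
  δₗ_naturality_left _ _ := rfl
  δₗ_associativity V W P := ObjectProperty.hom_ext _ (twistLIso_assoc_inv α V W P.obj)
  δₗ_unitality_inv _ := rfl
  μₗ_comp_δₗ _ _ := rfl
  δₗ_comp_μₗ _ _ := rfl

end PivotalHopfGCoalgebra

namespace HopfGCoalgebra
variable {k : Type u} [Field k] {G : Type w} [Group G] (H : HopfGCoalgebra k G)

/-- `α` is the modulus of `H_1`: for a nonzero left cointegral `c` of `H_1` one has
`c a = α(a) c` for all `a`. -/
def IsModulus (α : H.A 1 →ₐ[k] k) : Prop :=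
  ∃ c : H.A 1, c ≠ 0 ∧ (∀ a, a * c = H.ε a • c) ∧ ∀ a, c * a = α a • c

/-- Right `G`-integrals: families `μ_x` of linear forms on `H_x` with
`(μ_x ⊗ id) Δ_{x,y}(a) = μ_{xy}(a) 1_y`. -/
def rightIntegrals : Submodule k (∀ x, Module.Dual k (H.A x)) where
  carrier := {μ | ∀ (x y : G) (a : H.A (x * y)),
    TensorProduct.lid k (H.A y) ((μ x).rTensor (H.A y) (H.Δ x y a)) = μ (x * y) a • 1}
  zero_mem' := by simp
  add_mem' hμ hν x y a := by
    simp only [Pi.add_apply, LinearMap.rTensor_add, LinearMap.add_apply, map_add, add_smul,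
      hμ x y a, hν x y a]
  smul_mem' c μ hμ x y a := by
    simp only [Pi.smul_apply, LinearMap.rTensor_smul, LinearMap.smul_apply, map_smul,
      hμ x y a, smul_assoc]

/-- Left `G`-integrals: families `μ_x` of linear forms on `H_x` with
`(id ⊗ μ_y) Δ_{x,y}(a) = μ_{xy}(a) 1_x`. -/
def leftIntegrals : Submodule k (∀ x, Module.Dual k (H.A x)) where
  carrier := {μ | ∀ (x y : G) (a : H.A (x * y)),
    TensorProduct.rid k (H.A x) ((μ y).lTensor (H.A x) (H.Δ x y a)) = μ (x * y) a • 1}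
  zero_mem' := by simp
  add_mem' hμ hν x y a := by
    simp only [Pi.add_apply, LinearMap.lTensor_add, LinearMap.add_apply, map_add, add_smul,
      hμ x y a, hν x y a]
  smul_mem' c μ hμ x y a := by
    simp only [Pi.smul_apply, LinearMap.lTensor_smul, LinearMap.smul_apply, map_smul,
      hμ x y a, smul_assoc]

/-- The linear map sending a family `μ_x` to the family `a ↦ μ_x(u_x a)`. -/
def shift (u : ∀ x, H.A x) : (∀ x, Module.Dual k (H.A x)) →ₗ[k] ∀ x, Module.Dual k (H.A x) where
  toFun μ x := μ x ∘ₗ LinearMap.mulLeft k (u x)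
  map_add' _ _ := rfl
  map_smul' _ _ := rfl

end HopfGCoalgebra

namespace PivotalHopfGCoalgebra
open HopfGCoalgebra HopfGCoalgebra.Rep
variable {k : Type u} [Field k] {G : Type w} [Group G] (H : PivotalHopfGCoalgebra k G)

/-- The symmetrised right `G`-integrals `a ↦ μ_x(g_x a)`, for `μ` a right `G`-integral. -/
def symmRightIntegrals : Submodule k (∀ x, Module.Dual k (H.A x)) :=
  H.rightIntegrals.map (H.shift fun x => (H.g x : H.A x))

/-- The symmetrised left `G`-integrals `a ↦ μ_x(g_x⁻¹ a)`, for `μ` a left `G`-integral. -/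
def symmLeftIntegrals : Submodule k (∀ x, Module.Dual k (H.A x)) :=
  H.leftIntegrals.map (H.shift fun x => ((H.g x)⁻¹ : (H.A x)ˣ))

/-- The regular module `H_x` as an object of `H.Pmod`. -/
noncomputable def regularPmod [∀ x, FiniteDimensional k (H.A x)] (x : G) : H.Pmod :=
  ⟨regular H.toHopfGCoalgebra x, regular_projective x⟩

variable {H}

/-- The value `f(1_x)` of an `H_x`-linear map `f : H_x → R(α)_* H_x`. -/
noncomputable def valueR [∀ x, FiniteDimensional k (H.A x)] {α : H.A 1 →ₐ[k] k} {x : G}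
    (f : H.regularPmod x ⟶ (twistR α).obj (H.regularPmod x)) : H.A x :=
  lin f.hom (1 : H.A x)

/-- The value `f(1_x)` of an `H_x`-linear map `f : H_x → L(α)_* H_x`. -/
noncomputable def valueL [∀ x, FiniteDimensional k (H.A x)] {α : H.A 1 →ₐ[k] k} {x : G}
    (f : H.regularPmod x ⟶ (twistL α).obj (H.regularPmod x)) : H.A x :=
  lin f.hom (1 : H.A x)

end PivotalHopfGCoalgebra

/-! Write Σ for the pull back along φ = R(α) or L(α).

Forms. Every projective module is a retract of a finite sum of regular modules H_x, and a morphism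
H_x → φ_* H_x has the shape a ↦ φ(a) b. A Σ-cyclic family t is therefore determined by the linear
forms τ_x(b) = t(a ↦ φ(a) b). Conversely, forms with τ_x(φ(q) b) = τ_x(b q) extend to a cyclic
family (`exists_isSCyclic`), since regular modules of different degrees have no morphisms between
them.

Partial traces. By cyclicity and naturality the partial trace condition need only be tested on
composites H_x ⊗ V → H_z → Σ(H_x ⊗ V). Duality turns the first arrow into an element of H_z ⊗ V*.
Evaluating both sides gives the condition τ_z(b₁) S(b₂) = τ_{zw}(b) g_{w⁻¹}, equivalently τ_z(b₁) b₂
= τ_{zw}(b) g_w⁻¹. As g is group-like, this says exactly that τ = μ(g ·) for a right G-integral μ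
(`trace_partialTraceR_iff`, `isRightSymmetrised_iff_mem`). On the left the pivot enters through its
inverse.

Integrals. It remains to see that integrals form a line and that their symmetrisations satisfy the
twisted symmetry and are non-degenerate. Everything comes from the nonzero left cointegral c of H_1.
The contraction f ↦ c₁ f(c₂) maps the dual of H_{x⁻¹} bijectively onto H_x (`contractR_surjective`),
so forms with μ_x(c₁) c₂ = 1 exist; they are an integral, and every integral is a multiple of them.

Twisted symmetry. From (S a ⊗ 1) Δ(c) = (1 ⊗ a) Δ(c) and Δ(c)(a ⊗ 1) = Δ(c)(1 ⊗ S R(α)(a)) one gets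
μ(S(a) c₁) c₂ = a and μ(c₁ a) c₂ = S(R(α)(a)). Putting a = S(R(α)(q)) in the first formula and
comparing with the second at q, the identity S² = g(·)g⁻¹ gives μ(g R(α)(q) b) = μ(g b q)
(`rightDual_twisted`). The second formula alone gives non-degeneracy. The left case is the mirror
image, with S⁻¹ appearing in the second formula. -/

namespace HopfGCoalgebra
variable {k : Type u} [Field k] {G : Type w} [Group G] (H : HopfGCoalgebra k G)

/-! ### Contractions of tensors, and identities for the coproduct of a cointegral. -/

/-- The contraction `a ⊗ b ↦ f(a) b`. -/
noncomputable def sliceL {A B : Type*} [AddCommGroup A] [Module k A] [AddCommGroup B] [Module k B]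
    (f : Module.Dual k A) : A ⊗[k] B →ₗ[k] B :=
  (TensorProduct.lid k B).toLinearMap ∘ₗ f.rTensor B

/-- The contraction `a ⊗ b ↦ f(b) a`. -/
noncomputable def sliceR {A B : Type*} [AddCommGroup A] [Module k A] [AddCommGroup B] [Module k B]
    (f : Module.Dual k B) : A ⊗[k] B →ₗ[k] A :=
  (TensorProduct.rid k A).toLinearMap ∘ₗ f.lTensor A

section Slice
variable {A B : Type*} [AddCommGroup A] [Module k A] [AddCommGroup B] [Module k B]

@[simp] theorem sliceL_tmul (f : Module.Dual k A) (a : A) (b : B) :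
    sliceL f (a ⊗ₜ[k] b) = f a • b := by simp [sliceL]

@[simp] theorem sliceR_tmul (f : Module.Dual k B) (a : A) (b : B) :
    sliceR f (a ⊗ₜ[k] b) = f b • a := by simp [sliceR]

/-- Evaluating the two legs in either order gives the same scalar, so `contractL t` and `contractR
t` are transposes of each other. -/
theorem apply_sliceL (f : Module.Dual k A) (p : Module.Dual k B) (t : A ⊗[k] B) :
    p (sliceL f t) = f (sliceR p t) := by
  induction t with
  | zero => simp
  | add s t hs ht => simp only [map_add, hs, ht]
  | tmul a b => simp [mul_comm]

theorem sliceL_add (f f' : Module.Dual k A) (t : A ⊗[k] B) :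
    sliceL (f + f') t = sliceL f t + sliceL f' t := by
  simp [sliceL, LinearMap.rTensor_add]

theorem sliceL_smul (c : k) (f : Module.Dual k A) (t : A ⊗[k] B) :
    sliceL (c • f) t = c • sliceL f t := by
  simp [sliceL, LinearMap.rTensor_smul]

theorem sliceR_add (f f' : Module.Dual k B) (t : A ⊗[k] B) :
    sliceR (f + f') t = sliceR f t + sliceR f' t := by
  simp [sliceR, LinearMap.lTensor_add]

theorem sliceR_smul (c : k) (f : Module.Dual k B) (t : A ⊗[k] B) :
    sliceR (c • f) t = c • sliceR f t := by
  simp [sliceR, LinearMap.lTensor_smul]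

/-- The contractions of `t` in the first factor, as a linear map of the linear form. -/
noncomputable def contractL (t : A ⊗[k] B) : Module.Dual k A →ₗ[k] B where
  toFun f := sliceL f t
  map_add' f f' := sliceL_add f f' t
  map_smul' c f := sliceL_smul c f t

/-- The contractions of `t` in the second factor, as a linear map of the linear form. -/
noncomputable def contractR (t : A ⊗[k] B) : Module.Dual k B →ₗ[k] A where
  toFun f := sliceR f t
  map_add' f f' := sliceR_add f f' t
  map_smul' c f := sliceR_smul c f t

@[simp] theorem contractL_apply (t : A ⊗[k] B) (f : Module.Dual k A) :
    contractL t f = sliceL f t := rfl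

@[simp] theorem contractR_apply (t : A ⊗[k] B) (f : Module.Dual k B) :
    contractR t f = sliceR f t := rfl

/-- A linear map whose transpose is surjective is injective. -/
theorem contractL_injective {t : A ⊗[k] B} (h : Function.Surjective (contractR t)) :
    Function.Injective (contractL t) := by
  rw [injective_iff_map_eq_zero]
  intro f hf
  ext a
  obtain ⟨p, rfl⟩ := h a
  rw [contractR_apply, ← apply_sliceL, ← contractL_apply, hf, map_zero, LinearMap.zero_apply]

end Slice

/-- Coassociativity with the first leg evaluated by f: the operator a ↦ f(a₁) a₂ commutes with the
coproduct of the remaining legs. -/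
theorem rTensor_sliceL_cop {x y z p q r : G} (h₁ : x * y = p) (h₂ : p * z = r) (h₃ : y * z = q)
    (h₄ : x * q = r) (f : Module.Dual k (H.A x)) (a : H.A r) :
    (sliceL f ∘ₗ (H.cop h₁).toLinearMap).rTensor _ (H.cop h₂ a) =
      H.cop h₃ (sliceL f (H.cop h₄ a)) := by
  have h := congrArg (fun q => sliceL f q) (H.cop_coassoc h₁ h₂ h₃ h₄ a)
  beta_reduce at h
  have e1 : ∀ t : H.A x ⊗[k] H.A q,
      sliceL f ((H.cop h₃).toLinearMap.lTensor _ t) = H.cop h₃ (sliceL f t) := by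
    intro t
    induction t with
    | zero => simp
    | add s t hs ht => simp only [map_add, hs, ht]
    | tmul a b => simp
  have e2 : ∀ t : H.A p ⊗[k] H.A z,
      sliceL f (TensorProduct.assoc k _ _ _ ((H.cop h₁).toLinearMap.rTensor _ t)) =
        (sliceL f ∘ₗ (H.cop h₁).toLinearMap).rTensor _ t := by
    intro t
    induction t with
    | zero => simp
    | add s t hs ht => simp only [map_add, hs, ht]
    | tmul a b =>
      simp only [LinearMap.rTensor_tmul, AlgHom.toLinearMap_apply, LinearMap.comp_apply]
      generalize H.cop h₁ a = d
      induction d with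
      | zero => simp
      | add s t hs ht => simp only [map_add, add_tmul, hs, ht]
      | tmul a b => simp [smul_tmul']
  rw [e1, e2] at h
  exact h

/-- Coassociativity with the last leg evaluated by f. -/
theorem lTensor_sliceR_cop {x y z p q r : G} (h₁ : x * y = p) (h₂ : p * z = r) (h₃ : y * z = q)
    (h₄ : x * q = r) (f : Module.Dual k (H.A z)) (a : H.A r) :
    (sliceR f ∘ₗ (H.cop h₃).toLinearMap).lTensor _ (H.cop h₄ a) =
      H.cop h₁ (sliceR f (H.cop h₂ a)) := by
  have h := congrArg (fun q => sliceR f ((TensorProduct.assoc k _ _ _).symm q))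
    (H.cop_coassoc h₁ h₂ h₃ h₄ a)
  simp only [LinearEquiv.symm_apply_apply] at h
  have e1 : ∀ t : H.A p ⊗[k] H.A z,
      sliceR f ((H.cop h₁).toLinearMap.rTensor _ t) = H.cop h₁ (sliceR f t) := by
    intro t
    induction t with
    | zero => simp
    | add s t hs ht => simp only [map_add, hs, ht]
    | tmul a b => simp
  have e2 : ∀ t : H.A x ⊗[k] H.A q,
      sliceR f ((TensorProduct.assoc k _ _ _).symm ((H.cop h₃).toLinearMap.lTensor _ t)) =
        (sliceR f ∘ₗ (H.cop h₃).toLinearMap).lTensor _ t := by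
    intro t
    induction t with
    | zero => simp
    | add s t hs ht => simp only [map_add, hs, ht]
    | tmul a b =>
      simp only [LinearMap.lTensor_tmul, AlgHom.toLinearMap_apply, LinearMap.comp_apply]
      generalize H.cop h₃ b = d
      induction d with
      | zero => simp
      | add s t hs ht => simp only [map_add, tmul_add, hs, ht]
      | tmul a b => simp
  rw [e1, e2] at h
  exact h.symm

/-- `∑ (S a₁ ⊗ 1) Δ(a₂) = 1 ⊗ a`. -/
theorem anti_mul_cop {x y : G} (h : y⁻¹ = x) (hxy : x * y = 1) (hyx : y * x = 1) (a : H.A y) :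
    LinearMap.mul' k _ (TensorProduct.map
      ((Algebra.TensorProduct.includeLeft (R := k) (S := k) (B := H.A y)).toLinearMap ∘ₗ H.anti h)
      (H.cop hxy).toLinearMap (H.cop (mul_one y) a)) = 1 ⊗ₜ a := by
  have e1 := H.cop_coassoc hyx (one_mul y) hxy (mul_one y) a
  -- After reassociation the product reads S(a₁) a₂ ⊗ a₃: the antipode axiom collapses the first two
  -- legs, the counit axiom what is left.
  have e2 : ∀ t : H.A 1 ⊗[k] H.A y, LinearMap.mul' k _ (LinearMap.rTensor _
      ((Algebra.TensorProduct.includeLeft (R := k) (S := k) (B := H.A y)).toLinearMap ∘ₗ H.anti h)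
      (TensorProduct.assoc k _ _ _ ((H.cop hyx).toLinearMap.rTensor _ t))) =
      1 ⊗ₜ TensorProduct.lid k _ (H.ε.toLinearMap.rTensor _ t) := by
    intro t
    induction t with
    | zero => simp
    | add s t hs ht => simp only [map_add, hs, ht, tmul_add]
    | tmul b b' =>
      have := H.anti_left hyx h b
      have e : (1 : H.A x) ⊗ₜ[k] (TensorProduct.lid k _ (H.ε.toLinearMap.rTensor _ (b ⊗ₜ[k] b'))) =
        (LinearMap.mul' k _ ((H.anti h).rTensor _ (H.cop hyx b))) ⊗ₜ[k] b' := by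
        rw [this]; simp [Algebra.algebraMap_eq_smul_one, smul_tmul']
      rw [e]
      simp only [LinearMap.rTensor_tmul, AlgHom.toLinearMap_apply]
      generalize H.cop hyx b = d
      induction d with
      | zero => simp
      | add s t hs ht => simp only [map_add, add_tmul, hs, ht]
      | tmul a b => simp
  have e3 := H.cop_counit_left (one_mul y) rfl a
  rw [H.tr_rfl] at e3
  conv_rhs => rw [← e3]
  rw [← e2, e1, ← LinearMap.comp_apply (LinearMap.rTensor _ _), LinearMap.rTensor_comp_lTensor]

/-- `∑ Δ(a₁) (1 ⊗ S a₂) = a ⊗ 1`. -/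
theorem cop_mul_anti {x y : G} (h : x⁻¹ = y) (hxy : x * y = 1) (hyx : y * x = 1) (a : H.A x) :
    LinearMap.mul' k _ (TensorProduct.map (H.cop hxy).toLinearMap
      ((Algebra.TensorProduct.includeRight (R := k) (A := H.A x)).toLinearMap ∘ₗ H.anti h)
      (H.cop (one_mul x) a)) = a ⊗ₜ 1 := by
  have e1 := H.cop_coassoc hxy (one_mul x) hyx (mul_one x) a
  have e2 : ∀ t : H.A x ⊗[k] H.A 1, LinearMap.mul' k _ (LinearMap.lTensor _
      ((Algebra.TensorProduct.includeRight (R := k) (A := H.A x)).toLinearMap ∘ₗ H.anti h)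
      ((TensorProduct.assoc k _ _ _).symm ((H.cop hyx).toLinearMap.lTensor _ t))) =
      TensorProduct.rid k _ (H.ε.toLinearMap.lTensor _ t) ⊗ₜ 1 := by
    intro t
    induction t with
    | zero => simp
    | add s t hs ht => simp only [map_add, hs, ht, add_tmul]
    | tmul b b' =>
      have := H.anti_right hyx h b'
      have e : (TensorProduct.rid k _ (H.ε.toLinearMap.lTensor _ (b ⊗ₜ[k] b'))) ⊗ₜ[k] (1 : H.A y) =
        b ⊗ₜ[k] (LinearMap.mul' k _ ((H.anti h).lTensor _ (H.cop hyx b'))) := by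
        rw [this]; simp [Algebra.algebraMap_eq_smul_one, smul_tmul']
      rw [e]
      simp only [LinearMap.lTensor_tmul, AlgHom.toLinearMap_apply]
      generalize H.cop hyx b' = d
      induction d with
      | zero => simp
      | add s t hs ht => simp only [map_add, tmul_add, hs, ht]
      | tmul a b => simp
  have e3 := H.cop_counit_right (mul_one x) rfl a
  rw [H.tr_rfl] at e3
  conv_rhs => rw [← e3]
  rw [← e2, ← e1, LinearEquiv.symm_apply_apply, ← LinearMap.comp_apply (LinearMap.lTensor _ _),
    LinearMap.lTensor_comp_rTensor]

/-- `c` is a left cointegral of `H_1`. -/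
def IsLeftCointegral (c : H.A 1) : Prop := ∀ a, a * c = H.ε a • c

variable {H}

/-- Substitute 1 ⊗ a = ∑ (S a₁ ⊗ 1) Δ(a₂). The factor a₂ lies in H_1, so a₂ c = ε(a₂) c, and the
counit restores a. -/
theorem IsLeftCointegral.anti_cop {c : H.A 1} (hc : H.IsLeftCointegral c) {x y : G} (h : y⁻¹ = x)
    (hxy : x * y = 1) (a : H.A y) :
    (H.anti h a ⊗ₜ[k] 1) * H.cop hxy c = (1 ⊗ₜ[k] a) * H.cop hxy c := by
  have hyx : y * x = 1 := by simp [← h]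
  rw [← H.anti_mul_cop h hxy hyx a]
  have e3 := H.cop_counit_right (mul_one y) rfl a
  rw [H.tr_rfl] at e3
  conv_lhs => rw [← e3]
  generalize H.cop (mul_one y) a = t
  induction t with
  | zero => simp
  | add s t hs ht => simp only [map_add, add_tmul, add_mul, hs, ht]
  | tmul u v =>
    simp only [LinearMap.lTensor_tmul, TensorProduct.rid_tmul, map_tmul, AlgHom.toLinearMap_apply,
      LinearMap.mul'_apply, mul_assoc, ← map_mul, hc v, LinearMap.comp_apply]
    simp [← smul_tmul']

/-- Substitute a ⊗ 1 = ∑ Δ(a₁)(1 ⊗ S a₂) with a₁ in H_1. Then c a₁ = α(a₁) c, and α(a₁) a₂ is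
R(α)(a). -/
theorem cop_anti_modulus {c : H.A 1} {α : H.A 1 →ₐ[k] k} (hc : ∀ a, c * a = α a • c)
    {x y : G} (h : x⁻¹ = y) (hxy : x * y = 1) (a : H.A x) :
    H.cop hxy c * (a ⊗ₜ[k] 1) = H.cop hxy c * (1 ⊗ₜ[k] H.anti h (H.coactR α x a)) := by
  have hyx : y * x = 1 := by simp [← h]
  rw [← H.cop_mul_anti h hxy hyx a, coactR_apply]
  generalize H.cop (one_mul x) a = t
  induction t with
  | zero => simp
  | add s t hs ht => simp only [map_add, tmul_add, mul_add, hs, ht]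
  | tmul u v =>
    simp only [LinearMap.rTensor_tmul, TensorProduct.lid_tmul, map_tmul, AlgHom.toLinearMap_apply,
      LinearMap.mul'_apply, ← mul_assoc, ← map_mul, hc u, LinearMap.comp_apply]
    simp

end HopfGCoalgebra

/-! ### Contractions of products in a tensor product of algebras. -/

namespace HopfGCoalgebra
variable {k : Type u} [Field k]

section Slice
variable {A B : Type*} [Ring A] [Algebra k A] [Ring B] [Algebra k B]

theorem sliceR_tmul_one_mul (f : Module.Dual k B) (a : A) (t : A ⊗[k] B) :
    sliceR f ((a ⊗ₜ 1) * t) = a * sliceR f t := by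
  induction t with
  | zero => simp
  | add s t hs ht => simp only [mul_add, map_add, hs, ht]
  | tmul b b' => simp

theorem sliceR_mul_tmul_one (f : Module.Dual k B) (a : A) (t : A ⊗[k] B) :
    sliceR f (t * (a ⊗ₜ 1)) = sliceR f t * a := by
  induction t with
  | zero => simp
  | add s t hs ht => simp only [add_mul, map_add, hs, ht]
  | tmul b b' => simp

theorem sliceR_one_tmul_mul (f : Module.Dual k B) (b : B) (t : A ⊗[k] B) :
    sliceR f ((1 ⊗ₜ b) * t) = sliceR (f ∘ₗ LinearMap.mulLeft k b) t := by
  induction t with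
  | zero => simp
  | add s t hs ht => simp only [mul_add, map_add, hs, ht]
  | tmul b b' => simp

theorem sliceR_mul_one_tmul (f : Module.Dual k B) (b : B) (t : A ⊗[k] B) :
    sliceR f (t * (1 ⊗ₜ b)) = sliceR (f ∘ₗ LinearMap.mulRight k b) t := by
  induction t with
  | zero => simp
  | add s t hs ht => simp only [add_mul, map_add, hs, ht]
  | tmul b b' => simp

theorem sliceL_one_tmul_mul (f : Module.Dual k A) (b : B) (t : A ⊗[k] B) :
    sliceL f ((1 ⊗ₜ b) * t) = b * sliceL f t := by
  induction t with
  | zero => simp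
  | add s t hs ht => simp only [mul_add, map_add, hs, ht]
  | tmul b b' => simp

theorem sliceL_mul_one_tmul (f : Module.Dual k A) (b : B) (t : A ⊗[k] B) :
    sliceL f (t * (1 ⊗ₜ b)) = sliceL f t * b := by
  induction t with
  | zero => simp
  | add s t hs ht => simp only [add_mul, map_add, hs, ht]
  | tmul b b' => simp

theorem sliceL_tmul_one_mul (f : Module.Dual k A) (a : A) (t : A ⊗[k] B) :
    sliceL f ((a ⊗ₜ 1) * t) = sliceL (f ∘ₗ LinearMap.mulLeft k a) t := by
  induction t with
  | zero => simp
  | add s t hs ht => simp only [mul_add, map_add, hs, ht]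
  | tmul b b' => simp

theorem sliceL_mul_tmul_one (f : Module.Dual k A) (a : A) (t : A ⊗[k] B) :
    sliceL f (t * (a ⊗ₜ 1)) = sliceL (f ∘ₗ LinearMap.mulRight k a) t := by
  induction t with
  | zero => simp
  | add s t hs ht => simp only [add_mul, map_add, hs, ht]
  | tmul b b' => simp

theorem sum_sliceR_tmul [FiniteDimensional k B] (t : A ⊗[k] B) :
    ∑ i, sliceR ((Module.finBasis k B).coord i) t ⊗ₜ[k] (Module.finBasis k B i) = t := by
  induction t with
  | zero => simp
  | add s t hs ht =>
    simp only [map_add, add_tmul, Finset.sum_add_distrib]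
    rw [hs, ht]
  | tmul a b =>
    simp only [sliceR_tmul, smul_tmul, ← tmul_sum]
    congr 1
    exact (Module.finBasis k B).sum_repr b

end Slice

end HopfGCoalgebra

/-! ### The inverse antipode and non-degeneracy of the coproduct of a cointegral. -/

namespace PivotalHopfGCoalgebra
open HopfGCoalgebra
variable {k : Type u} [Field k] {G : Type w} [Group G] (H : PivotalHopfGCoalgebra k G)

theorem anti_comp_anti {x y : G} (h : x⁻¹ = y) (h' : y⁻¹ = x) (a : H.A x) :
    H.anti h' (H.anti h a) = H.g x * a * ((H.g x)⁻¹ : (H.A x)ˣ) := by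
  subst h
  exact H.antipode_sq x a

/-- S² is conjugation by the pivot, hence injective. -/
theorem anti_injective {x y : G} (h : x⁻¹ = y) : Function.Injective (H.anti h) := by
  have h' : y⁻¹ = x := by rw [← h, inv_inv]
  intro a b hab
  have := congrArg (H.anti h') hab
  rw [H.anti_comp_anti h h', H.anti_comp_anti h h'] at this
  simpa using this

/-- The inverse of the antipode. -/
noncomputable def antiInv {x y : G} (h : y⁻¹ = x) : H.A y →ₗ[k] H.A x :=
  H.anti h ∘ₗ LinearMap.mulLeft k (((H.g y)⁻¹ : (H.A y)ˣ) : H.A y) ∘ₗ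
    LinearMap.mulRight k (H.g y : H.A y)

theorem antiInv_apply {x y : G} (h : y⁻¹ = x) (a : H.A y) :
    H.antiInv h a = H.anti h (((H.g y)⁻¹ : (H.A y)ˣ) * (a * H.g y)) := rfl

/-- S maps S(g⁻¹ a g) to g (g⁻¹ a g) g⁻¹ = a, because S² is conjugation by the pivot. -/
theorem anti_antiInv {x y : G} (h : y⁻¹ = x) (h' : x⁻¹ = y) (a : H.A y) :
    H.anti h' (H.antiInv h a) = a := by
  rw [antiInv_apply, H.anti_comp_anti]
  simp [mul_assoc]

theorem anti_surjective {x y : G} (h : x⁻¹ = y) : Function.Surjective (H.anti h) := by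
  have h' : y⁻¹ = x := by rw [← h, inv_inv]
  exact fun a => ⟨_, H.anti_antiInv h' h a⟩

theorem cop_g {x y z : G} (h : x * y = z) :
    H.cop h (H.g z : H.A z) = (H.g x : H.A x) ⊗ₜ[k] (H.g y : H.A y) := by
  subst h
  exact H.Δ_g x y

/-- The antipode axiom at the group-like element g_1 reads S(g_x) g_{x⁻¹} = ε(g_1) = 1. -/
theorem anti_g {x y : G} (h : x⁻¹ = y) :
    H.anti h (H.g x : H.A x) = ((H.g y)⁻¹ : (H.A y)ˣ) := by
  have h1 := H.anti_left (show x * y = 1 by simp [← h]) h (H.g 1 : H.A 1)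
  rw [H.cop_g, H.ε_g, map_one, LinearMap.rTensor_tmul, LinearMap.mul'_apply] at h1
  rw [← Units.mul_left_inj (H.g y), h1, Units.inv_mul]

/-- The identity S⁻¹(b₂) b₁ = ε(b): the injective, anti-multiplicative map S carries it to the
antipode axiom S(b₁) b₂ = ε(b). -/
theorem antiInv_mul {x y : G} (h : y⁻¹ = x) (hxy : x * y = 1) (b : H.A 1) :
    LinearMap.mul' k _ (TensorProduct.comm k _ _ ((H.antiInv h).lTensor _ (H.cop hxy b))) =
      algebraMap k _ (H.ε b) := by
  have h' : x⁻¹ = y := by rw [← h, inv_inv]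
  apply H.anti_injective h'
  have e := H.anti_left hxy h' b
  have e1 : H.anti h' (algebraMap k _ (H.ε b)) = algebraMap k _ (H.ε b) := by
    simp [Algebra.algebraMap_eq_smul_one, anti_one]
  rw [e1, ← e]
  generalize H.cop hxy b = t
  induction t with
  | zero => simp
  | add s t hs ht => simp only [map_add, hs, ht]
  | tmul a b => simp [H.anti_mul, H.anti_antiInv h h']

/-- The identity b₂ S⁻¹(b₁) = ε(b), which S carries to b₁ S(b₂) = ε(b). -/
theorem mul_antiInv {x y : G} (h : y⁻¹ = x) (hyx : y * x = 1) (b : H.A 1) :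
    LinearMap.mul' k _ (TensorProduct.comm k _ _ ((H.antiInv h).rTensor _ (H.cop hyx b))) =
      algebraMap k _ (H.ε b) := by
  have h' : x⁻¹ = y := by rw [← h, inv_inv]
  apply H.anti_injective h'
  have e := H.anti_right hyx h' b
  have e1 : H.anti h' (algebraMap k _ (H.ε b)) = algebraMap k _ (H.ε b) := by
    simp [Algebra.algebraMap_eq_smul_one, anti_one]
  rw [e1, ← e]
  generalize H.cop hyx b = t
  induction t with
  | zero => simp
  | add s t hs ht => simp only [map_add, hs, ht]
  | tmul a b => simp [H.anti_mul, H.anti_antiInv h h']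

/-- `∑ Δ(a₂) (S⁻¹ a₁ ⊗ 1) = 1 ⊗ a`. -/
theorem cop_mul_antiInv {x y : G} (h : y⁻¹ = x) (hxy : x * y = 1) (hyx : y * x = 1) (a : H.A y) :
    LinearMap.mul' k _ (TensorProduct.comm k _ _ (TensorProduct.map
      ((Algebra.TensorProduct.includeLeft (R := k) (S := k) (B := H.A y)).toLinearMap ∘ₗ H.antiInv h)
      (H.cop hxy).toLinearMap (H.cop (mul_one y) a))) = 1 ⊗ₜ a := by
  have e1 := H.cop_coassoc hyx (one_mul y) hxy (mul_one y) a
  have e2 : ∀ t : H.A 1 ⊗[k] H.A y,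
      LinearMap.mul' k _ (TensorProduct.comm k _ _ (LinearMap.rTensor _
      ((Algebra.TensorProduct.includeLeft (R := k) (S := k) (B := H.A y)).toLinearMap ∘ₗ H.antiInv h)
      (TensorProduct.assoc k _ _ _ ((H.cop hyx).toLinearMap.rTensor _ t)))) =
      1 ⊗ₜ TensorProduct.lid k _ (H.ε.toLinearMap.rTensor _ t) := by
    intro t
    induction t with
    | zero => simp
    | add s t hs ht => simp only [map_add, hs, ht, tmul_add]
    | tmul b b' =>
      have := H.mul_antiInv h hyx b
      have e : (1 : H.A x) ⊗ₜ[k] (TensorProduct.lid k _ (H.ε.toLinearMap.rTensor _ (b ⊗ₜ[k] b'))) =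
        (LinearMap.mul' k _ (TensorProduct.comm k _ _
          ((H.antiInv h).rTensor _ (H.cop hyx b)))) ⊗ₜ[k] b' := by
        rw [this]; simp [Algebra.algebraMap_eq_smul_one, smul_tmul']
      rw [e]
      simp only [LinearMap.rTensor_tmul, AlgHom.toLinearMap_apply]
      generalize H.cop hyx b = d
      induction d with
      | zero => simp
      | add s t hs ht => simp only [map_add, add_tmul, hs, ht]
      | tmul a b => simp
  have e3 := H.cop_counit_left (one_mul y) rfl a
  rw [H.tr_rfl] at e3
  conv_rhs => rw [← e3]
  rw [← e2, e1, ← LinearMap.comp_apply (LinearMap.rTensor _ _), LinearMap.rTensor_comp_lTensor]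

variable {H}

/-- Substitute 1 ⊗ a = ∑ Δ(a₂)(S⁻¹ a₁ ⊗ 1) with a₂ in H_1, and use c a₂ = α(a₂) c. The inverse
antipode is needed because Δ(a₂) has to stand directly to the right of Δ(c). -/
theorem cop_antiInv_modulus {c : H.A 1} {α : H.A 1 →ₐ[k] k} (hc : ∀ a, c * a = α a • c)
    {x y : G} (h : y⁻¹ = x) (hxy : x * y = 1) (a : H.A y) :
    H.cop hxy c * (1 ⊗ₜ[k] a) = H.cop hxy c * (H.antiInv h (H.coactL α y a) ⊗ₜ[k] 1) := by
  have hyx : y * x = 1 := by simp [← h]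
  rw [← H.cop_mul_antiInv h hxy hyx a, coactL_apply]
  generalize H.cop (mul_one y) a = t
  induction t with
  | zero => simp
  | add s t hs ht => simp only [map_add, add_tmul, mul_add, hs, ht]
  | tmul u v =>
    simp only [LinearMap.lTensor_tmul, TensorProduct.rid_tmul, map_tmul, AlgHom.toLinearMap_apply,
      TensorProduct.comm_tmul, LinearMap.mul'_apply, ← mul_assoc, ← map_mul, hc v,
      LinearMap.comp_apply]
    simp [← smul_tmul']

section Nondegenerate
variable [∀ x, FiniteDimensional k (H.A x)] {c : H.A 1}

/-- The elements c₁ f(c₂) form a left ideal of H_x, since S(a) c₁ f(c₂) = c₁ f(a c₂) and S is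
surjective. The point is to find 1 in it, which a twisted contraction of c with S⁻¹ achieves. -/
theorem contractR_surjective (hc : H.IsLeftCointegral c) (hc0 : c ≠ 0) {x y : G}
    (hxy : x * y = 1) : Function.Surjective (contractR (H.cop hxy c)) := by
  have h : y⁻¹ = x := by rw [inv_eq_iff_mul_eq_one, mul_eq_one_comm.1 hxy]
  have ideal : ∀ (s n : H.A x), n ∈ LinearMap.range (contractR (H.cop hxy c)) →
      s * n ∈ LinearMap.range (contractR (H.cop hxy c)) := by
    rintro s _ ⟨f, rfl⟩
    obtain ⟨a, rfl⟩ := H.anti_surjective h s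
    refine ⟨f ∘ₗ LinearMap.mulLeft k a, ?_⟩
    rw [contractR_apply, contractR_apply, ← sliceR_one_tmul_mul, ← hc.anti_cop h,
      sliceR_tmul_one_mul]
  -- Expanding Δ(c) in a basis of H_y exhibits T(c₂) c₁ as a sum of left multiples of elements of
  -- the ideal.
  have key : ∀ T : H.A y →ₗ[k] H.A x,
      LinearMap.mul' k _ (TensorProduct.comm k _ _ (T.lTensor _ (H.cop hxy c))) ∈
        LinearMap.range (contractR (H.cop hxy c)) := by
    intro T
    have e : LinearMap.mul' k _ (TensorProduct.comm k _ _ (T.lTensor _ (H.cop hxy c))) =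
        ∑ i, T (Module.finBasis k (H.A y) i) *
          contractR (H.cop hxy c) ((Module.finBasis k (H.A y)).coord i) := by
      conv_lhs => rw [← sum_sliceR_tmul (H.cop hxy c)]
      simp only [map_sum, LinearMap.lTensor_tmul, TensorProduct.comm_tmul, LinearMap.mul'_apply,
        contractR_apply]
    rw [e]
    exact Submodule.sum_mem _ fun i _ => ideal _ _ ⟨_, rfl⟩
  obtain ⟨f, hf⟩ : ∃ f : Module.Dual k (H.A 1), f c ≠ 0 := by
    by_contra! hf
    exact hc0 ((Module.forall_dual_apply_eq_zero_iff k c).1 hf)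
  -- With T(b) = S⁻¹(b₁) f(b₂) one gets T(c₂) c₁ = S⁻¹(c₂) c₁ f(c₃) = f(c) 1, a nonzero multiple of
  -- 1.
  have h1 := key (H.antiInv h ∘ₗ sliceR f ∘ₗ (H.cop (mul_one y)).toLinearMap)
  rw [LinearMap.lTensor_comp_apply, H.lTensor_sliceR_cop hxy (mul_one 1) (mul_one y) hxy,
    H.antiInv_mul] at h1
  have h2 : H.ε (sliceR f (H.cop (mul_one 1) c)) = f c :=
    (apply_sliceL H.ε.toLinearMap f _).symm.trans
      (congrArg f (H.cop_counit_left (one_mul 1) rfl c))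
  rw [h2, Algebra.algebraMap_eq_smul_one] at h1
  have h3 : (1 : H.A x) ∈ LinearMap.range (contractR (H.cop hxy c)) := by
    simpa [smul_smul, hf] using Submodule.smul_mem _ (f c)⁻¹ h1
  intro a
  simpa using ideal a 1 h3

/-- Surjectivity of the contraction for (x, y) and for (y, x) bounds the dimensions both ways, a
space and its dual having equal dimension. -/
theorem finrank_eq_finrank_inv (hc : H.IsLeftCointegral c) (hc0 : c ≠ 0) {x y : G}
    (hxy : x * y = 1) : Module.finrank k (H.A x) = Module.finrank k (H.A y) := by
  have key : ∀ {x y : G}, x * y = 1 → Module.finrank k (H.A x) ≤ Module.finrank k (H.A y) := by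
    intro x y hxy
    have := LinearMap.finrank_le_finrank_of_surjective (contractR_surjective hc hc0 hxy)
    rwa [Subspace.dual_finrank_eq] at this
  exact le_antisymm (key hxy) (key (mul_eq_one_comm.1 hxy))

/-- Injectivity is dual to the surjectivity of the other contraction; equality of dimensions gives
the rest. -/
theorem contractL_bijective (hc : H.IsLeftCointegral c) (hc0 : c ≠ 0) {x y : G}
    (hxy : x * y = 1) : Function.Bijective (contractL (H.cop hxy c)) := by
  have h := contractL_injective (contractR_surjective hc hc0 hxy)
  refine ⟨h, (LinearMap.injective_iff_surjective_of_finrank_eq_finrank ?_).1 h⟩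
  rw [Subspace.dual_finrank_eq, finrank_eq_finrank_inv hc hc0 hxy]

theorem contractR_bijective (hc : H.IsLeftCointegral c) (hc0 : c ≠ 0) {x y : G}
    (hxy : x * y = 1) : Function.Bijective (contractR (H.cop hxy c)) := by
  have h := contractR_surjective hc hc0 hxy
  refine ⟨(LinearMap.injective_iff_surjective_of_finrank_eq_finrank ?_).2 h, h⟩
  rw [Subspace.dual_finrank_eq, finrank_eq_finrank_inv hc hc0 hxy]

end Nondegenerate

end PivotalHopfGCoalgebra

/-! ### Integrals as the families dual to a cointegral. -/

namespace HopfGCoalgebra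
variable {k : Type u} [Field k] {G : Type w} [Group G] {H : HopfGCoalgebra k G}

theorem sliceL_cop_of_mem {μ : ∀ x, Module.Dual k (H.A x)} (hμ : μ ∈ H.rightIntegrals) {x y z : G}
    (h : x * y = z) (a : H.A z) : sliceL (μ x) (H.cop h a) = μ z a • 1 := by
  subst h
  exact hμ x y a

theorem sliceR_cop_of_mem {μ : ∀ x, Module.Dual k (H.A x)} (hμ : μ ∈ H.leftIntegrals) {x y z : G}
    (h : x * y = z) (a : H.A z) : sliceR (μ y) (H.cop h a) = μ z a • 1 := by
  subst h
  exact hμ x y a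

theorem sliceR_rTensor {A A' B : Type*} [AddCommGroup A] [Module k A] [AddCommGroup B] [Module k B]
    [AddCommGroup A'] [Module k A'] (f : Module.Dual k B) (T : A →ₗ[k] A') (t : A ⊗[k] B) :
    sliceR f (T.rTensor B t) = T (sliceR f t) := by
  induction t with
  | zero => simp
  | add s t hs ht => simp only [map_add, hs, ht]
  | tmul b b' => simp

theorem sliceL_lTensor {A B B' : Type*} [AddCommGroup A] [Module k A] [AddCommGroup B] [Module k B]
    [AddCommGroup B'] [Module k B'] (f : Module.Dual k A) (T : B →ₗ[k] B') (t : A ⊗[k] B) :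
    sliceL f (T.lTensor A t) = T (sliceL f t) := by
  induction t with
  | zero => simp
  | add s t hs ht => simp only [map_add, hs, ht]
  | tmul b b' => simp

theorem rTensor_toSpanSingleton {A A' B : Type*} [AddCommGroup A] [Module k A] [AddCommGroup B]
    [Module k B] [AddCommGroup A'] [Module k A'] (f : Module.Dual k A) (a : A') (t : A ⊗[k] B) :
    (LinearMap.toSpanSingleton k A' a ∘ₗ f).rTensor B t = a ⊗ₜ sliceL f t := by
  induction t with
  | zero => simp
  | add s t hs ht => simp only [map_add, hs, ht, tmul_add]
  | tmul b b' => simp [smul_tmul]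

theorem lTensor_toSpanSingleton {A B B' : Type*} [AddCommGroup A] [Module k A] [AddCommGroup B]
    [Module k B] [AddCommGroup B'] [Module k B'] (f : Module.Dual k B) (b : B') (t : A ⊗[k] B) :
    (LinearMap.toSpanSingleton k B' b ∘ₗ f).lTensor A t = sliceR f t ⊗ₜ b := by
  induction t with
  | zero => simp
  | add s t hs ht => simp only [map_add, hs, ht, add_tmul]
  | tmul b b' => simp [smul_tmul']

/-- The linear forms `μ_x` with `(μ_x ⊗ id) Δ(c) = 1`. -/
def IsRightDualOf (μ : ∀ x, Module.Dual k (H.A x)) (c : H.A 1) : Prop :=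
  ∀ ⦃x y : G⦄ (h : x * y = 1), sliceL (μ x) (H.cop h c) = 1

/-- The linear forms `μ_x` with `(id ⊗ μ_x) Δ(c) = 1`. -/
def IsLeftDualOf (μ : ∀ x, Module.Dual k (H.A x)) (c : H.A 1) : Prop :=
  ∀ ⦃x y : G⦄ (h : x * y = 1), sliceR (μ y) (H.cop h c) = 1

end HopfGCoalgebra

namespace PivotalHopfGCoalgebra
open HopfGCoalgebra
variable {k : Type u} [Field k] {G : Type w} [Group G] {H : PivotalHopfGCoalgebra k G}
variable {c : H.A 1}
variable {μ : ∀ x, Module.Dual k (H.A x)} {α : H.A 1 →ₐ[k] k}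

theorem _root_.HopfGCoalgebra.IsRightDualOf.ne_zero (hc0 : c ≠ 0)
    (hμ : IsRightDualOf μ c) : μ ≠ 0 := by
  rintro rfl
  have h := hμ (one_mul 1)
  rw [Pi.zero_apply, ← contractL_apply, map_zero] at h
  exact hc0 (by rw [← one_mul c, ← h, zero_mul])

theorem _root_.HopfGCoalgebra.IsLeftDualOf.ne_zero (hc0 : c ≠ 0)
    (hμ : IsLeftDualOf μ c) : μ ≠ 0 := by
  rintro rfl
  have h := hμ (one_mul 1)
  rw [Pi.zero_apply, ← contractR_apply, map_zero] at h
  exact hc0 (by rw [← one_mul c, ← h, zero_mul])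

/-- In Sweedler notation, μ(S(a) c₁) c₂ = a μ(c₁) c₂ = a. -/
theorem rightDual_anti (hc : H.IsLeftCointegral c) (hμ : IsRightDualOf μ c) {x y : G}
    (h : y⁻¹ = x) (hxy : x * y = 1) (a : H.A y) :
    sliceL (μ x ∘ₗ LinearMap.mulLeft k (H.anti h a)) (H.cop hxy c) = a := by
  rw [← sliceL_tmul_one_mul, hc.anti_cop h hxy, sliceL_one_tmul_mul, hμ hxy, mul_one]

/-- In Sweedler notation, μ(c₁ a) c₂ = μ(c₁) c₂ S(R(α)(a)) = S(R(α)(a)). -/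
theorem rightDual_mul (hα : ∀ a, c * a = α a • c) (hμ : IsRightDualOf μ c) {x y : G}
    (h : x⁻¹ = y) (hxy : x * y = 1) (a : H.A x) :
    sliceL (μ x ∘ₗ LinearMap.mulRight k a) (H.cop hxy c) = H.anti h (H.autR α x a) := by
  rw [← sliceL_mul_tmul_one, cop_anti_modulus hα h hxy, sliceL_mul_one_tmul, hμ hxy, one_mul]
  rfl

/-- In Sweedler notation, c₁ μ(a c₂) = S(a) c₁ μ(c₂) = S(a). -/
theorem leftDual_anti (hc : H.IsLeftCointegral c) (hμ : IsLeftDualOf μ c) {x y : G}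
    (h : y⁻¹ = x) (hxy : x * y = 1) (a : H.A y) :
    sliceR (μ y ∘ₗ LinearMap.mulLeft k a) (H.cop hxy c) = H.anti h a := by
  rw [← sliceR_one_tmul_mul, ← hc.anti_cop h hxy, sliceR_tmul_one_mul, hμ hxy, mul_one]

/-- In Sweedler notation, c₁ μ(c₂ a) = c₁ μ(c₂) S⁻¹(L(α)(a)) = S⁻¹(L(α)(a)). -/
theorem leftDual_mul (hα : ∀ a, c * a = α a • c) (hμ : IsLeftDualOf μ c) {x y : G}
    (h : y⁻¹ = x) (hxy : x * y = 1) (a : H.A y) :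
    sliceR (μ y ∘ₗ LinearMap.mulRight k a) (H.cop hxy c) = H.antiInv h (H.autL α y a) := by
  rw [← sliceR_mul_one_tmul, cop_antiInv_modulus hα h hxy, sliceR_mul_tmul_one, hμ hxy, one_mul]
  rfl

/-- The form b ↦ μ(b a) determines S(R(α)(a)) = μ(c₁ a) c₂, and both S and R(α) are injective. -/
theorem rightDual_right_nondegenerate (hα : ∀ a, c * a = α a • c) (hμ : IsRightDualOf μ c) {x : G}
    (a : H.A x) (ha : ∀ b, μ x (b * a) = 0) : a = 0 := by
  have e := rightDual_mul hα hμ rfl (mul_inv_cancel x) a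
  have e1 : μ x ∘ₗ LinearMap.mulRight k a = 0 := LinearMap.ext ha
  rw [e1, ← contractL_apply, map_zero] at e
  have := H.anti_injective rfl (e.symm.trans (map_zero _).symm)
  simpa using this

theorem leftDual_right_nondegenerate (hα : ∀ a, c * a = α a • c) (hμ : IsLeftDualOf μ c) {x : G}
    (a : H.A x) (ha : ∀ b, μ x (b * a) = 0) : a = 0 := by
  have e := leftDual_mul hα hμ rfl (inv_mul_cancel x) a
  have e1 : μ x ∘ₗ LinearMap.mulRight k a = 0 := LinearMap.ext ha
  rw [e1, ← contractR_apply, map_zero] at e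
  have := congrArg (H.anti (inv_inv x)) e
  rw [H.anti_antiInv] at this
  simpa using this.symm

variable [∀ x, FiniteDimensional k (H.A x)]

/-- In each degree the equation μ_x(c₁) c₂ = 1 is solvable because the contraction of Δ(c) is
bijective. -/
theorem exists_isRightDualOf (hc : H.IsLeftCointegral c) (hc0 : c ≠ 0) :
    ∃ μ : ∀ x, Module.Dual k (H.A x), IsRightDualOf μ c := by
  choose μ hμ using fun x : G => (contractL_bijective hc hc0 (mul_inv_cancel x)).2 1
  refine ⟨μ, fun x y h => ?_⟩
  obtain rfl : y = x⁻¹ := by rw [eq_inv_iff_mul_eq_one, mul_eq_one_comm.1 h]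
  exact hμ x

theorem exists_isLeftDualOf (hc : H.IsLeftCointegral c) (hc0 : c ≠ 0) :
    ∃ μ : ∀ x, Module.Dual k (H.A x), IsLeftDualOf μ c := by
  choose μ hμ using fun x : G => (contractR_bijective hc hc0 (inv_mul_cancel x)).2 1
  refine ⟨μ, fun x y h => ?_⟩
  obtain rfl : x = y⁻¹ := by rw [eq_inv_iff_mul_eq_one, h]
  exact hμ y

/-- Each a in H_{xy} is some c₁ f(c₂). By coassociativity μ_x(c₁) c₂ ⊗ c₃ = Δ(1) = 1 ⊗ 1, which is
also 1 ⊗ μ_{xy}(c₁) c₂; applying f to the last leg gives the integral equation for a. -/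
theorem _root_.HopfGCoalgebra.IsRightDualOf.mem_rightIntegrals (hc : H.IsLeftCointegral c)
    (hc0 : c ≠ 0) (hμ : IsRightDualOf μ c) :
    μ ∈ H.rightIntegrals := by
  intro x y a
  have h1 : (x * y) * (x * y)⁻¹ = 1 := mul_inv_cancel _
  obtain ⟨f, rfl⟩ := contractR_surjective hc hc0 h1 a
  have h2 : y * (x * y)⁻¹ = x⁻¹ := by simp
  have e1 := H.rTensor_sliceL_cop (rfl : x * y = x * y) h1 h2 (mul_inv_cancel x) (μ x) c
  rw [hμ, map_one, Algebra.TensorProduct.one_def] at e1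
  have e2 := rTensor_toSpanSingleton (μ (x * y)) (1 : H.A y) (H.cop h1 c)
  rw [hμ h1, ← e1] at e2
  have e3 := congrArg (sliceR f) e2
  rw [sliceR_rTensor, sliceR_rTensor] at e3
  exact e3.symm

/-- Mirror image of the right case: each a in H_{xy} is some f(c₁) c₂, and f is applied to the first
leg of c₁ ⊗ c₂ μ_y(c₃) = 1 ⊗ 1 = c₁ μ_{xy}(c₂) ⊗ 1. -/
theorem _root_.HopfGCoalgebra.IsLeftDualOf.mem_leftIntegrals (hc : H.IsLeftCointegral c)
    (hc0 : c ≠ 0) (hμ : IsLeftDualOf μ c) :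
    μ ∈ H.leftIntegrals := by
  intro x y a
  have h1 : (x * y)⁻¹ * (x * y) = 1 := inv_mul_cancel _
  obtain ⟨f, rfl⟩ := (contractL_bijective hc hc0 h1).2 a
  have h2 : (x * y)⁻¹ * x = y⁻¹ := by simp
  have e1 := H.lTensor_sliceR_cop h2 (inv_mul_cancel y) (rfl : x * y = x * y) h1 (μ y) c
  rw [hμ, map_one, Algebra.TensorProduct.one_def] at e1
  have e2 := lTensor_toSpanSingleton (μ (x * y)) (1 : H.A x) (H.cop h1 c)
  rw [hμ h1, ← e1] at e2
  have e3 := congrArg (sliceL f) e2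
  rw [sliceL_lTensor, sliceL_lTensor] at e3
  exact e3.symm

/-- Both sides have the same contraction with Δ(c), and that contraction is injective. Indeed,
coassociativity in degrees x, x⁻¹, 1 and the integral property give Δ(ν_x(c₁) c₂) = 1 ⊗ ν_1(c₁) c₂;
applying ε to the last leg shows ν_x(c₁) c₂ to be a scalar independent of x, namely ν_1(c). -/
theorem eq_smul_of_mem_rightIntegrals (hc : H.IsLeftCointegral c)
    (hc0 : c ≠ 0) {ν : ∀ x, Module.Dual k (H.A x)} (hμ : IsRightDualOf μ c)
    (hν : ν ∈ H.rightIntegrals) : H.ε (sliceL (ν 1) (H.cop (one_mul 1) c)) • μ = ν := by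
  ext1 x
  have h1 : x * x⁻¹ = 1 := mul_inv_cancel x
  apply (contractL_bijective hc hc0 h1).1
  rw [Pi.smul_apply, map_smul, contractL_apply, contractL_apply, hμ h1]
  have e1 := H.rTensor_sliceL_cop h1 (one_mul 1) (mul_one x⁻¹) h1 (ν x) c
  have e2 : sliceL (ν x) ∘ₗ (H.cop h1).toLinearMap =
      LinearMap.toSpanSingleton k (H.A x⁻¹) 1 ∘ₗ ν 1 :=
    LinearMap.ext fun a => sliceL_cop_of_mem hν h1 a
  rw [e2, rTensor_toSpanSingleton] at e1
  have e3 := congrArg (sliceR H.ε.toLinearMap) e1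
  rw [sliceR_tmul] at e3
  exact e3.trans (H.cop_counit_right (mul_one x⁻¹) rfl _)

theorem eq_smul_of_mem_leftIntegrals (hc : H.IsLeftCointegral c)
    (hc0 : c ≠ 0) {ν : ∀ x, Module.Dual k (H.A x)} (hμ : IsLeftDualOf μ c)
    (hν : ν ∈ H.leftIntegrals) : H.ε (sliceR (ν 1) (H.cop (one_mul 1) c)) • μ = ν := by
  ext1 x
  have h1 : x⁻¹ * x = 1 := inv_mul_cancel x
  apply (contractR_bijective hc hc0 h1).1
  rw [Pi.smul_apply, map_smul, contractR_apply, contractR_apply, hμ h1]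
  have e1 := H.lTensor_sliceR_cop (one_mul x⁻¹) h1 h1 (one_mul 1) (ν x) c
  have e2 : sliceR (ν x) ∘ₗ (H.cop h1).toLinearMap =
      LinearMap.toSpanSingleton k (H.A x⁻¹) 1 ∘ₗ ν 1 :=
    LinearMap.ext fun a => sliceR_cop_of_mem hν h1 a
  rw [e2, lTensor_toSpanSingleton] at e1
  have e3 := congrArg (sliceL H.ε.toLinearMap) e1
  rw [sliceL_tmul] at e3
  exact e3.trans (H.cop_counit_left (one_mul x⁻¹) rfl _)

theorem finrank_rightIntegrals (hc : H.IsLeftCointegral c) (hc0 : c ≠ 0) :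
    Module.finrank k H.rightIntegrals = 1 := by
  obtain ⟨μ, hμ⟩ := exists_isRightDualOf hc hc0
  refine finrank_eq_one (⟨μ, hμ.mem_rightIntegrals hc hc0⟩ : H.rightIntegrals)
    (fun h => hμ.ne_zero hc0 (congrArg Subtype.val h))
    fun ν => ⟨_, Subtype.ext (eq_smul_of_mem_rightIntegrals hc hc0 hμ ν.2)⟩

theorem finrank_leftIntegrals (hc : H.IsLeftCointegral c) (hc0 : c ≠ 0) :
    Module.finrank k H.leftIntegrals = 1 := by
  obtain ⟨μ, hμ⟩ := exists_isLeftDualOf hc hc0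
  refine finrank_eq_one (⟨μ, hμ.mem_leftIntegrals hc hc0⟩ : H.leftIntegrals)
    (fun h => hμ.ne_zero hc0 (congrArg Subtype.val h))
    fun ν => ⟨_, Subtype.ext (eq_smul_of_mem_leftIntegrals hc hc0 hμ ν.2)⟩

/-- Write g b = c₁ f(c₂) and compute f(S(R(α)(q))) twice. `rightDual_mul` gives μ(g b q).
`rightDual_anti` at a = S(R(α)(q)), where S(a) = g R(α)(q) g⁻¹, gives μ(g R(α)(q) g⁻¹ g b). -/
theorem rightDual_twisted (hc : H.IsLeftCointegral c) (hc0 : c ≠ 0) (hα : ∀ a, c * a = α a • c)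
    (hμ : IsRightDualOf μ c) (x : G) (q b : H.A x) :
    μ x (H.g x * (H.autR α x q * b)) = μ x (H.g x * (b * q)) := by
  have hxy : x * x⁻¹ = 1 := mul_inv_cancel x
  obtain ⟨f, hf⟩ := contractR_surjective hc hc0 hxy (H.g x * b)
  obtain rfl : b = ((H.g x)⁻¹ : (H.A x)ˣ) * contractR (H.cop hxy c) f := by
    rw [hf, Units.inv_mul_cancel_left]
  have e1 := congrArg f (rightDual_mul hα hμ rfl hxy q)
  have e2 := congrArg f (rightDual_anti hc hμ (inv_inv x) hxy (H.anti rfl (H.autR α x q)))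
  rw [apply_sliceL] at e1 e2
  rw [H.anti_comp_anti] at e2
  simpa [mul_assoc] using e2.trans e1.symm

/-- Write g⁻¹ b = f(c₁) c₂ and compute f(S⁻¹(L(α)(q))) twice, using S⁻¹(L(α)(q)) = S(g⁻¹ L(α)(q) g).
-/
theorem leftDual_twisted (hc : H.IsLeftCointegral c) (hc0 : c ≠ 0) (hα : ∀ a, c * a = α a • c)
    (hμ : IsLeftDualOf μ c) (x : G) (q b : H.A x) :
    μ x (((H.g x)⁻¹ : (H.A x)ˣ) * (H.autL α x q * b)) = μ x (((H.g x)⁻¹ : (H.A x)ˣ) * (b * q)) := by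
  have hxy : x⁻¹ * x = 1 := inv_mul_cancel x
  obtain ⟨f, hf⟩ := (contractL_bijective hc hc0 hxy).2 (((H.g x)⁻¹ : (H.A x)ˣ) * b)
  obtain rfl : b = H.g x * contractL (H.cop hxy c) f := by
    rw [hf, Units.mul_inv_cancel_left]
  have e1 := congrArg f (leftDual_mul hα hμ rfl hxy q)
  have e2 := congrArg f (leftDual_anti hc hμ rfl hxy
    (((H.g x)⁻¹ : (H.A x)ˣ) * (H.autL α x q * H.g x)))
  rw [← apply_sliceL] at e1 e2
  rw [antiInv_apply] at e1
  simpa [mul_assoc] using e2.trans e1.symm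

end PivotalHopfGCoalgebra

/-! ### Cyclic traces and generating families. -/

namespace CategoryTheory
section
variable {k : Type*} [Field k] {D : Type*} [Category D] [Preadditive D] [Linear k D] {S : D ⥤ D}
variable {ι : Type*} {R : ι → D}

/-- Every object is a retract of a finite direct sum of objects of the family `R`. -/
def IsRetractGenerating (R : ι → D) : Prop :=
  ∀ P : D, ∃ (n : ℕ) (x : Fin n → ι) (i : ∀ j, P ⟶ R (x j)) (p : ∀ j, R (x j) ⟶ P),
    ∑ j, i j ≫ p j = 𝟙 P

/-- Insert the decomposition of the identity in front of f and move each inclusion around by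
cyclicity. -/
theorem IsSCyclic.eq_sum {t : TraceFamily k S} (ht : IsSCyclic t) {P : D} {n : ℕ} {x : Fin n → ι}
    {i : ∀ j, P ⟶ R (x j)} {p : ∀ j, R (x j) ⟶ P} (h : ∑ j, i j ≫ p j = 𝟙 P) (f : P ⟶ S.obj P) :
    t P f = ∑ j, t (R (x j)) (p j ≫ f ≫ S.map (i j)) := by
  conv_lhs => rw [← Category.id_comp f, ← h, Preadditive.sum_comp, map_sum]
  refine Finset.sum_congr rfl fun j _ => ?_
  rw [Category.assoc, ht, Category.assoc]

theorem IsSCyclic.ext {t t' : TraceFamily k S} (ht : IsSCyclic t) (ht' : IsSCyclic t')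
    (hR : IsRetractGenerating R) (h : ∀ x, t (R x) = t' (R x)) : t = t' := by
  funext P
  ext f
  obtain ⟨n, x, i, p, e⟩ := hR P
  rw [ht.eq_sum e, ht'.eq_sum e]
  simp only [h]

/-- Cyclicity forces t_P(f) = ∑ T(S(i) f p) for a chosen decomposition ∑ p i = 1 of P, and this is
taken as the definition. Inserting the decompositions of both X and Y turns the two sides of the
cyclicity condition into double sums that `hT` matches term by term. -/
theorem exists_isSCyclic [S.Additive] (hR : IsRetractGenerating R)
    (T : ∀ x, (R x ⟶ S.obj (R x)) →ₗ[k] k)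
    (hT : ∀ ⦃x y : ι⦄ (g : R x ⟶ R y) (f : R y ⟶ S.obj (R x)),
      T x (g ≫ f) = T y (f ≫ S.map g)) :
    ∃ t : TraceFamily k S, IsSCyclic t ∧ ∀ x, t (R x) = T x := by
  choose n x i p h using hR
  refine ⟨fun P => ∑ j, T (x P j) ∘ₗ Linear.leftComp k _ (p P j) ∘ₗ
    Linear.rightComp k P (S.map (i P j)), fun X Y g f => ?_, fun z => ?_⟩
  · simp only [LinearMap.sum_apply, LinearMap.comp_apply, Linear.leftComp_apply,
      Linear.rightComp_apply]
    have e1 : ∀ j, T (x X j) (p X j ≫ (g ≫ f) ≫ S.map (i X j)) =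
        ∑ l, T (x Y l) (p Y l ≫ f ≫ S.map (i X j) ≫ S.map (p X j) ≫ S.map g ≫ S.map (i Y l)) := by
      intro j
      have : p X j ≫ (g ≫ f) ≫ S.map (i X j) =
          ∑ l, (p X j ≫ g ≫ i Y l) ≫ p Y l ≫ f ≫ S.map (i X j) := by
        conv_lhs => rw [Category.assoc, ← Category.id_comp f, ← h Y]
        simp only [Preadditive.sum_comp, Preadditive.comp_sum, Category.assoc]
      rw [this, map_sum]
      refine Finset.sum_congr rfl fun l _ => ?_
      rw [hT]
      simp only [Functor.map_comp, Category.assoc]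
    simp only [e1]
    rw [Finset.sum_comm]
    refine Finset.sum_congr rfl fun l _ => ?_
    rw [← map_sum]
    congr 1
    -- The sum over j is the image under S of the decomposition of the identity of X, so it can be
    -- removed.
    have e2 := congrArg S.map (h X)
    rw [S.map_sum, S.map_id] at e2
    have : p Y l ≫ (f ≫ S.map g) ≫ S.map (i Y l) =
        p Y l ≫ f ≫ 𝟙 _ ≫ S.map g ≫ S.map (i Y l) := by simp
    rw [this, ← e2]
    simp only [Preadditive.sum_comp, Preadditive.comp_sum, Category.assoc, Functor.map_comp]
  · ext f
    simp only [LinearMap.sum_apply, LinearMap.comp_apply, Linear.leftComp_apply,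
      Linear.rightComp_apply]
    -- On a member of the family the chosen decomposition need not be the trivial one; cyclicity of
    -- T moves the inclusions back, and the sum recombines to the identity.
    have : ∀ j, T (x (R z) j) (p (R z) j ≫ f ≫ S.map (i (R z) j)) =
        T z (i (R z) j ≫ p (R z) j ≫ f) := by
      intro j
      rw [hT (i (R z) j) (p (R z) j ≫ f), Category.assoc]
    simp only [this]
    rw [← map_sum]
    simp only [← Category.assoc]
    rw [← Preadditive.sum_comp, h, Category.id_comp]

/-- A morphism is the sum of its components between generators. By cyclicity, pairing a component
with a morphism of generators is pairing the whole morphism with the composite through P or P', so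
every component of a degenerate morphism vanishes. -/
theorem IsSCyclic.traceNondegenerate [S.Additive] {t : TraceFamily k S} (ht : IsSCyclic t)
    (hR : IsRetractGenerating R)
    (h₁ : ∀ (x y : ι) (f : R y ⟶ S.obj (R x)), (∀ g : R x ⟶ R y, t (R x) (g ≫ f) = 0) → f = 0)
    (h₂ : ∀ (x y : ι) (g : R x ⟶ R y),
      (∀ f : R y ⟶ S.obj (R x), t (R x) (g ≫ f) = 0) → g = 0) :
    TraceNondegenerate t := by
  intro P P'
  obtain ⟨n, x, i, p, e⟩ := hR P
  obtain ⟨n', x', i', p', e'⟩ := hR P'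
  constructor
  · intro f hf
    have key : ∀ j j', p' j' ≫ f ≫ S.map (i j) = 0 := by
      intro j j'
      refine h₁ _ _ _ fun g => ?_
      have := hf (i j ≫ g ≫ p' j')
      rw [Category.assoc, ht] at this
      simpa using this
    have e2 := congrArg S.map e
    rw [S.map_sum, S.map_id] at e2
    rw [← Category.id_comp f, ← Category.comp_id f, ← e', ← e2]
    simp only [Preadditive.sum_comp, Preadditive.comp_sum, Functor.map_comp, Category.assoc]
    refine Finset.sum_eq_zero fun j _ => Finset.sum_eq_zero fun j' _ => ?_
    have := key j j'
    rw [← Category.assoc f, ← Category.assoc (p' j'), this]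
    simp
  · intro g hg
    have key : ∀ j j', p j ≫ g ≫ i' j' = 0 := by
      intro j j'
      refine h₂ _ _ _ fun f => ?_
      have := hg (i' j' ≫ f ≫ S.map (p j))
      rw [Category.assoc, Category.assoc, ht (p j)]
      simpa using this
    rw [← Category.id_comp g, ← Category.comp_id g, ← e', ← e]
    simp only [Preadditive.sum_comp, Preadditive.comp_sum, Category.assoc]
    refine Finset.sum_eq_zero fun j _ => Finset.sum_eq_zero fun j' _ => ?_
    have := key j' j
    rw [← Category.assoc g, ← Category.assoc (p j'), this]
    simp

end
end CategoryTheory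

/-! ### Projective modules as retracts of sums of regular modules. -/

namespace HopfGCoalgebra
variable {k : Type u} [Field k] {G : Type w} [Group G] {H : HopfGCoalgebra k G}
namespace Rep
open MonoidalCategory

theorem lin_sum {V W : H.Rep} {ι : Type*} (s : Finset ι) (f : ι → (V ⟶ W)) :
    lin (∑ j ∈ s, f j) = ∑ j ∈ s, lin (f j) :=
  map_sum (⟨⟨lin, rfl⟩, fun _ _ => rfl⟩ : (V ⟶ W) →+ (V.V →ₗ[k] W.V)) f s

theorem epi_of_surjective {V W : H.Rep} (f : V ⟶ W) (hf : Function.Surjective (lin f)) : Epi f where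
  left_cancellation g h e := hom_ext (LinearMap.ext fun w => by
    obtain ⟨v, rfl⟩ := hf w
    exact LinearMap.congr_fun (congrArg lin e) v)

variable [∀ x, FiniteDimensional k (H.A x)]

/-- The morphism `H_x ⟶ V`, `a ↦ a v`. -/
noncomputable def freeHom (x : G) (V : H.Rep) (v : V.V) : regular H x ⟶ V :=
  ofLin (V := regular H x) ((V.act x).flip v) fun a b =>
    (LinearMap.congr_fun (ρ_mul_act V a x b) v).symm

/-- H_x is free of rank one on 1_x: the element a is a · 1_x. -/
theorem hom_regular_apply {x : G} {V : H.Rep} (f : regular H x ⟶ V) (a : H.A x) :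
    lin f a = V.act x a (lin f (1 : H.A x)) := by
  classical
  have h := lin_comm f (Pi.single x a) (1 : H.A x)
  have h3 : (regular H x).ρ (Pi.single x a) (1 : H.A x) = a := by
    change (Pi.single x a : ∀ x, H.A x) x * 1 = a
    simp
  rw [h3] at h
  exact h

theorem freeHom_one {x : G} {V : H.Rep} (f : regular H x ⟶ V) :
    freeHom x V (lin f (1 : H.A x)) = f :=
  hom_ext (LinearMap.ext fun a => (hom_regular_apply f a).symm)

theorem hom_regular_ext {x : G} {V : H.Rep} {f g : regular H x ⟶ V}
    (h : lin f (1 : H.A x) = lin g (1 : H.A x)) : f = g := by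
  rw [← freeHom_one f, h, freeHom_one]

theorem regular_act (x : G) (a b : H.A x) : (regular H x).act x a b = a * b := by
  classical
  change (Pi.single x a : ∀ x, H.A x) x * b = _
  simp

theorem regular_act_ne {x y : G} (h : x ≠ y) (a : H.A x) (b : H.A y) :
    (regular H y).act x a b = 0 := by
  classical
  change (Pi.single x a : ∀ x, H.A x) y * b = _
  simp [Pi.single_eq_of_ne h.symm]

theorem supportedOn_regular (x : G) : (regular H x).SupportedOn {x} := fun a ha => by
  simp [ha x (by simp)]

/-- The finite direct sum of regular modules. -/
noncomputable abbrev regularSum (H : HopfGCoalgebra k G) [∀ x, FiniteDimensional k (H.A x)] {n : ℕ}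
    (x : Fin n → G) : H.Rep where
  V := ∀ j, H.A (x j)
  ρ := (Algebra.lmul k (∀ j, H.A (x j))).comp (AlgHom.pi fun j => Pi.evalAlgHom k H.A (x j))
  finite_support := by
    classical
    refine ⟨Finset.univ.image x, fun a ha => ?_⟩
    refine LinearMap.ext fun v => funext fun j => ?_
    change a (x j) * v j = 0
    rw [ha _ (Finset.mem_image_of_mem x (Finset.mem_univ j)), zero_mul]

/-- The projections of a finite direct sum of regular modules. -/
noncomputable def regularSumProj {n : ℕ} (x : Fin n → G) (j : Fin n) :
    regularSum H x ⟶ regular H (x j) :=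
  ofLin (V := regularSum H x) (W := regular H (x j)) (LinearMap.proj j) fun _ _ => rfl

/-- The morphism from a finite direct sum of regular modules given by elements `v j`. -/
noncomputable def regularSumDesc {n : ℕ} (x : Fin n → G) (V : H.Rep) (v : Fin n → V.V) :
    regularSum H x ⟶ V :=
  ∑ j, regularSumProj x j ≫ freeHom (x j) V (v j)

theorem lin_regularSumDesc {n : ℕ} (x : Fin n → G) (V : H.Rep) (v : Fin n → V.V)
    (a : ∀ j, H.A (x j)) :
    lin (regularSumDesc x V v) a = ∑ j, V.act (x j) (a j) (v j) := by
  rw [regularSumDesc, lin_sum, LinearMap.sum_apply]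
  rfl

/-- A vector is the sum of its homogeneous components 1_x v, over the finitely many degrees of the
support. -/
theorem exists_surjective_regularSumDesc (V : H.Rep) :
    ∃ (n : ℕ) (x : Fin n → G) (v : Fin n → V.V),
      Function.Surjective (lin (regularSumDesc x V v)) := by
  obtain ⟨s, hs⟩ := V.finite_support
  let b := Module.finBasis k V.V
  -- One summand for each pair of a basis vector and a degree of the support.
  let e := (Fintype.equivFin (Fin (Module.finrank k V.V) × s)).symm
  refine ⟨_, fun j => (e j).2, fun j => b (e j).1, fun w => ?_⟩
  -- The preimage of w carries the coefficient of each basis vector in all degrees at once.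
  refine ⟨fun j => b.repr w (e j).1 • 1, ?_⟩
  rw [lin_regularSumDesc, e.sum_comp fun p => V.act (p.2 : G) (b.repr w p.1 • 1) (b p.1),
    Fintype.sum_prod_type]
  have h1 := ρ_eq_sum hs 1
  rw [map_one] at h1
  have h2 : ∀ i, ∑ y : s, V.act (y : G) (b.repr w i • 1) (b i) = b.repr w i • b i := by
    intro i
    have := LinearMap.congr_fun h1 (b i)
    rw [LinearMap.sum_apply, ← Finset.sum_coe_sort s fun y => V.act y ((1 : ∀ x, H.A x) y) (b i)]
      at this
    simp only [map_smul, LinearMap.smul_apply]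
    rw [← Finset.smul_sum]
    exact congrArg _ this.symm
  simp only [h2]
  exact b.sum_repr w

/-- Lift the identity of P through a surjection from a finite sum of regular modules. -/
theorem exists_retract_regular (P : H.Rep) (hP : Projective P) :
    ∃ (n : ℕ) (x : Fin n → G) (i : ∀ j, P ⟶ regular H (x j)) (p : ∀ j, regular H (x j) ⟶ P),
      ∑ j, i j ≫ p j = 𝟙 P := by
  obtain ⟨n, x, v, h⟩ := exists_surjective_regularSumDesc P
  have := epi_of_surjective _ h
  refine ⟨n, x, fun j => Projective.factorThru (𝟙 P) (regularSumDesc x P v) ≫ regularSumProj x j,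
    fun j => freeHom (x j) P (v j), ?_⟩
  simp only [Category.assoc]
  rw [← Preadditive.comp_sum]
  exact Projective.factorThru_comp _ _

end Rep
end HopfGCoalgebra

/-! ### Cyclic traces on projective modules as families of linear forms. -/

namespace PivotalHopfGCoalgebra
open MonoidalCategory HopfGCoalgebra HopfGCoalgebra.Rep
variable {k : Type u} [Field k] {G : Type w} [Group G] {H : PivotalHopfGCoalgebra k G}

instance (φ : ∀ x, H.A x ≃ₐ[k] H.A x) : (twistPmod φ).Additive where
  map_add := rfl

instance (α : H.A 1 →ₐ[k] k) : (twistR (H := H) α).Additive :=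
  inferInstanceAs (twistPmod _).Additive

instance (α : H.A 1 →ₐ[k] k) : (twistL (H := H) α).Additive :=
  inferInstanceAs (twistPmod _).Additive

variable [∀ x, FiniteDimensional k (H.A x)]

theorem isRetractGenerating_regular : IsRetractGenerating (fun x => H.regularPmod x) := by
  intro P
  obtain ⟨n, x, i, p, h⟩ := exists_retract_regular P.obj P.property
  refine ⟨n, x, fun j => ObjectProperty.homMk (i j), fun j => ObjectProperty.homMk (p j), ?_⟩
  ext
  have : (∑ j, (ObjectProperty.homMk (i j) : P ⟶ H.regularPmod (x j)) ≫
      (ObjectProperty.homMk (p j) : H.regularPmod (x j) ⟶ P)).hom = ∑ j, i j ≫ p j :=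
    map_sum ((isProjective H.Rep).ι.mapAddHom (X := P) (Y := P)) _ _
  rw [this, h]
  rfl

section Twist
variable (φ : ∀ x, H.A x ≃ₐ[k] H.A x)

/-- The morphism `H_x ⟶ φ_* H_x`, `a ↦ φ(a) b`. -/
noncomputable def twistHom (x : G) :
    H.A x ≃ₗ[k] (H.regularPmod x ⟶ (twistPmod φ).obj (H.regularPmod x)) where
  toFun b := ObjectProperty.homMk (freeHom x (twist φ (regular H.toHopfGCoalgebra x)) b)
  map_add' b b' := ObjectProperty.hom_ext _ (hom_ext (map_add _ b b'))
  map_smul' r b := ObjectProperty.hom_ext _ (hom_ext (map_smul _ r b))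
  invFun f := lin f.hom (1 : H.A x)
  left_inv b := by
    change (twist φ (regular H.toHopfGCoalgebra x)).act x 1 b = b
    rw [twist_act, regular_act, map_one, one_mul]
  right_inv f := ObjectProperty.hom_ext _ (freeHom_one _)

variable {φ}

/-- The value `g(1)` of an endomorphism of `H_x`. -/
noncomputable def regularValue {x : G} (g : H.regularPmod x ⟶ H.regularPmod x) : H.A x :=
  lin g.hom (1 : H.A x)

/-- The value `f(1)` of a morphism `H_x ⟶ φ_* H_x`. -/
noncomputable def twistValue {x : G}
    (f : H.regularPmod x ⟶ (twistPmod φ).obj (H.regularPmod x)) : H.A x :=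
  lin f.hom (1 : H.A x)

theorem lin_hom_regular {x : G} (g : H.regularPmod x ⟶ H.regularPmod x) (a : H.A x) :
    lin g.hom a = a * regularValue g := by
  have := hom_regular_apply g.hom a
  exact this.trans (regular_act x a _)

theorem lin_hom_twist_regular {x : G}
    (f : H.regularPmod x ⟶ (twistPmod φ).obj (H.regularPmod x)) (a : H.A x) :
    lin f.hom a = φ x a * twistValue f := by
  have := hom_regular_apply f.hom a
  refine this.trans ?_
  change (twist φ (regular H.toHopfGCoalgebra x)).act x a _ = _
  rw [twist_act]
  exact regular_act x (φ x a) _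

/-- The unit 1_x acts as the identity on H_x and as zero on H_y. -/
theorem hom_regular_eq_zero {x y : G} (h : x ≠ y) (g : H.regularPmod x ⟶ H.regularPmod y) :
    g = 0 := by
  refine ObjectProperty.hom_ext _ (hom_regular_ext ?_)
  refine (hom_regular_apply g.hom 1).trans ?_
  exact regular_act_ne h _ _

theorem hom_twist_regular_eq_zero {x y : G} (h : x ≠ y)
    (g : H.regularPmod x ⟶ (twistPmod φ).obj (H.regularPmod y)) :
    g = 0 := by
  refine ObjectProperty.hom_ext _ (hom_regular_ext ?_)
  refine (hom_regular_apply g.hom 1).trans ?_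
  change (twist φ (regular H.toHopfGCoalgebra y)).act x 1 _ = _
  rw [twist_act]
  exact regular_act_ne h _ _

/-- The linear forms `b ↦ t(a ↦ φ(a) b)` on the algebras `H_x` defined by a family `t` of linear
forms. -/
noncomputable def traceForms :
    TraceFamily k (twistPmod φ) →ₗ[k] ∀ x, Module.Dual k (H.A x) where
  toFun t x := t (H.regularPmod x) ∘ₗ (twistHom φ x).toLinearMap
  map_add' _ _ := rfl
  map_smul' _ _ := rfl

theorem apply_eq_traceForms (t : TraceFamily k (twistPmod φ)) {x : G}
    (f : H.regularPmod x ⟶ (twistPmod φ).obj (H.regularPmod x)) :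
    t (H.regularPmod x) f = traceForms t x (twistValue f) :=
  congrArg (t (H.regularPmod x)) ((twistHom φ x).right_inv f).symm

/-- Families of linear forms with `τ_x(φ(q) b) = τ_x(b q)`. -/
def IsTwistedSymmetric (φ : ∀ x, H.A x ≃ₐ[k] H.A x) (τ : ∀ x, Module.Dual k (H.A x)) : Prop :=
  ∀ x (q b : H.A x), τ x (φ x q * b) = τ x (b * q)

/-- For q = g(1) and b = f(1), the composites f ∘ g and g ∘ f send 1 to φ(q) b and b q. Twisted
symmetry is thus cyclicity on the regular modules; between different degrees there is nothing to
check. -/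
theorem exists_isSCyclic_of_isTwistedSymmetric {τ : ∀ x, Module.Dual k (H.A x)}
    (hτ : IsTwistedSymmetric φ τ) :
    ∃ t : TraceFamily k (twistPmod φ), IsSCyclic t ∧ traceForms t = τ := by
  obtain ⟨t, ht, h⟩ := exists_isSCyclic (S := twistPmod φ) (isRetractGenerating_regular (H := H))
    (fun x => τ x ∘ₗ (twistHom φ x).symm.toLinearMap) (by
      intro x y g f
      by_cases hxy : x = y
      · subst hxy
        change τ x (lin f.hom (lin g.hom (1 : H.A x))) = τ x (lin g.hom (lin f.hom (1 : H.A x)))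
        have h1 := lin_hom_twist_regular f (regularValue g)
        have h2 := lin_hom_regular g (twistValue f)
        exact (congrArg (τ x) h1).trans ((hτ x (regularValue g) (twistValue f)).trans (congrArg (τ x) h2).symm)
      · rw [hom_regular_eq_zero hxy g, Functor.map_zero, Limits.comp_zero, Limits.zero_comp,
          map_zero, map_zero])
  refine ⟨t, ht, ?_⟩
  funext x
  ext b
  change t (H.regularPmod x) _ = _
  rw [h x]
  exact congrArg (τ x) ((twistHom φ x).left_inv b)

theorem eq_of_traceForms_eq {t t' : TraceFamily k (twistPmod φ)} (ht : IsSCyclic t)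
    (ht' : IsSCyclic t') (h : traceForms t = traceForms t') : t = t' := by
  refine ht.ext ht' (isRetractGenerating_regular (H := H)) fun x => ?_
  ext f
  rw [apply_eq_traceForms, apply_eq_traceForms, h]

/-- On regular modules both arguments of the pairing reduce to the form τ(a b) with b the morphism
under test: directly for the twisted morphism, after one use of cyclicity for the other. Hence a
one-sided condition suffices. -/
theorem traceNondegenerate_of_traceForms {t : TraceFamily k (twistPmod φ)} (ht : IsSCyclic t)
    (h₁ : ∀ x (b : H.A x), (∀ a, traceForms t x (a * b) = 0) → b = 0) :
    TraceNondegenerate t := by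
  refine ht.traceNondegenerate (isRetractGenerating_regular (H := H)) ?_ ?_
  · intro x y f hf
    by_cases hxy : y = x
    · subst hxy
      refine ObjectProperty.hom_ext _ (hom_regular_ext (h₁ y (twistValue f) fun a => ?_))
      -- The composite takes 1 to φ(g(1)) f(1), so testing against a requires g(1) = φ⁻¹(a).
      have := hf (ObjectProperty.homMk (freeHom y _ ((φ y).symm a)))
      rw [apply_eq_traceForms] at this
      refine Eq.trans (congrArg (traceForms t y) ?_) this
      have h3 := lin_hom_twist_regular f ((φ y).symm a)
      rw [AlgEquiv.apply_symm_apply] at h3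
      refine h3.symm.trans (congrArg (lin f.hom) ?_)
      exact ((regular_act y 1 _).trans (one_mul _)).symm
    · exact hom_twist_regular_eq_zero hxy f
  · intro x y g hg
    by_cases hxy : x = y
    · subst hxy
      refine ObjectProperty.hom_ext _ (hom_regular_ext (h₁ x (regularValue g) fun a => ?_))
      have := hg (twistHom φ x a)
      rw [ht, apply_eq_traceForms] at this
      refine Eq.trans (congrArg (traceForms t x) ?_) this
      have h3 := lin_hom_regular g a
      refine h3.symm.trans (congrArg (lin g.hom) ?_)
      exact ((twistHom φ x).left_inv a).symm
    · exact hom_regular_eq_zero hxy g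

end Twist
end PivotalHopfGCoalgebra

/-! ### Reduction of partial trace conditions to generators, and tensor products with regular
modules. -/

namespace CategoryTheory
variable {k : Type*} [Field k] {D : Type*} [Category D] [Preadditive D] [Linear k D] {S : D ⥤ D}
variable {ι : Type*} {R : ι → D}

/-- A cyclic trace on the objects `F P` agrees with its composition with a natural operation
`Hom(F P, S F P) → Hom(P, S P)` as soon as it does so on the morphisms between the images of the
objects of a generating family. -/
theorem IsSCyclic.eq_partialTrace [S.Additive] {t : TraceFamily k S} (ht : IsSCyclic t)
    (hR : IsRetractGenerating R) (F : D ⥤ D) [F.Additive]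
    (ptr : ∀ P : D, (F.obj P ⟶ S.obj (F.obj P)) →+ (P ⟶ S.obj P))
    (hptr : ∀ {P Q : D} (u : Q ⟶ P) (f : F.obj P ⟶ S.obj (F.obj P)) (v : P ⟶ Q),
      ptr Q (F.map u ≫ f ≫ S.map (F.map v)) = u ≫ ptr P f ≫ S.map v)
    (h : ∀ (x z : ι) (i : F.obj (R x) ⟶ R z) (f : R z ⟶ S.obj (F.obj (R x))),
      t (F.obj (R x)) (i ≫ f) = t (R x) (ptr _ (i ≫ f))) (P : D)
    (f : F.obj P ⟶ S.obj (F.obj P)) : t (F.obj P) f = t P (ptr P f) := by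
  -- For a generator R x, decomposing the identity of F(R x) writes every f as a sum of morphisms
  -- that start by passing through some R z.
  have h' : ∀ (x : ι) (f : F.obj (R x) ⟶ S.obj (F.obj (R x))),
      t (F.obj (R x)) f = t (R x) (ptr _ f) := by
    intro x f
    obtain ⟨n, z, i, p, e⟩ := hR (F.obj (R x))
    rw [← Category.id_comp f, ← e, Preadditive.sum_comp, map_sum, map_sum, map_sum]
    refine Finset.sum_congr rfl fun j _ => ?_
    rw [Category.assoc, h]
  obtain ⟨n, x, i, p, e⟩ := hR P
  -- For general P, F carries the decomposition of P to one of F P; cyclicity on F P and naturality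
  -- of the operation then match the two sums termwise.
  have e' : ∑ j, F.map (i j) ≫ F.map (p j) = 𝟙 (F.obj P) := by
    rw [← F.map_id, ← e, F.map_sum]
    simp only [F.map_comp]
  rw [ht.eq_sum e]
  conv_lhs => rw [← Category.id_comp f, ← e', Preadditive.sum_comp, map_sum]
  refine Finset.sum_congr rfl fun j _ => ?_
  rw [Category.assoc, ht, Category.assoc, h', hptr]

end CategoryTheory

namespace HopfGCoalgebra
variable {k : Type u} [Field k] {G : Type w} [Group G] {H : HopfGCoalgebra k G}
namespace Rep

theorem SupportedOn.mono {V : H.Rep} {s s' : Finset G} (h : V.SupportedOn s) (hs : s ⊆ s') :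
    V.SupportedOn s' :=
  fun a ha => h a fun x hx => ha x (hs hx)

variable [∀ x, FiniteDimensional k (H.A x)]

/-- H_z lives in the single degree z and x = z y determines y, so only one summand of the action on
the tensor product survives. -/
theorem tensor_regular_act {x y z : G} (h : z * y = x) (W : H.Rep) (b : H.A x) (a : H.A z)
    (v : W.V) : (tensor (regular H z) W).act x b (a ⊗ₜ[k] v : H.A z ⊗[k] W.V) =
      TensorProduct.map (LinearMap.mulRight k a) ((W.act y).flip v) (H.cop h b) := by
  classical
  obtain ⟨t, ht⟩ := W.finite_support
  have ht' := SupportedOn.mono (V := W) ht (Finset.subset_insert y t)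
  have e := LinearMap.congr_fun (tensor_act_flip (supportedOn_regular (H := H) z) ht' x a v) b
  refine e.trans ?_
  rw [Finset.sum_singleton, LinearMap.sum_apply,
    Finset.sum_eq_single_of_mem y (Finset.mem_insert_self y t)]
  · rw [dif_pos h, LinearMap.comp_apply]
    congr 2
    exact LinearMap.ext fun c => regular_act z c a
  · intro y' _ hy'
    rw [dif_neg, LinearMap.zero_apply]
    intro h'
    exact hy' (mul_left_cancel (h'.trans h.symm))

theorem tensor_act_regular {x y z : G} (h : y * z = x) (W : H.Rep) (b : H.A x) (a : H.A z)
    (v : W.V) : (tensor W (regular H z)).act x b (v ⊗ₜ[k] a : W.V ⊗[k] H.A z) =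
      TensorProduct.map ((W.act y).flip v) (LinearMap.mulRight k a) (H.cop h b) := by
  classical
  obtain ⟨t, ht⟩ := W.finite_support
  have ht' := SupportedOn.mono (V := W) ht (Finset.subset_insert y t)
  have e := LinearMap.congr_fun (tensor_act_flip ht' (supportedOn_regular (H := H) z) x v a) b
  refine e.trans ?_
  rw [LinearMap.sum_apply, Finset.sum_eq_single_of_mem y (Finset.mem_insert_self y t)]
  · rw [Finset.sum_singleton, dif_pos h, LinearMap.comp_apply]
    congr 2
    exact LinearMap.ext fun c => regular_act z c a
  · intro y' _ hy'
    rw [Finset.sum_singleton, dif_neg, LinearMap.zero_apply]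
    intro h'
    exact hy' (mul_right_cancel (h'.trans h.symm))

end Rep
end HopfGCoalgebra

/-! ### The right partial trace on underlying vector spaces. -/

namespace PivotalHopfGCoalgebra
open MonoidalCategory HopfGCoalgebra HopfGCoalgebra.Rep
variable {k : Type u} [Field k] {G : Type w} [Group G] {H : PivotalHopfGCoalgebra k G}

section PartialTrace
variable {V V' U U' W : Type*} [AddCommGroup V] [Module k V] [AddCommGroup V'] [Module k V']
  [AddCommGroup U] [Module k U] [AddCommGroup U'] [Module k U']
  [AddCommGroup W] [Module k W] [FiniteDimensional k W]

/-- The partial trace over `W` of a linear map `V ⊗ W → V' ⊗ W`, twisted by an endomorphism of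
`W`. -/
noncomputable def partialTraceR (γ : Module.End k W) (E : V ⊗[k] W →ₗ[k] V' ⊗[k] W) : V →ₗ[k] V' :=
  ∑ i, sliceR ((Module.Basis.ofVectorSpace k W).coord i ∘ₗ γ) ∘ₗ E ∘ₗ
    (TensorProduct.mk k V W).flip (Module.Basis.ofVectorSpace k W i)

theorem partialTraceR_apply (γ : Module.End k W) (E : V ⊗[k] W →ₗ[k] V' ⊗[k] W) (v : V) :
    partialTraceR γ E v = ∑ i, sliceR ((Module.Basis.ofVectorSpace k W).coord i ∘ₗ γ)
      (E (v ⊗ₜ Module.Basis.ofVectorSpace k W i)) := by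
  simp [partialTraceR]

theorem partialTraceR_add (γ : Module.End k W) (E E' : V ⊗[k] W →ₗ[k] V' ⊗[k] W) :
    partialTraceR γ (E + E') = partialTraceR γ E + partialTraceR γ E' := by
  ext v
  simp [partialTraceR_apply, Finset.sum_add_distrib]

theorem partialTraceR_comp (γ : Module.End k W) (E : V ⊗[k] W →ₗ[k] V' ⊗[k] W) (f : U →ₗ[k] V)
    (g : V' →ₗ[k] U') :
    partialTraceR γ (g.rTensor W ∘ₗ E ∘ₗ f.rTensor W) = g ∘ₗ partialTraceR γ E ∘ₗ f := by
  ext v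
  simp [partialTraceR_apply, sliceR_rTensor]

/-- If E(v ⊗ w) depends on w only through ω, the trace over W amounts to the basis expansion of ω ∘
γ, applied to the fixed tensor e. -/
theorem partialTraceR_of_eq_smul (γ : Module.End k W) {E : V ⊗[k] W →ₗ[k] V' ⊗[k] W} {v : V}
    (ω : Module.Dual k W) (e : V' ⊗[k] W) (h : ∀ w, E (v ⊗ₜ w) = ω w • e) :
    partialTraceR γ E v = sliceR (ω ∘ₗ γ) e := by
  rw [partialTraceR_apply]
  simp only [h, map_smul]
  have e1 : ω ∘ₗ γ = ∑ i, ω (Module.Basis.ofVectorSpace k W i) •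
      ((Module.Basis.ofVectorSpace k W).coord i ∘ₗ γ) := by
    ext w
    rw [LinearMap.comp_apply]
    conv_lhs => rw [← (Module.Basis.ofVectorSpace k W).sum_repr (γ w), map_sum]
    rw [LinearMap.sum_apply]
    refine Finset.sum_congr rfl fun i _ => ?_
    rw [map_smul, smul_eq_mul, mul_comm]
    rfl
  rw [e1, ← contractR_apply, map_sum]
  simp only [map_smul, contractR_apply]

end PartialTrace

/-- The loop is opened by ∑ vᵢ ⊗ vᵢ* and closed by v ⊗ f ↦ f(g v); this is where the twist by the
pivot comes from. -/
theorem lin_rightPartialTrace (α : H.A 1 →ₐ[k] k) (P : H.Pmod) (V : H.Rep)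
    (f : MonoidalRightAction.actionObj P V ⟶ (twistR α).obj (MonoidalRightAction.actionObj P V)) :
    lin (rightPartialTrace (twistR α) f).hom =
      partialTraceR (V := P.obj.V) (V' := P.obj.V) (W := V.V)
        (V.ρ fun x => (H.g x : H.A x)) (lin f.hom) := by
  refine LinearMap.ext fun p => ?_
  obtain ⟨F, hF⟩ : ∃ F : Module.End k (P.obj.V ⊗[k] V.V), F = lin f.hom := ⟨_, rfl⟩
  -- The module structure of the twist consists of identity maps, so only the linear maps of the
  -- duality and the associators remain.
  have h0 : lin (rightPartialTrace (twistR α) f).hom p =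
    TensorProduct.rid k P.obj.V ((lin (ε_ (TwoSidedDuality.dual V) V)).lTensor P.obj.V
      (TensorProduct.assoc k P.obj.V V.V (Module.Dual k V.V)
        (F.rTensor (Module.Dual k V.V)
          ((TensorProduct.assoc k P.obj.V V.V (Module.Dual k V.V)).symm
            (p ⊗ₜ[k] coevaluation k V.V 1))))) := by
    rw [hF]; rfl
  have key : ∀ (φ : Module.Dual k V.V) (t : P.obj.V ⊗[k] V.V),
      TensorProduct.rid k P.obj.V ((lin (ε_ (TwoSidedDuality.dual V) V)).lTensor P.obj.V
        (TensorProduct.assoc k P.obj.V V.V (Module.Dual k V.V) (t ⊗ₜ φ))) =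
      sliceR (φ ∘ₗ V.ρ fun x => (H.g x : H.A x)) t := by
    intro φ t
    induction t with
    | zero => simp
    | add s t hs ht => simp only [add_tmul, map_add, hs, ht]
    | tmul b b' =>
      simp only [assoc_tmul, LinearMap.lTensor_tmul, sliceR_tmul]
      rw [tev_tmul]
      exact rid_tmul _ _
  rw [h0, ← hF, coevaluation_apply_one, tmul_sum]
  simp only [map_sum, assoc_symm_tmul, LinearMap.rTensor_tmul]
  refine Eq.trans ?_ (partialTraceR_apply (V' := P.obj.V) _ _ p).symm
  exact Finset.sum_congr rfl fun i _ => key _ _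

/-- The functor `P ↦ P ⊗ V` on projective modules. -/
noncomputable def tensorRightPmod (V : H.Rep) : H.Pmod ⥤ H.Pmod where
  obj P := MonoidalRightAction.actionObj P V
  map f := ObjectProperty.homMk (f.hom ▷ V)
  map_id P := ObjectProperty.hom_ext _ (id_whiskerRight P.obj V)
  map_comp f g := ObjectProperty.hom_ext _ (comp_whiskerRight f.hom g.hom V)

instance (V : H.Rep) : (tensorRightPmod V).Additive where
  map_add {_ _ f g} := ObjectProperty.hom_ext _ (hom_ext
    (LinearMap.rTensor_add V.V (lin f.hom) (lin g.hom)))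

/-- The right partial trace as an additive map. -/
noncomputable def rightPartialTraceHom (α : H.A 1 →ₐ[k] k) (V : H.Rep) (P : H.Pmod) :
    ((tensorRightPmod V).obj P ⟶ (twistR α).obj ((tensorRightPmod V).obj P)) →+
      (P ⟶ (twistR α).obj P) :=
  AddMonoidHom.mk' (fun f => rightPartialTrace (twistR α) f) fun f g => by
    refine ObjectProperty.hom_ext _ (hom_ext ?_)
    refine (lin_rightPartialTrace α P V (f + g)).trans ?_
    refine (partialTraceR_add _ _ _).trans ?_
    exact (congrArg₂ (· + ·) (lin_rightPartialTrace α P V f) (lin_rightPartialTrace α P V g)).symm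

theorem rightPartialTraceHom_natural (α : H.A 1 →ₐ[k] k) (V : H.Rep) {P Q : H.Pmod} (u : Q ⟶ P)
    (f : (tensorRightPmod V).obj P ⟶ (twistR α).obj ((tensorRightPmod V).obj P)) (v : P ⟶ Q) :
    rightPartialTraceHom α V Q ((tensorRightPmod V).map u ≫ f ≫
      (twistR α).map ((tensorRightPmod V).map v)) =
      u ≫ rightPartialTraceHom α V P f ≫ (twistR α).map v := by
  refine ObjectProperty.hom_ext _ (hom_ext ?_)
  refine (lin_rightPartialTrace α Q V _).trans ?_
  refine (partialTraceR_comp _ (lin f.hom) (lin u.hom) (lin v.hom)).trans ?_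
  exact congrArg (fun E => lin v.hom ∘ₗ E ∘ₗ lin u.hom) (lin_rightPartialTrace α P V f).symm

end PivotalHopfGCoalgebra

/-! ### The right partial trace condition in terms of linear forms. -/

namespace PivotalHopfGCoalgebra
open MonoidalCategory HopfGCoalgebra HopfGCoalgebra.Rep
variable {k : Type u} [Field k] {G : Type w} [Group G] {H : PivotalHopfGCoalgebra k G}

theorem lin_tensorRightHomEquiv_symm {X V Z : H.Rep} (q : X ⟶ Z ⊗ TwoSidedDuality.dual V) (b : X.V)
    (v : V.V) :
    lin ((tensorRightHomEquiv X V (TwoSidedDuality.dual V) Z).symm q) (b ⊗ₜ[k] v : X.V ⊗[k] V.V) =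
      sliceR (A := Z.V) (B := Module.Dual k V.V) (Module.Dual.eval k V.V v) (lin q b) := by
  have h0 : lin ((tensorRightHomEquiv X V (TwoSidedDuality.dual V) Z).symm q)
      (b ⊗ₜ[k] v : X.V ⊗[k] V.V) =
    TensorProduct.rid k Z.V ((contractLeft k V.V).lTensor Z.V
      (TensorProduct.assoc k Z.V (Module.Dual k V.V) V.V (lin q b ⊗ₜ[k] v))) := rfl
  rw [h0]
  have key : ∀ t : Z.V ⊗[k] Module.Dual k V.V,
    TensorProduct.rid k Z.V ((contractLeft k V.V).lTensor Z.V
      (TensorProduct.assoc k Z.V (Module.Dual k V.V) V.V (t ⊗ₜ[k] v))) =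
    sliceR (Module.Dual.eval k V.V v) t := by
    intro t
    induction t with
    | zero => simp
    | add s t hs ht => simp only [add_tmul, map_add, hs, ht]
    | tmul b b' => simp
  exact key _

/-- Families with `τ_z(b₁) S(b₂) = τ_{zw}(b) g_{w⁻¹}`. -/
def IsRightSymmetrised (H : PivotalHopfGCoalgebra k G) (τ : ∀ x, Module.Dual k (H.A x)) : Prop :=
  ∀ ⦃x z w w' : G⦄ (h : z * w = x) (hw : w⁻¹ = w') (b : H.A x),
    H.anti hw (sliceL (τ z) (H.cop h b)) = τ x b • (H.g w' : H.A w')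

variable [∀ x, FiniteDimensional k (H.A x)]

/-- The morphism `H_x ⊗ V ⟶ H_z`, `b ⊗ v ↦ b₁ ψ(S(b₂) v)`. -/
noncomputable def coactHomR (x z : G) (V : H.Rep) (ψ : Module.Dual k V.V) :
    regular H.toHopfGCoalgebra x ⊗ V ⟶ regular H.toHopfGCoalgebra z :=
  (tensorRightHomEquiv _ V (TwoSidedDuality.dual V) _).symm
    (freeHom x (tensor (regular H.toHopfGCoalgebra z) (dual V)) ((1 : H.A z) ⊗ₜ[k] ψ))

theorem lin_coactHomR {x z w w' : G} (h : z * w = x) (hw : w⁻¹ = w') (V : H.Rep)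
    (ψ : Module.Dual k V.V) (b : H.A x) (v : V.V) :
    lin (coactHomR x z V ψ) (b ⊗ₜ[k] v : H.A x ⊗[k] V.V) =
      sliceR (ψ ∘ₗ (V.act w').flip v ∘ₗ H.anti hw) (H.cop h b) := by
  refine (lin_tensorRightHomEquiv_symm (X := regular H.toHopfGCoalgebra x) _ b v).trans ?_
  have e := tensor_regular_act h (dual V) b (1 : H.A z) ψ
  refine (congrArg (sliceR (A := H.A z) (B := Module.Dual k V.V) (Module.Dual.eval k V.V v))
    e).trans ?_
  generalize H.cop h b = t
  induction t with
  | zero => simp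
  | add s t hs ht => simp only [map_add, hs, ht]
  | tmul a a' =>
    simp only [map_tmul, sliceR_tmul, LinearMap.mulRight_apply, mul_one, LinearMap.comp_apply,
      LinearMap.flip_apply]
    congr 1
    exact dual_act V hw a' ψ v

theorem apply_lin_coactHomR {τ : ∀ x, Module.Dual k (H.A x)} {x z w w' : G} (h : z * w = x)
    (hw : w⁻¹ = w') (V : H.Rep) (ψ : Module.Dual k V.V) (b : H.A x) (v : V.V) :
    τ z (lin (coactHomR x z V ψ) (b ⊗ₜ[k] v : H.A x ⊗[k] V.V)) =
      ψ (V.act w' (H.anti hw (sliceL (τ z) (H.cop h b))) v) := by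
  rw [lin_coactHomR h hw, ← apply_sliceL]
  rfl

theorem lin_coactHomR_one {x z w w' : G} (h : z * w = x) (hw : w⁻¹ = w') (V : H.Rep)
    (ψ : Module.Dual k V.V) (v : V.V) :
    lin (coactHomR x z V ψ) ((1 : H.A x) ⊗ₜ[k] v : H.A x ⊗[k] V.V) =
      (ψ ∘ₗ V.act w' 1) v • (1 : H.A z) := by
  refine (lin_coactHomR h hw V ψ 1 v).trans ?_
  rw [map_one, Algebra.TensorProduct.one_def, sliceR_tmul]
  simp [anti_one]

/-- On b ⊗ v the left side is ψ(τ_z(b₁) S(b₂) v), which the hypothesis turns into τ_x(b) ψ(g v). -/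
theorem IsRightSymmetrised.apply_coactHomR {τ : ∀ x, Module.Dual k (H.A x)}
    (hτ : IsRightSymmetrised H τ) {x z w w' : G} (h : z * w = x) (hw : w⁻¹ = w') (V : H.Rep)
    (ψ : Module.Dual k V.V) (e : H.A x ⊗[k] V.V) :
    τ z (lin (coactHomR x z V ψ) e) = τ x (sliceR (ψ ∘ₗ V.act w' (H.g w' : H.A w')) e) := by
  induction e with
  | zero => exact (congrArg (τ z) (map_zero _)).trans (by simp)
  | add e e' he he' =>
    refine (congrArg (τ z) (map_add _ e e')).trans ?_
    exact (map_add _ _ _).trans ((congrArg₂ (· + ·) he he').trans (by simp))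
  | tmul b v =>
    rw [apply_lin_coactHomR h hw, hτ h hw]
    simp [mul_comm]

/-- The morphism `H_x ⊗ V ⟶ H_z` corresponding to an element of `H_z ⊗ V*`. -/
noncomputable def freeMateR (x z : G) (V : H.Rep) (e : H.A z ⊗[k] Module.Dual k V.V) :
    regular H.toHopfGCoalgebra x ⊗ V ⟶ regular H.toHopfGCoalgebra z :=
  (tensorRightHomEquiv _ V (TwoSidedDuality.dual V) _).symm
    (freeHom x (tensor (regular H.toHopfGCoalgebra z) (dual V)) e)

theorem lin_freeMateR (x z : G) (V : H.Rep) (e : H.A z ⊗[k] Module.Dual k V.V) (b : H.A x)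
    (v : V.V) : lin (freeMateR x z V e) (b ⊗ₜ[k] v : H.A x ⊗[k] V.V) =
      sliceR (A := H.A z) (B := Module.Dual k V.V) (Module.Dual.eval k V.V v)
        ((tensor (regular H.toHopfGCoalgebra z) (dual V)).act x b e) :=
  lin_tensorRightHomEquiv_symm (X := regular H.toHopfGCoalgebra x) _ b v

theorem freeMateR_add (x z : G) (V : H.Rep) (e e' : H.A z ⊗[k] Module.Dual k V.V) :
    freeMateR x z V (e + e') = freeMateR x z V e + freeMateR x z V e' := by
  refine hom_ext (TensorProduct.ext' fun b v => ?_)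
  refine (lin_freeMateR x z V _ b v).trans ?_
  rw [map_add, map_add]
  exact (congrArg₂ (· + ·) (lin_freeMateR x z V e b v) (lin_freeMateR x z V e' b v)).symm

/-- The element a ⊗ ψ is the image of 1 ⊗ ψ under right multiplication by a, an endomorphism of the
module H_z. It can be absorbed in the next morphism, so the elements 1 ⊗ ψ suffice. -/
theorem freeMateR_tmul {x z w : G} (h : z * w = x) (V : H.Rep) (a : H.A z)
    (ψ : Module.Dual k V.V) :
    freeMateR x z V (a ⊗ₜ ψ) = coactHomR x z V ψ ≫ freeHom z (regular H.toHopfGCoalgebra z) a := by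
  refine hom_ext (TensorProduct.ext' fun b v => ?_)
  refine (lin_freeMateR x z V _ b v).trans ?_
  have e1 := lin_freeMateR x z V (1 ⊗ₜ[k] ψ) b v
  have e2 := regular_act (H := H.toHopfGCoalgebra) z
    (lin (freeMateR x z V (1 ⊗ₜ[k] ψ)) (b ⊗ₜ[k] v : H.A x ⊗[k] V.V)) a
  refine Eq.trans ?_ e2.symm
  refine Eq.trans ?_ (congrArg (· * a) e1.symm)
  have h1 := tensor_regular_act h (dual V) b a ψ
  have h2 := tensor_regular_act h (dual V) b 1 ψ
  refine (congrArg _ h1).trans (Eq.trans ?_ (congrArg (fun y => sliceR (A := H.A z)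
    (B := Module.Dual k V.V) (Module.Dual.eval k V.V v) y * a) h2.symm))
  generalize H.cop h b = s
  induction s with
  | zero => simp
  | add s t hs ht => simp only [map_add, add_mul, hs, ht]
  | tmul c d => simp

section
variable {α : H.A 1 →ₐ[k] k} {t : TraceFamily k (twistR (H := H) α)}

/-- The value at `1` of a morphism `H_z ⟶ R(α)_* (H_x ⊗ V)`. -/
noncomputable def twistTensorValueR {x z : G} {V : H.Rep}
    (f : H.regularPmod z ⟶ (twistR α).obj ((tensorRightPmod V).obj (H.regularPmod x))) :
    H.A x ⊗[k] V.V :=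
  lin f.hom (1 : H.A z)

/-- Cyclicity moves the trace from H_x ⊗ V to H_z, where only the value at 1 counts. -/
theorem trace_coactHomR (ht : IsSCyclic t) {x z : G} {V : H.Rep} (ψ : Module.Dual k V.V)
    (f : H.regularPmod z ⟶ (twistR α).obj ((tensorRightPmod V).obj (H.regularPmod x))) :
    t ((tensorRightPmod V).obj (H.regularPmod x))
        ((ObjectProperty.homMk (coactHomR x z V ψ) :
          (tensorRightPmod V).obj (H.regularPmod x) ⟶ H.regularPmod z) ≫ f) =
      traceForms (φ := H.autR α) t z (lin (coactHomR x z V ψ) (twistTensorValueR f)) := by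
  rw [ht]
  exact apply_eq_traceForms (φ := H.autR α) t _

/-- Since 1 ⊗ v goes to ψ(1_{w'} v) 1_z, the composite sends 1 ⊗ v to ψ(1_{w'} v) times the value of
f at 1. The trace over V is then an evaluation, with g inserted by ev'. -/
theorem trace_partialTrace_coactHomR {x z w w' : G} (h : z * w = x)
    (hw : w⁻¹ = w') {V : H.Rep} (ψ : Module.Dual k V.V)
    (f : H.regularPmod z ⟶ (twistR α).obj ((tensorRightPmod V).obj (H.regularPmod x))) :
    t (H.regularPmod x) (rightPartialTraceHom α V (H.regularPmod x)
        ((ObjectProperty.homMk (coactHomR x z V ψ) :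
          (tensorRightPmod V).obj (H.regularPmod x) ⟶ H.regularPmod z) ≫ f)) =
      traceForms (φ := H.autR α) t x
        (sliceR (ψ ∘ₗ V.act w' (H.g w' : H.A w')) (twistTensorValueR f)) := by
  refine (apply_eq_traceForms (φ := H.autR α) t _).trans (congrArg _ ?_)
  refine (LinearMap.congr_fun (lin_rightPartialTrace α (H.regularPmod x) V _) (1 : H.A x)).trans ?_
  refine (partialTraceR_of_eq_smul (V := H.A x) (V' := H.A x) _ (ψ ∘ₗ V.act w' 1)
    (twistTensorValueR f) fun v => ?_).trans ?_
  · refine (congrArg (lin f.hom) (lin_coactHomR_one h hw V ψ v)).trans ?_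
    exact map_smul (lin f.hom) _ _
  · have e := act_mul_ρ V (fun x => (H.g x : H.A x)) w' 1
    rw [one_mul] at e
    rw [← e]
    rfl

/-- By `trace_coactHomR` and `trace_partialTrace_coactHomR`, on morphisms through `coactHomR` the
two sides are τ_z(b₁) ψ(S(b₂) v) and τ_x(b) ψ(g v). Regular V and arbitrary ψ recover the
symmetrised identity; conversely these morphisms generate all others. -/
theorem trace_partialTraceR_iff (ht : IsSCyclic t) :
    (∀ (P : H.Pmod) (V : H.Rep)
      (f : (tensorRightPmod V).obj P ⟶ (twistR α).obj ((tensorRightPmod V).obj P)),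
      t ((tensorRightPmod V).obj P) f = t P (rightPartialTraceHom α V P f)) ↔
    IsRightSymmetrised H (traceForms (φ := H.autR α) t) := by
  constructor
  · intro hp x z w w' h hw b
    rw [← sub_eq_zero, ← Module.forall_dual_apply_eq_zero_iff k]
    intro ψ
    -- In V = H_{w'} the vector v = 1 is acted on freely, so no information about S(b₂) is lost.
    let V := regular H.toHopfGCoalgebra w'
    let f : H.regularPmod z ⟶ (twistR α).obj ((tensorRightPmod V).obj (H.regularPmod x)) :=
      ObjectProperty.homMk (freeHom z (twist (H.autR α) (regular H.toHopfGCoalgebra x ⊗ V))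
        (b ⊗ₜ[k] (1 : H.A w') : H.A x ⊗[k] H.A w'))
    -- The tensor b ⊗ 1 has degree x w' = z, so 1_z fixes it and it is a legitimate value at 1.
    have hf : twistTensorValueR f = b ⊗ₜ[k] (1 : H.A w') := by
      change (twist (H.autR α) (tensor (regular H.toHopfGCoalgebra x) V)).act z 1
        (b ⊗ₜ[k] (1 : H.A w') : H.A x ⊗[k] H.A w') = _
      rw [twist_act, map_one]
      refine (tensor_regular_act (show x * w' = z by simp [← h, ← hw]) V 1 b (1 : H.A w')).trans ?_
      rw [map_one (H.cop _), Algebra.TensorProduct.one_def, map_tmul]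
      have := regular_act (H := H.toHopfGCoalgebra) w' 1 1
      rw [LinearMap.flip_apply, this]
      simp
    have e := hp (H.regularPmod x) V ((ObjectProperty.homMk (coactHomR x z V ψ) :
          (tensorRightPmod V).obj (H.regularPmod x) ⟶ H.regularPmod z) ≫ f)
    rw [trace_coactHomR ht, trace_partialTrace_coactHomR h hw, hf, apply_lin_coactHomR h hw,
      sliceR_tmul, map_smul, smul_eq_mul, LinearMap.comp_apply, regular_act, regular_act] at e
    rw [map_sub, map_smul, smul_eq_mul]
    rw [mul_one, mul_one, mul_comm] at e
    exact sub_eq_zero.2 e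
  · intro hτ P V f
    refine ht.eq_partialTrace (isRetractGenerating_regular (H := H)) (tensorRightPmod V)
      (rightPartialTraceHom α V) (rightPartialTraceHom_natural α V) ?_ P f
    intro x z i f
    obtain ⟨i, rfl⟩ : ∃ j, ObjectProperty.homMk j = i := ⟨i.hom, rfl⟩
    -- By duality and freeness of H_x, every morphism H_x ⊗ V → H_z comes from an element of H_z ⊗
    -- V*.
    obtain ⟨q, rfl⟩ := (tensorRightHomEquiv _ V (TwoSidedDuality.dual V) _).symm.surjective i
    obtain ⟨e, rfl⟩ : ∃ e : H.A z ⊗[k] Module.Dual k V.V,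
        freeHom x (tensor (regular H.toHopfGCoalgebra z) (dual V)) e = q := ⟨_, freeHom_one q⟩
    have key : ∀ (a : H.A z) (ψ : Module.Dual k V.V),
        t ((tensorRightPmod V).obj (H.regularPmod x))
          ((ObjectProperty.homMk (freeMateR x z V (a ⊗ₜ[k] ψ)) :
            (tensorRightPmod V).obj (H.regularPmod x) ⟶ H.regularPmod z) ≫ f) =
        t (H.regularPmod x) (rightPartialTraceHom α V (H.regularPmod x)
          ((ObjectProperty.homMk (freeMateR x z V (a ⊗ₜ[k] ψ)) :
            (tensorRightPmod V).obj (H.regularPmod x) ⟶ H.regularPmod z) ≫ f)) := by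
      intro a ψ
      have h : z * (z⁻¹ * x) = x := by simp
      rw [freeMateR_tmul h]
      have e1 := trace_coactHomR ht (V := V) ψ ((ObjectProperty.homMk
        (freeHom z (regular H.toHopfGCoalgebra z) a) : H.regularPmod z ⟶ H.regularPmod z) ≫ f)
      have e2 := trace_partialTrace_coactHomR (t := t) h rfl (V := V) ψ ((ObjectProperty.homMk
        (freeHom z (regular H.toHopfGCoalgebra z) a) : H.regularPmod z ⟶ H.regularPmod z) ≫ f)
      rw [hτ.apply_coactHomR h rfl] at e1
      exact e1.trans e2.symm
    change t _ ((ObjectProperty.homMk (freeMateR x z V e) :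
            (tensorRightPmod V).obj (H.regularPmod x) ⟶ H.regularPmod z) ≫ f) =
        t (H.regularPmod x) (rightPartialTraceHom α V (H.regularPmod x)
          ((ObjectProperty.homMk (freeMateR x z V e) :
            (tensorRightPmod V).obj (H.regularPmod x) ⟶ H.regularPmod z) ≫ f))
    induction e with
    | zero => simpa using key 0 0
    | add e e' he he' =>
      have h1 : (ObjectProperty.homMk (freeMateR x z V (e + e')) :
            (tensorRightPmod V).obj (H.regularPmod x) ⟶ H.regularPmod z) =
          ObjectProperty.homMk (freeMateR x z V e) + ObjectProperty.homMk (freeMateR x z V e') :=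
        ObjectProperty.hom_ext _ (freeMateR_add x z V e e')
      rw [h1, Preadditive.add_comp, map_add, map_add, map_add, he, he']
    | tmul a ψ => exact key a ψ

end

end PivotalHopfGCoalgebra

/-! ### The left partial trace and its condition in terms of linear forms. -/

namespace PivotalHopfGCoalgebra
open MonoidalCategory HopfGCoalgebra HopfGCoalgebra.Rep
variable {k : Type u} [Field k] {G : Type w} [Group G] {H : PivotalHopfGCoalgebra k G}

section PartialTrace
variable {V V' U U' W : Type*} [AddCommGroup V] [Module k V] [AddCommGroup V'] [Module k V']
  [AddCommGroup U] [Module k U] [AddCommGroup U'] [Module k U']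
  [AddCommGroup W] [Module k W] [FiniteDimensional k W]

/-- The partial trace over `W` of a linear map `W ⊗ V → W ⊗ V'`, twisted by an endomorphism of
`W`. -/
noncomputable def partialTraceL (γ : Module.End k W) (E : W ⊗[k] V →ₗ[k] W ⊗[k] V') : V →ₗ[k] V' :=
  ∑ i, sliceL (Module.Basis.ofVectorSpace k (Module.Dual k W) i) ∘ₗ E ∘ₗ
    TensorProduct.mk k W V (γ ((Module.evalEquiv k W).symm
      ((Module.Basis.ofVectorSpace k (Module.Dual k W)).coord i)))

theorem partialTraceL_apply (γ : Module.End k W) (E : W ⊗[k] V →ₗ[k] W ⊗[k] V') (v : V) :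
    partialTraceL γ E v = ∑ i, sliceL (Module.Basis.ofVectorSpace k (Module.Dual k W) i)
      (E (γ ((Module.evalEquiv k W).symm
        ((Module.Basis.ofVectorSpace k (Module.Dual k W)).coord i)) ⊗ₜ v)) := by
  simp [partialTraceL]

theorem partialTraceL_add (γ : Module.End k W) (E E' : W ⊗[k] V →ₗ[k] W ⊗[k] V') :
    partialTraceL γ (E + E') = partialTraceL γ E + partialTraceL γ E' := by
  ext v
  simp [partialTraceL_apply, Finset.sum_add_distrib]

theorem partialTraceL_comp (γ : Module.End k W) (E : W ⊗[k] V →ₗ[k] W ⊗[k] V') (f : U →ₗ[k] V)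
    (g : V' →ₗ[k] U') :
    partialTraceL γ (g.lTensor W ∘ₗ E ∘ₗ f.lTensor W) = g ∘ₗ partialTraceL γ E ∘ₗ f := by
  ext v
  simp [partialTraceL_apply, sliceL_lTensor]

/-- Here ω ∘ γ is expanded in the chosen basis of the dual space of W. -/
theorem partialTraceL_of_eq_smul (γ : Module.End k W) {E : W ⊗[k] V →ₗ[k] W ⊗[k] V'} {v : V}
    (ω : Module.Dual k W) (e : W ⊗[k] V') (h : ∀ w, E (w ⊗ₜ v) = ω w • e) :
    partialTraceL γ E v = sliceL (ω ∘ₗ γ) e := by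
  rw [partialTraceL_apply]
  simp only [h, map_smul]
  have e1 : ω ∘ₗ γ = ∑ i, ω (γ ((Module.evalEquiv k W).symm
      ((Module.Basis.ofVectorSpace k (Module.Dual k W)).coord i))) •
      Module.Basis.ofVectorSpace k (Module.Dual k W) i := by
    conv_lhs => rw [← (Module.Basis.ofVectorSpace k (Module.Dual k W)).sum_repr (ω ∘ₗ γ)]
    refine Finset.sum_congr rfl fun i _ => ?_
    congr 1
    exact (Module.apply_evalEquiv_symm_apply k W (ω ∘ₗ γ)
      ((Module.Basis.ofVectorSpace k (Module.Dual k W)).coord i)).symm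
  rw [e1, ← contractL_apply, map_sum]
  simp only [map_smul, contractL_apply]

end PartialTrace

/-- The morphism coev' is the coevaluation of V*, brought back along V ≅ V**. This explains both the
basis of the dual space and the inverse pivot; the loop is closed by the plain evaluation. -/
theorem lin_leftPartialTrace (α : H.A 1 →ₐ[k] k) (P : H.Pmod) (V : H.Rep)
    (f : MonoidalLeftAction.actionObj V P ⟶ (twistL α).obj (MonoidalLeftAction.actionObj V P)) :
    lin (leftPartialTrace (twistL α) f).hom =
      partialTraceL (V := P.obj.V) (V' := P.obj.V) (W := V.V)
        (V.ρ fun x => ((H.g x)⁻¹ : (H.A x)ˣ)) (lin f.hom) := by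
  refine LinearMap.ext fun p => ?_
  obtain ⟨F, hF⟩ : ∃ F : Module.End k (V.V ⊗[k] P.obj.V), F = lin f.hom := ⟨_, rfl⟩
  have h0 : lin (leftPartialTrace (twistL α) f).hom p =
    TensorProduct.lid k P.obj.V ((contractLeft k V.V).rTensor P.obj.V
      ((TensorProduct.assoc k (Module.Dual k V.V) V.V P.obj.V).symm
        (F.lTensor (Module.Dual k V.V)
          (TensorProduct.assoc k (Module.Dual k V.V) V.V P.obj.V
            ((((V.ρ fun x => ((H.g x)⁻¹ : (H.A x)ˣ)) ∘ₗ
              (Module.evalEquiv k V.V).symm.toLinearMap).lTensor (Module.Dual k V.V)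
              (coevaluation k (Module.Dual k V.V) 1)) ⊗ₜ[k] p))))) := by
    rw [hF]; rfl
  have key : ∀ (φ : Module.Dual k V.V) (t : V.V ⊗[k] P.obj.V),
      TensorProduct.lid k P.obj.V ((contractLeft k V.V).rTensor P.obj.V
        ((TensorProduct.assoc k (Module.Dual k V.V) V.V P.obj.V).symm (φ ⊗ₜ t))) =
      sliceL φ t := by
    intro φ t
    induction t with
    | zero => simp
    | add s t hs ht => simp only [tmul_add, map_add, hs, ht]
    | tmul b b' => simp
  rw [h0, ← hF, coevaluation_apply_one]
  simp only [map_sum, sum_tmul, assoc_tmul, LinearMap.lTensor_tmul]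
  refine Eq.trans ?_ (partialTraceL_apply (V' := P.obj.V) _ _ p).symm
  exact Finset.sum_congr rfl fun i _ => key _ _

/-- The functor `P ↦ V ⊗ P` on projective modules. -/
noncomputable def tensorLeftPmod (V : H.Rep) : H.Pmod ⥤ H.Pmod where
  obj P := MonoidalLeftAction.actionObj V P
  map f := ObjectProperty.homMk (V ◁ f.hom)
  map_id P := ObjectProperty.hom_ext _ (whiskerLeft_id V P.obj)
  map_comp f g := ObjectProperty.hom_ext _ (whiskerLeft_comp V f.hom g.hom)

instance (V : H.Rep) : (tensorLeftPmod V).Additive where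
  map_add {_ _ f g} := ObjectProperty.hom_ext _ (hom_ext
    (LinearMap.lTensor_add V.V (lin f.hom) (lin g.hom)))

/-- The left partial trace as an additive map. -/
noncomputable def leftPartialTraceHom (α : H.A 1 →ₐ[k] k) (V : H.Rep) (P : H.Pmod) :
    ((tensorLeftPmod V).obj P ⟶ (twistL α).obj ((tensorLeftPmod V).obj P)) →+
      (P ⟶ (twistL α).obj P) :=
  AddMonoidHom.mk' (fun f => leftPartialTrace (twistL α) f) fun f g => by
    refine ObjectProperty.hom_ext _ (hom_ext ?_)
    refine (lin_leftPartialTrace α P V (f + g)).trans ?_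
    refine (partialTraceL_add _ _ _).trans ?_
    exact (congrArg₂ (· + ·) (lin_leftPartialTrace α P V f) (lin_leftPartialTrace α P V g)).symm

theorem leftPartialTraceHom_natural (α : H.A 1 →ₐ[k] k) (V : H.Rep) {P Q : H.Pmod} (u : Q ⟶ P)
    (f : (tensorLeftPmod V).obj P ⟶ (twistL α).obj ((tensorLeftPmod V).obj P)) (v : P ⟶ Q) :
    leftPartialTraceHom α V Q ((tensorLeftPmod V).map u ≫ f ≫
      (twistL α).map ((tensorLeftPmod V).map v)) =
      u ≫ leftPartialTraceHom α V P f ≫ (twistL α).map v := by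
  refine ObjectProperty.hom_ext _ (hom_ext ?_)
  refine (lin_leftPartialTrace α Q V _).trans ?_
  refine (partialTraceL_comp _ (lin f.hom) (lin u.hom) (lin v.hom)).trans ?_
  exact congrArg (fun E => lin v.hom ∘ₗ E ∘ₗ lin u.hom) (lin_leftPartialTrace α P V f).symm

/-- In contrast with the right case, this adjunction is closed by ev', which puts the pivot into the
formula. -/
theorem lin_tensorLeftHomEquiv_symm {X V Z : H.Rep} (q : X ⟶ TwoSidedDuality.dual V ⊗ Z) (b : X.V)
    (v : V.V) :
    lin ((tensorLeftHomEquiv X (TwoSidedDuality.dual V) V Z).symm q) (v ⊗ₜ[k] b : V.V ⊗[k] X.V) =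
      sliceL (A := Module.Dual k V.V) (B := Z.V)
        (Module.Dual.eval k V.V (V.ρ (fun x => (H.g x : H.A x)) v)) (lin q b) := by
  have h0 : lin ((tensorLeftHomEquiv X (TwoSidedDuality.dual V) V Z).symm q)
      (v ⊗ₜ[k] b : V.V ⊗[k] X.V) =
    TensorProduct.lid k Z.V ((lin (ε_ (TwoSidedDuality.dual V) V)).rTensor Z.V
      ((TensorProduct.assoc k V.V (Module.Dual k V.V) Z.V).symm (v ⊗ₜ[k] lin q b))) := rfl
  rw [h0]
  have key : ∀ t : Module.Dual k V.V ⊗[k] Z.V,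
    TensorProduct.lid k Z.V ((lin (ε_ (TwoSidedDuality.dual V) V)).rTensor Z.V
      ((TensorProduct.assoc k V.V (Module.Dual k V.V) Z.V).symm (v ⊗ₜ[k] t))) =
    sliceL (Module.Dual.eval k V.V (V.ρ (fun x => (H.g x : H.A x)) v)) t := by
    intro t
    induction t with
    | zero => simp
    | add s t hs ht => simp only [tmul_add, map_add, hs, ht]
    | tmul b b' =>
      simp only [assoc_symm_tmul, LinearMap.rTensor_tmul, sliceL_tmul]
      rw [tev_tmul]
      exact lid_tmul _ _
  exact key _

/-- Families with `S(b₁) τ_z(b₂) = τ_{wz}(b) g_{w⁻¹}⁻¹`. -/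
def IsLeftSymmetrised (H : PivotalHopfGCoalgebra k G) (τ : ∀ x, Module.Dual k (H.A x)) : Prop :=
  ∀ ⦃x z w w' : G⦄ (h : w * z = x) (hw : w⁻¹ = w') (b : H.A x),
    H.anti hw (sliceR (τ z) (H.cop h b)) = τ x b • (((H.g w')⁻¹ : (H.A w')ˣ) : H.A w')

variable [∀ x, FiniteDimensional k (H.A x)]

/-- The morphism `V ⊗ H_x ⟶ H_z` corresponding to an element of `V* ⊗ H_z`. -/
noncomputable def freeMateL (x z : G) (V : H.Rep) (e : Module.Dual k V.V ⊗[k] H.A z) :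
    V ⊗ regular H.toHopfGCoalgebra x ⟶ regular H.toHopfGCoalgebra z :=
  (tensorLeftHomEquiv _ (TwoSidedDuality.dual V) V _).symm
    (freeHom x (tensor (dual V) (regular H.toHopfGCoalgebra z)) e)

theorem lin_freeMateL (x z : G) (V : H.Rep) (e : Module.Dual k V.V ⊗[k] H.A z) (b : H.A x)
    (v : V.V) : lin (freeMateL x z V e) (v ⊗ₜ[k] b : V.V ⊗[k] H.A x) =
      sliceL (A := Module.Dual k V.V) (B := H.A z)
        (Module.Dual.eval k V.V (V.ρ (fun x => (H.g x : H.A x)) v))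
        ((tensor (dual V) (regular H.toHopfGCoalgebra z)).act x b e) :=
  lin_tensorLeftHomEquiv_symm (X := regular H.toHopfGCoalgebra x) _ b v

/-- The morphism `V ⊗ H_x ⟶ H_z`, `v ⊗ b ↦ ψ(S(b₁) g v) b₂`. -/
noncomputable def coactHomL (x z : G) (V : H.Rep) (ψ : Module.Dual k V.V) :
    V ⊗ regular H.toHopfGCoalgebra x ⟶ regular H.toHopfGCoalgebra z :=
  freeMateL x z V (ψ ⊗ₜ 1)

theorem freeMateL_add (x z : G) (V : H.Rep) (e e' : Module.Dual k V.V ⊗[k] H.A z) :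
    freeMateL x z V (e + e') = freeMateL x z V e + freeMateL x z V e' := by
  refine hom_ext (TensorProduct.ext' fun v b => ?_)
  refine (lin_freeMateL x z V _ b v).trans ?_
  rw [map_add, map_add]
  exact (congrArg₂ (· + ·) (lin_freeMateL x z V e b v) (lin_freeMateL x z V e' b v)).symm

theorem freeMateL_tmul {x z w : G} (h : w * z = x) (V : H.Rep) (a : H.A z)
    (ψ : Module.Dual k V.V) :
    freeMateL x z V (ψ ⊗ₜ a) = coactHomL x z V ψ ≫ freeHom z (regular H.toHopfGCoalgebra z) a := by
  refine hom_ext (TensorProduct.ext' fun v b => ?_)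
  refine (lin_freeMateL x z V _ b v).trans ?_
  have e1 := lin_freeMateL x z V (ψ ⊗ₜ[k] 1) b v
  have e2 := regular_act (H := H.toHopfGCoalgebra) z
    (lin (freeMateL x z V (ψ ⊗ₜ[k] 1)) (v ⊗ₜ[k] b : V.V ⊗[k] H.A x)) a
  refine Eq.trans ?_ e2.symm
  refine Eq.trans ?_ (congrArg (· * a) e1.symm)
  have h1 := tensor_act_regular h (dual V) b a ψ
  have h2 := tensor_act_regular h (dual V) b 1 ψ
  refine (congrArg _ h1).trans (Eq.trans ?_ (congrArg (fun y => sliceL (A := Module.Dual k V.V)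
    (B := H.A z) (Module.Dual.eval k V.V (V.ρ (fun x => (H.g x : H.A x)) v)) y * a) h2.symm))
  generalize H.cop h b = s
  induction s with
  | zero => simp
  | add s t hs ht => simp only [map_add, add_mul, hs, ht]
  | tmul c d => simp

theorem lin_coactHomL {x z w w' : G} (h : w * z = x) (hw : w⁻¹ = w') (V : H.Rep)
    (ψ : Module.Dual k V.V) (b : H.A x) (v : V.V) :
    lin (coactHomL x z V ψ) (v ⊗ₜ[k] b : V.V ⊗[k] H.A x) =
      sliceL (ψ ∘ₗ (V.act w').flip (V.ρ (fun x => (H.g x : H.A x)) v) ∘ₗ H.anti hw)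
        (H.cop h b) := by
  refine (lin_freeMateL x z V _ b v).trans ?_
  have e := tensor_act_regular h (dual V) b (1 : H.A z) ψ
  refine (congrArg (sliceL (A := Module.Dual k V.V) (B := H.A z)
    (Module.Dual.eval k V.V (V.ρ (fun x => (H.g x : H.A x)) v))) e).trans ?_
  generalize H.cop h b = t
  induction t with
  | zero => simp
  | add s t hs ht => simp only [map_add, hs, ht]
  | tmul a a' =>
    simp only [map_tmul, sliceL_tmul, LinearMap.mulRight_apply, mul_one, LinearMap.comp_apply,
      LinearMap.flip_apply]
    congr 1
    exact dual_act V hw a ψ _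

theorem apply_lin_coactHomL {τ : ∀ x, Module.Dual k (H.A x)} {x z w w' : G} (h : w * z = x)
    (hw : w⁻¹ = w') (V : H.Rep) (ψ : Module.Dual k V.V) (b : H.A x) (v : V.V) :
    τ z (lin (coactHomL x z V ψ) (v ⊗ₜ[k] b : V.V ⊗[k] H.A x)) =
      ψ (V.act w' (H.anti hw (sliceR (τ z) (H.cop h b))) (V.ρ (fun x => (H.g x : H.A x)) v)) := by
  rw [lin_coactHomL h hw, apply_sliceL]
  rfl

theorem lin_coactHomL_one {x z w w' : G} (h : w * z = x) (hw : w⁻¹ = w') (V : H.Rep)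
    (ψ : Module.Dual k V.V) (v : V.V) :
    lin (coactHomL x z V ψ) (v ⊗ₜ[k] (1 : H.A x) : V.V ⊗[k] H.A x) =
      (ψ ∘ₗ V.act w' 1 ∘ₗ V.ρ fun x => (H.g x : H.A x)) v • (1 : H.A z) := by
  refine (lin_coactHomL h hw V ψ 1 v).trans ?_
  rw [map_one, Algebra.TensorProduct.one_def, sliceL_tmul]
  simp [anti_one]

/-- The pivot carried by `coactHomL` cancels the inverse pivot of the hypothesis, leaving only the
projection 1_{w'}. -/
theorem IsLeftSymmetrised.apply_coactHomL {τ : ∀ x, Module.Dual k (H.A x)}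
    (hτ : IsLeftSymmetrised H τ) {x z w w' : G} (h : w * z = x) (hw : w⁻¹ = w') (V : H.Rep)
    (ψ : Module.Dual k V.V) (e : V.V ⊗[k] H.A x) :
    τ z (lin (coactHomL x z V ψ) e) = τ x (sliceL (ψ ∘ₗ V.act w' 1) e) := by
  induction e with
  | zero => exact (congrArg (τ z) (map_zero _)).trans (by simp)
  | add e e' he he' =>
    refine (congrArg (τ z) (map_add _ e e')).trans ?_
    exact (map_add _ _ _).trans ((congrArg₂ (· + ·) he he').trans (by simp))
  | tmul v b =>
    rw [apply_lin_coactHomL h hw, hτ h hw]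
    have e := LinearMap.congr_fun (act_mul_ρ V (fun x => (H.g x : H.A x)) w'
      (((H.g w')⁻¹ : (H.A w')ˣ) : H.A w')) v
    rw [Units.inv_mul, Module.End.mul_apply] at e
    rw [map_smul, LinearMap.smul_apply, e]
    simp [mul_comm]

section
variable {α : H.A 1 →ₐ[k] k} {t : TraceFamily k (twistL (H := H) α)}

/-- The value at `1` of a morphism `H_z ⟶ L(α)_* (V ⊗ H_x)`. -/
noncomputable def twistTensorValueL {x z : G} {V : H.Rep}
    (f : H.regularPmod z ⟶ (twistL α).obj ((tensorLeftPmod V).obj (H.regularPmod x))) :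
    V.V ⊗[k] H.A x :=
  lin f.hom (1 : H.A z)

theorem trace_coactHomL (ht : IsSCyclic t) {x z : G} {V : H.Rep} (ψ : Module.Dual k V.V)
    (f : H.regularPmod z ⟶ (twistL α).obj ((tensorLeftPmod V).obj (H.regularPmod x))) :
    t ((tensorLeftPmod V).obj (H.regularPmod x))
        ((ObjectProperty.homMk (coactHomL x z V ψ) :
          (tensorLeftPmod V).obj (H.regularPmod x) ⟶ H.regularPmod z) ≫ f) =
      traceForms (φ := H.autL α) t z (lin (coactHomL x z V ψ) (twistTensorValueL f)) := by
  rw [ht]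
  exact apply_eq_traceForms (φ := H.autL α) t _

/-- As on the right; the pivot of `coactHomL` now cancels the inverse pivot that coev' inserts in
the partial trace. -/
theorem trace_partialTrace_coactHomL {x z w w' : G} (h : w * z = x)
    (hw : w⁻¹ = w') {V : H.Rep} (ψ : Module.Dual k V.V)
    (f : H.regularPmod z ⟶ (twistL α).obj ((tensorLeftPmod V).obj (H.regularPmod x))) :
    t (H.regularPmod x) (leftPartialTraceHom α V (H.regularPmod x)
        ((ObjectProperty.homMk (coactHomL x z V ψ) :
          (tensorLeftPmod V).obj (H.regularPmod x) ⟶ H.regularPmod z) ≫ f)) =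
      traceForms (φ := H.autL α) t x (sliceL (ψ ∘ₗ V.act w' 1) (twistTensorValueL f)) := by
  refine (apply_eq_traceForms (φ := H.autL α) t _).trans (congrArg _ ?_)
  refine (LinearMap.congr_fun (lin_leftPartialTrace α (H.regularPmod x) V _) (1 : H.A x)).trans ?_
  refine (partialTraceL_of_eq_smul (V := H.A x) (V' := H.A x) _
    (ψ ∘ₗ V.act w' 1 ∘ₗ V.ρ fun x => (H.g x : H.A x)) (twistTensorValueL f) fun v => ?_).trans ?_
  · refine (congrArg (lin f.hom) (lin_coactHomL_one h hw V ψ v)).trans ?_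
    exact map_smul (lin f.hom) _ _
  · have e : (V.ρ fun x => (H.g x : H.A x)) * (V.ρ fun x => ((H.g x)⁻¹ : (H.A x)ˣ)) = 1 := by
      rw [← map_mul, ← map_one V.ρ]
      congr 1
      ext x
      exact Units.mul_inv _
    have e' : (ψ ∘ₗ V.act w' 1 ∘ₗ V.ρ fun x => (H.g x : H.A x)) ∘ₗ
        (V.ρ fun x => ((H.g x)⁻¹ : (H.A x)ˣ)) = ψ ∘ₗ V.act w' 1 := by
      rw [LinearMap.comp_assoc, LinearMap.comp_assoc, ← Module.End.mul_eq_comp (V.ρ _), e]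
      rfl
    rw [e']

theorem trace_partialTraceL_iff (ht : IsSCyclic t) :
    (∀ (P : H.Pmod) (V : H.Rep)
      (f : (tensorLeftPmod V).obj P ⟶ (twistL α).obj ((tensorLeftPmod V).obj P)),
      t ((tensorLeftPmod V).obj P) f = t P (leftPartialTraceHom α V P f)) ↔
    IsLeftSymmetrised H (traceForms (φ := H.autL α) t) := by
  constructor
  · intro hp x z w w' h hw b
    -- The morphisms used for testing contain g, so what they yield is the identity multiplied by
    -- g_{w'} on the right.
    have key : H.anti hw (sliceR (traceForms (φ := H.autL α) t z) (H.cop h b)) * H.g w' =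
        traceForms (φ := H.autL α) t x b • 1 := by
      rw [← sub_eq_zero, ← Module.forall_dual_apply_eq_zero_iff k]
      intro ψ
      let V := regular H.toHopfGCoalgebra w'
      let f : H.regularPmod z ⟶ (twistL α).obj ((tensorLeftPmod V).obj (H.regularPmod x)) :=
        ObjectProperty.homMk (freeHom z (twist (H.autL α) (V ⊗ regular H.toHopfGCoalgebra x))
          ((1 : H.A w') ⊗ₜ[k] b : H.A w' ⊗[k] H.A x))
      have hf : twistTensorValueL f = (1 : H.A w') ⊗ₜ[k] b := by
        change (twist (H.autL α) (tensor V (regular H.toHopfGCoalgebra x))).act z 1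
          ((1 : H.A w') ⊗ₜ[k] b : H.A w' ⊗[k] H.A x) = _
        rw [twist_act, map_one]
        refine (tensor_act_regular (show w' * x = z by simp [← h, ← hw]) V 1 b (1 : H.A w')).trans ?_
        rw [map_one (H.cop _), Algebra.TensorProduct.one_def, map_tmul]
        have := regular_act (H := H.toHopfGCoalgebra) w' 1 1
        rw [LinearMap.flip_apply, this]
        simp
      have e := hp (H.regularPmod x) V ((ObjectProperty.homMk (coactHomL x z V ψ) :
            (tensorLeftPmod V).obj (H.regularPmod x) ⟶ H.regularPmod z) ≫ f)
      have e1 : V.ρ (fun x => (H.g x : H.A x)) (1 : H.A w') = (H.g w' : H.A w') := mul_one _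
      rw [trace_coactHomL ht, trace_partialTrace_coactHomL h hw, hf, apply_lin_coactHomL h hw,
        sliceL_tmul, map_smul, smul_eq_mul, LinearMap.comp_apply, e1, regular_act, regular_act] at e
      rw [map_sub, map_smul, smul_eq_mul]
      rw [mul_one, mul_comm (ψ _)] at e
      exact sub_eq_zero.2 e
    rw [← Units.mul_left_inj (H.g w'), key, smul_mul_assoc, Units.inv_mul]
  · intro hτ P V f
    refine ht.eq_partialTrace (isRetractGenerating_regular (H := H)) (tensorLeftPmod V)
      (leftPartialTraceHom α V) (leftPartialTraceHom_natural α V) ?_ P f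
    intro x z i f
    obtain ⟨i, rfl⟩ : ∃ j, ObjectProperty.homMk j = i := ⟨i.hom, rfl⟩
    obtain ⟨q, rfl⟩ := (tensorLeftHomEquiv _ (TwoSidedDuality.dual V) V _).symm.surjective i
    obtain ⟨e, rfl⟩ : ∃ e : Module.Dual k V.V ⊗[k] H.A z,
        freeHom x (tensor (dual V) (regular H.toHopfGCoalgebra z)) e = q := ⟨_, freeHom_one q⟩
    have key : ∀ (a : H.A z) (ψ : Module.Dual k V.V),
        t ((tensorLeftPmod V).obj (H.regularPmod x))
          ((ObjectProperty.homMk (freeMateL x z V (ψ ⊗ₜ[k] a)) :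
            (tensorLeftPmod V).obj (H.regularPmod x) ⟶ H.regularPmod z) ≫ f) =
        t (H.regularPmod x) (leftPartialTraceHom α V (H.regularPmod x)
          ((ObjectProperty.homMk (freeMateL x z V (ψ ⊗ₜ[k] a)) :
            (tensorLeftPmod V).obj (H.regularPmod x) ⟶ H.regularPmod z) ≫ f)) := by
      intro a ψ
      have h : x * z⁻¹ * z = x := by simp
      rw [freeMateL_tmul h]
      have e1 := trace_coactHomL ht (V := V) ψ ((ObjectProperty.homMk
        (freeHom z (regular H.toHopfGCoalgebra z) a) : H.regularPmod z ⟶ H.regularPmod z) ≫ f)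
      have e2 := trace_partialTrace_coactHomL (t := t) h rfl (V := V) ψ ((ObjectProperty.homMk
        (freeHom z (regular H.toHopfGCoalgebra z) a) : H.regularPmod z ⟶ H.regularPmod z) ≫ f)
      rw [hτ.apply_coactHomL h rfl] at e1
      exact e1.trans e2.symm
    change t _ ((ObjectProperty.homMk (freeMateL x z V e) :
            (tensorLeftPmod V).obj (H.regularPmod x) ⟶ H.regularPmod z) ≫ f) =
        t (H.regularPmod x) (leftPartialTraceHom α V (H.regularPmod x)
          ((ObjectProperty.homMk (freeMateL x z V e) :
            (tensorLeftPmod V).obj (H.regularPmod x) ⟶ H.regularPmod z) ≫ f))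
    induction e with
    | zero => simpa using key 0 0
    | add e e' he he' =>
      have h1 : (ObjectProperty.homMk (freeMateL x z V (e + e')) :
            (tensorLeftPmod V).obj (H.regularPmod x) ⟶ H.regularPmod z) =
          ObjectProperty.homMk (freeMateL x z V e) + ObjectProperty.homMk (freeMateL x z V e') :=
        ObjectProperty.hom_ext _ (freeMateL_add x z V e e')
      rw [h1, Preadditive.add_comp, map_add, map_add, map_add, he, he']
    | tmul ψ a => exact key a ψ

end

end PivotalHopfGCoalgebra

/-! ### Symmetrised families are symmetrised integrals. -/

namespace PivotalHopfGCoalgebra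
open HopfGCoalgebra HopfGCoalgebra.Rep
variable {k : Type u} [Field k] {G : Type w} [Group G] {H : PivotalHopfGCoalgebra k G}

variable (H) in
theorem anti_g_inv {x y : G} (h : x⁻¹ = y) :
    H.anti h (((H.g x)⁻¹ : (H.A x)ˣ) : H.A x) = H.g y := by
  rw [← Units.mul_left_inj (H.g y)⁻¹, ← H.anti_g h, ← H.anti_mul, Units.mul_inv, anti_one,
    H.anti_g h, Units.mul_inv]

variable (H) in
theorem cop_g_inv {x y z : G} (h : x * y = z) :
    H.cop h (((H.g z)⁻¹ : (H.A z)ˣ) : H.A z) =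
      (((H.g x)⁻¹ : (H.A x)ˣ) : H.A x) ⊗ₜ[k] (((H.g y)⁻¹ : (H.A y)ˣ) : H.A y) := by
  have h1 : H.cop h (((H.g z)⁻¹ : (H.A z)ˣ) : H.A z) *
      ((H.g x : H.A x) ⊗ₜ[k] (H.g y : H.A y)) = 1 := by
    rw [← H.cop_g h, ← map_mul, Units.inv_mul, map_one]
  have h2 : ((H.g x : H.A x) ⊗ₜ[k] (H.g y : H.A y)) *
      ((((H.g x)⁻¹ : (H.A x)ˣ) : H.A x) ⊗ₜ[k] (((H.g y)⁻¹ : (H.A y)ˣ) : H.A y)) = 1 := by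
    simp [Algebra.TensorProduct.one_def]
  exact left_inv_eq_right_inv h1 h2

/-- The antipode is injective and takes g_w⁻¹ to g_{w⁻¹}, so it can be removed. -/
theorem isRightSymmetrised_iff {τ : ∀ x, Module.Dual k (H.A x)} :
    IsRightSymmetrised H τ ↔ ∀ ⦃x z w : G⦄ (h : z * w = x) (b : H.A x),
      sliceL (τ z) (H.cop h b) = τ x b • (((H.g w)⁻¹ : (H.A w)ˣ) : H.A w) := by
  constructor
  · intro hτ x z w h b
    apply H.anti_injective rfl
    rw [hτ h rfl, map_smul, H.anti_g_inv]
  · rintro hτ x z w _ h rfl b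
    rw [hτ h, map_smul, H.anti_g_inv]

/-- The antipode is injective and takes g_w to g_{w⁻¹}⁻¹, so it can be removed. -/
theorem isLeftSymmetrised_iff {τ : ∀ x, Module.Dual k (H.A x)} :
    IsLeftSymmetrised H τ ↔ ∀ ⦃x z w : G⦄ (h : w * z = x) (b : H.A x),
      sliceR (τ z) (H.cop h b) = τ x b • (H.g w : H.A w) := by
  constructor
  · intro hτ x z w h b
    apply H.anti_injective rfl
    rw [hτ h rfl, map_smul, H.anti_g]
  · rintro hτ x z w _ h rfl b
    rw [hτ h, map_smul, H.anti_g]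

/-- Since Δ(g) = g ⊗ g, one factor is absorbed in the form and the other comes out on the left. -/
theorem sliceL_cop_g_mul (μ : ∀ x, Module.Dual k (H.A x)) {x z w : G} (h : z * w = x)
    (b : H.A x) : sliceL (μ z) (H.cop h (H.g x * b)) =
      H.g w * sliceL (μ z ∘ₗ LinearMap.mulLeft k (H.g z : H.A z)) (H.cop h b) := by
  have e : (H.g z : H.A z) ⊗ₜ[k] (H.g w : H.A w) = (1 ⊗ₜ (H.g w : H.A w)) * ((H.g z : H.A z) ⊗ₜ 1) := by
    simp
  rw [map_mul, H.cop_g, e, mul_assoc, sliceL_one_tmul_mul, sliceL_tmul_one_mul]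

theorem sliceR_cop_g_inv_mul (μ : ∀ x, Module.Dual k (H.A x)) {x z w : G} (h : w * z = x)
    (b : H.A x) : sliceR (μ z) (H.cop h ((((H.g x)⁻¹ : (H.A x)ˣ) : H.A x) * b)) =
      (((H.g w)⁻¹ : (H.A w)ˣ) : H.A w) *
        sliceR (μ z ∘ₗ LinearMap.mulLeft k (((H.g z)⁻¹ : (H.A z)ˣ) : H.A z)) (H.cop h b) := by
  have e : (((H.g w)⁻¹ : (H.A w)ˣ) : H.A w) ⊗ₜ[k] (((H.g z)⁻¹ : (H.A z)ˣ) : H.A z) =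
      ((((H.g w)⁻¹ : (H.A w)ˣ) : H.A w) ⊗ₜ 1) * (1 ⊗ₜ (((H.g z)⁻¹ : (H.A z)ˣ) : H.A z)) := by
    simp
  rw [map_mul, H.cop_g_inv, e, mul_assoc, sliceR_tmul_one_mul, sliceR_one_tmul_mul]

/-- With τ = μ(g ·), the identity μ(g b₁) g b₂ = μ((g b)₁)(g b)₂ shows that the equation for τ at b,
multiplied by g_w, is the integral equation for μ at g b. -/
theorem isRightSymmetrised_iff_mem {τ : ∀ x, Module.Dual k (H.A x)} :
    IsRightSymmetrised H τ ↔ τ ∈ H.symmRightIntegrals := by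
  rw [isRightSymmetrised_iff]
  constructor
  · intro hτ
    refine ⟨H.shift (fun x => (((H.g x)⁻¹ : (H.A x)ˣ) : H.A x)) τ, fun x y a => ?_, ?_⟩
    · have e := sliceL_cop_g_mul (H.shift (fun x => (((H.g x)⁻¹ : (H.A x)ˣ) : H.A x)) τ)
        (rfl : x * y = x * y) ((((H.g (x * y))⁻¹ : (H.A (x * y))ˣ) : H.A (x * y)) * a)
      have e1 : H.shift (fun x => (((H.g x)⁻¹ : (H.A x)ˣ) : H.A x)) τ x ∘ₗ
          LinearMap.mulLeft k (H.g x : H.A x) = τ x := by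
        ext b
        simp [shift]
      rw [e1, hτ, Units.mul_inv_cancel_left, mul_smul_comm, Units.mul_inv] at e
      exact e
    · funext x
      ext b
      simp [shift]
  · rintro ⟨μ, hμ, rfl⟩ x z w h b
    have e := sliceL_cop_g_mul μ h b
    rw [sliceL_cop_of_mem hμ] at e
    rw [← Units.mul_right_inj (H.g w), mul_smul_comm, Units.mul_inv]
    exact e.symm

/-- The same comparison with τ = μ(g⁻¹ ·) and the group-like family g⁻¹. -/
theorem isLeftSymmetrised_iff_mem {τ : ∀ x, Module.Dual k (H.A x)} :
    IsLeftSymmetrised H τ ↔ τ ∈ H.symmLeftIntegrals := by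
  rw [isLeftSymmetrised_iff]
  constructor
  · intro hτ
    refine ⟨H.shift (fun x => (H.g x : H.A x)) τ, fun x y a => ?_, ?_⟩
    · have e := sliceR_cop_g_inv_mul (H.shift (fun x => (H.g x : H.A x)) τ)
        (rfl : x * y = x * y) ((H.g (x * y) : H.A (x * y)) * a)
      have e1 : H.shift (fun x => (H.g x : H.A x)) τ y ∘ₗ
          LinearMap.mulLeft k (((H.g y)⁻¹ : (H.A y)ˣ) : H.A y) = τ y := by
        ext b
        simp [shift]
      rw [e1, hτ, Units.inv_mul_cancel_left, mul_smul_comm, Units.inv_mul] at e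
      exact e
    · funext x
      ext b
      simp [shift]
  · rintro ⟨μ, hμ, rfl⟩ x z w h b
    have e := sliceR_cop_g_inv_mul μ h b
    rw [sliceR_cop_of_mem hμ] at e
    rw [← Units.mul_right_inj (H.g w)⁻¹, mul_smul_comm, Units.inv_mul]
    exact e.symm

theorem shift_injective (v : ∀ x, (H.A x)ˣ) :
    Function.Injective (H.shift fun x => (v x : H.A x)) := by
  intro μ ν h
  funext x
  ext a
  have := LinearMap.congr_fun (congrFun h x) (((v x)⁻¹ : (H.A x)ˣ) * a)
  simpa [shift] using this

/-! ### Module traces and symmetrised integrals. -/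

variable [∀ x, FiniteDimensional k (H.A x)] {c : H.A 1} {α : H.A 1 →ₐ[k] k}

theorem finrank_symmRightIntegrals (hc : H.IsLeftCointegral c) (hc0 : c ≠ 0) :
    Module.finrank k H.symmRightIntegrals = 1 := by
  rw [← finrank_rightIntegrals hc hc0]
  exact (Submodule.equivMapOfInjective _ (shift_injective H.g) _).finrank_eq.symm

theorem finrank_symmLeftIntegrals (hc : H.IsLeftCointegral c) (hc0 : c ≠ 0) :
    Module.finrank k H.symmLeftIntegrals = 1 := by
  rw [← finrank_leftIntegrals hc hc0]
  exact (Submodule.equivMapOfInjective _ (shift_injective fun x => (H.g x)⁻¹) _).finrank_eq.symm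

/-- Uniqueness of integrals reduces twisted symmetry and non-degeneracy to the family dual to c. -/
theorem exists_eq_of_mem_symmRightIntegrals (hc : H.IsLeftCointegral c) (hc0 : c ≠ 0)
    {τ : ∀ x, Module.Dual k (H.A x)} (hτ : τ ∈ H.symmRightIntegrals) :
    ∃ (r : k) (μ : ∀ x, Module.Dual k (H.A x)), IsRightDualOf μ c ∧
      ∀ x a, τ x a = r * μ x (H.g x * a) := by
  obtain ⟨ν, hν, rfl⟩ := hτ
  obtain ⟨μ, hμ⟩ := exists_isRightDualOf hc hc0
  refine ⟨H.ε (sliceL (ν 1) (H.cop (one_mul 1) c)), μ, hμ, fun x a => ?_⟩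
  conv_lhs => rw [← eq_smul_of_mem_rightIntegrals hc hc0 hμ hν]
  rfl

theorem exists_eq_of_mem_symmLeftIntegrals (hc : H.IsLeftCointegral c) (hc0 : c ≠ 0)
    {τ : ∀ x, Module.Dual k (H.A x)} (hτ : τ ∈ H.symmLeftIntegrals) :
    ∃ (r : k) (μ : ∀ x, Module.Dual k (H.A x)), IsLeftDualOf μ c ∧
      ∀ x a, τ x a = r * μ x ((((H.g x)⁻¹ : (H.A x)ˣ) : H.A x) * a) := by
  obtain ⟨ν, hν, rfl⟩ := hτ
  obtain ⟨μ, hμ⟩ := exists_isLeftDualOf hc hc0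
  refine ⟨H.ε (sliceR (ν 1) (H.cop (one_mul 1) c)), μ, hμ, fun x a => ?_⟩
  conv_lhs => rw [← eq_smul_of_mem_leftIntegrals hc hc0 hμ hν]
  rfl

/-- Cyclic traces whose linear forms range over a space of twisted symmetric families. -/
theorem traces_of_forms {φ : ∀ x, H.A x ≃ₐ[k] H.A x} (M : Submodule k (TraceFamily k (twistPmod φ)))
    (I : Submodule k (∀ x, Module.Dual k (H.A x)))
    (hM : ∀ t, t ∈ M ↔ IsSCyclic t ∧ traceForms t ∈ I)
    (hI : ∀ τ ∈ I, IsTwistedSymmetric φ τ) (hrank : Module.finrank k I = 1)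
    (hnd : ∀ τ ∈ I, τ ≠ 0 → ∀ x (b : H.A x), (∀ a, τ x (a * b) = 0) → b = 0) :
    (∃ Φ : M ≃ₗ[k] I, ∀ (t : M) (x : G)
        (f : H.regularPmod x ⟶ (twistPmod φ).obj (H.regularPmod x)),
        t.1 (H.regularPmod x) f = (Φ t).1 x (twistValue f)) ∧
      Module.finrank k M = 1 ∧ ∀ t ∈ M, t ≠ 0 → TraceNondegenerate t := by
  let F : M →ₗ[k] I := (traceForms.domRestrict M).codRestrict I fun t => ((hM t).1 t.2).2
  have hF : Function.Bijective F := by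
    constructor
    · intro t t' h
      exact Subtype.ext (eq_of_traceForms_eq ((hM t).1 t.2).1 ((hM t').1 t'.2).1
        (congrArg Subtype.val h))
    · rintro ⟨τ, hτ⟩
      obtain ⟨t, ht, h⟩ := exists_isSCyclic_of_isTwistedSymmetric (hI τ hτ)
      exact ⟨⟨t, (hM t).2 ⟨ht, h ▸ hτ⟩⟩, Subtype.ext h⟩
  refine ⟨⟨LinearEquiv.ofBijective F hF, fun t x f => apply_eq_traceForms t.1 f⟩, ?_, ?_⟩
  · rw [← hrank, (LinearEquiv.ofBijective F hF).finrank_eq]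
  · intro t ht ht0
    obtain ⟨hcyc, hmem⟩ := (hM t).1 ht
    refine traceNondegenerate_of_traceForms hcyc (hnd _ hmem fun h => ht0 ?_)
    exact eq_of_traceForms_eq hcyc ((hM 0).1 M.zero_mem).1 (h.trans (map_zero traceForms).symm)

theorem mem_rightModuleTraces_iff (t : TraceFamily k (twistR (H := H) α)) :
    t ∈ rightModuleTraces k (twistR α) H.Rep ↔
      IsSCyclic t ∧ traceForms (φ := H.autR α) t ∈ H.symmRightIntegrals := by
  refine and_congr_right fun ht => ?_
  rw [← isRightSymmetrised_iff_mem, ← trace_partialTraceR_iff ht]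
  rfl

theorem mem_leftModuleTraces_iff (t : TraceFamily k (twistL (H := H) α)) :
    t ∈ leftModuleTraces k (twistL α) H.Rep ↔
      IsSCyclic t ∧ traceForms (φ := H.autL α) t ∈ H.symmLeftIntegrals := by
  refine and_congr_right fun ht => ?_
  rw [← isLeftSymmetrised_iff_mem, ← trace_partialTraceL_iff ht]
  rfl

end PivotalHopfGCoalgebra

theorem mainTheorem1 {k : Type u} [Field k] {G : Type w} [Group G]
    (H : PivotalHopfGCoalgebra k G) [∀ x, FiniteDimensional k (H.A x)]
    (α : H.A 1 →ₐ[k] k) (hα : H.IsModulus α) :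
    ((∃ Φ : rightModuleTraces k (PivotalHopfGCoalgebra.twistR α) H.Rep ≃ₗ[k]
          H.symmRightIntegrals,
        ∀ (t : rightModuleTraces k (PivotalHopfGCoalgebra.twistR α) H.Rep) (x : G)
          (f : H.regularPmod x ⟶ (PivotalHopfGCoalgebra.twistR α).obj (H.regularPmod x)),
          t.1 (H.regularPmod x) f = (Φ t).1 x (PivotalHopfGCoalgebra.valueR f)) ∧
      Module.finrank k (rightModuleTraces k (PivotalHopfGCoalgebra.twistR α) H.Rep) = 1 ∧
      ∀ t ∈ rightModuleTraces k (PivotalHopfGCoalgebra.twistR α) H.Rep,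
        t ≠ 0 → TraceNondegenerate t) ∧
    ((∃ Φ : leftModuleTraces k (PivotalHopfGCoalgebra.twistL α) H.Rep ≃ₗ[k]
          H.symmLeftIntegrals,
        ∀ (t : leftModuleTraces k (PivotalHopfGCoalgebra.twistL α) H.Rep) (x : G)
          (f : H.regularPmod x ⟶ (PivotalHopfGCoalgebra.twistL α).obj (H.regularPmod x)),
          t.1 (H.regularPmod x) f = (Φ t).1 x (PivotalHopfGCoalgebra.valueL f)) ∧
      Module.finrank k (leftModuleTraces k (PivotalHopfGCoalgebra.twistL α) H.Rep) = 1 ∧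
      ∀ t ∈ leftModuleTraces k (PivotalHopfGCoalgebra.twistL α) H.Rep,
        t ≠ 0 → TraceNondegenerate t) := by
  obtain ⟨c, hc0, hc, hcα⟩ := hα
  constructor
  · refine PivotalHopfGCoalgebra.traces_of_forms (φ := H.autR α) _ _
      PivotalHopfGCoalgebra.mem_rightModuleTraces_iff ?_
      (PivotalHopfGCoalgebra.finrank_symmRightIntegrals hc hc0) ?_
    · intro τ hτ x q b
      obtain ⟨r, μ, hμ, h⟩ := PivotalHopfGCoalgebra.exists_eq_of_mem_symmRightIntegrals hc hc0 hτ
      rw [h, h, PivotalHopfGCoalgebra.rightDual_twisted hc hc0 hcα hμ]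
    · intro τ hτ hτ0 x b hb
      obtain ⟨r, μ, hμ, h⟩ := PivotalHopfGCoalgebra.exists_eq_of_mem_symmRightIntegrals hc hc0 hτ
      have hr : r ≠ 0 := by
        rintro rfl
        exact hτ0 (funext fun x => LinearMap.ext fun a => by simp [h])
      refine PivotalHopfGCoalgebra.rightDual_right_nondegenerate hcα hμ b fun a => ?_
      -- Replacing a by g⁻¹ a removes the pivot from the symmetrised form, leaving μ(a b).
      have := hb (((H.g x)⁻¹ : (H.A x)ˣ) * a)
      rw [h, mul_assoc, Units.mul_inv_cancel_left] at this
      exact (mul_eq_zero.1 this).resolve_left hr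
  · refine PivotalHopfGCoalgebra.traces_of_forms (φ := H.autL α) _ _
      PivotalHopfGCoalgebra.mem_leftModuleTraces_iff ?_
      (PivotalHopfGCoalgebra.finrank_symmLeftIntegrals hc hc0) ?_
    · intro τ hτ x q b
      obtain ⟨r, μ, hμ, h⟩ := PivotalHopfGCoalgebra.exists_eq_of_mem_symmLeftIntegrals hc hc0 hτ
      rw [h, h, PivotalHopfGCoalgebra.leftDual_twisted hc hc0 hcα hμ]
    · intro τ hτ hτ0 x b hb
      obtain ⟨r, μ, hμ, h⟩ := PivotalHopfGCoalgebra.exists_eq_of_mem_symmLeftIntegrals hc hc0 hτ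
      have hr : r ≠ 0 := by
        rintro rfl
        exact hτ0 (funext fun x => LinearMap.ext fun a => by simp [h])
      refine PivotalHopfGCoalgebra.leftDual_right_nondegenerate hcα hμ b fun a => ?_
      -- The left symmetrisation contains g⁻¹, so here the test element is g a.
      have := hb (H.g x * a)
      rw [h, mul_assoc, Units.inv_mul_cancel_left] at this
      exact (mul_eq_zero.1 this).resolve_left hr
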